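/- Let $d\ge 1$, let $N\ge 0$ be a real number, and let $f\in L^2(\mathbb R^d)$ be complex-valued. Let $\widehat f\in L^2(\mathbb R^d)$ be its ($L^2$-)Fourier transform, normalized by $\widehat f(y)=\int_{\mathbb R^d} f(t)e^{-2i\pi\langle t,y\rangle}\,dt$ for integrable $f$. Here $\langle\cdot,\cdot\rangle$ and $\|\cdot\|$ denote the Euclidean scalar product and norm. Then $$\iint_{\mathbb R^d\times\mathbb R^d}\frac{|f(x)|\,|\widehat f(y)|}{(1+\|x\|+\|y\|)^N}\,e^{2\pi|\langle x,y\rangle|}\,dx\,dy<+\infty$$ if and only if there exist a real symmetric positive definite $d\times d$ matrix $A$ and a polynomial $P$ on $\mathbb R^d$ with complex coefficients, of total degree $\deg P<\frac{N-d}{2}$ (with the convention $\deg 0=-\infty$), such that $$f(x)=P(x)\,e^{-\pi\langle Ax,x\rangle}\quad\text{for almost every }x\in\mathbb R^d.$$ In particular, if $N\le d$ and the above integral is finite, then $f=0$ (almost everywhere). -/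

import Mathlib

open MeasureTheory
open scoped FourierTransform ENNReal Matrix

/-- The integrand `|f(x)| |f̂(y)| (1 + ‖x‖ + ‖y‖)^(-N) e^{2π |⟨x, y⟩|}`, for functions `f` and `g = f̂`
on `ℝ^d`. -/
noncomputable def beurlingIntegrand {d : ℕ} (N : ℝ) (f g : EuclideanSpace ℝ (Fin d) → ℂ)
    (x y : EuclideanSpace ℝ (Fin d)) : ℝ :=
  ‖f x‖ * ‖g y‖ / (1 + ‖x‖ + ‖y‖) ^ N * Real.exp (2 * Real.pi * |inner ℝ x y|)

/-- The function `x ↦ P(x) e^{-π ⟨A x, x⟩}` on `ℝ^d`, where `P` is a polynomial with complex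
coefficients and `A` a real matrix. -/
noncomputable def polyGaussian {d : ℕ} (P : MvPolynomial (Fin d) ℂ) (A : Matrix (Fin d) (Fin d) ℝ)
    (x : EuclideanSpace ℝ (Fin d)) : ℂ :=
  MvPolynomial.eval (fun i => (x i : ℂ)) P *
    (Real.exp (-Real.pi * inner ℝ (Matrix.toEuclideanLin A x) x) : ℂ)

/-! Multiply `f` by a Gaussian: `h(x) = f(x) e^{-π‖x‖²}`. Its Fourier transform is entire of order
two, and at real points it is the convolution of the transform of `f` with a Gaussian. Inserting the
finite double integral into a product of two values gives the one estimate on which the direct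
implication rests (`exists_norm_fourierLaplace_mul_le`): `|ĥ(y)| |ĥ(uy)|` grows at most polynomially
in the real vector `y`, uniformly in complex `u` with `|Im u| ≤ 1`.

On a real line write `φ(ζ) = ĥ(ζy)`. Phragmén–Lindelöf, applied to a product with one factor
slightly rotated, shows that `φ(z) φ(iz)` is a polynomial (`exists_polynomial_eval_eq_mul_rotate`).
The zeros of `φ` are then finite in number, and removing them leaves the exponential of a quadratic
polynomial without linear term, so `φ(z) = P(z) e^{az²}` (`exists_polynomial_mul_gaussian`). Taking
`u = ε + i` in the estimate forces `a` to be real.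

To treat all directions at once, note that the Taylor coefficients of `ζ ↦ ĥ(ζz)` are homogeneous
polynomials in `z`. The exponent `a(z)` is a quotient of two such polynomials and is `O(‖z‖²)`,
hence is itself a quadratic form (`exists_mvPolynomial_mul_exp`). So `ĥ` is a polynomial times the
exponential of a real quadratic form, which must be negative definite because `ĥ` is in `L²`
(`posDef_of_memLp_polyGaussian`). Polynomial Gaussians are stable under Fourier inversion, so `h`,
and then `f`, is of the same kind.

The degree condition comes from an explicit formula. If `f = P e^{-π⟨Ax,x⟩}`, its transform is `S
e^{-π⟨A⁻¹y,y⟩}` with `deg S = deg P = m`, and completing the square at `y = Ax + v` turns the main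
exponential factor into `e^{-π⟨A⁻¹v,v⟩}`. What remains is of size `‖x‖^{2m-N}` at infinity in `x`,
which is integrable on `ℝ^d` exactly when `2m + d < N`. Both directions make this precise, the lower
bound through Fatou's lemma along dilations. -/

/-! ### Entire functions of polynomial growth and of order two. -/

/-- The Taylor coefficients at `0` of an entire function of polynomial growth of order `n` vanish
beyond `n`. -/
lemma iteratedDeriv_zero_eq_zero_of_polynomial_growth {F : ℂ → ℂ} (hF : Differentiable ℂ F)
    {C : ℝ} {n : ℕ} (hb : ∀ z, ‖F z‖ ≤ C * (1 + ‖z‖) ^ n) {k : ℕ} (hk : n < k) :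
    iteratedDeriv k F 0 = 0 := by
  -- Cauchy's estimate on the circle of radius `R` gives `O(R^{n-k})`, which is `O(R⁻¹)` since `k ≥
  -- n + 1`.
  have hbd : ∀ R : ℝ, 1 ≤ R →
      ‖iteratedDeriv k F 0‖ ≤ k.factorial * |C| * 2 ^ n * R⁻¹ := by
    intro R hR
    have hR0 : 0 < R := by linarith
    have h := Complex.norm_iteratedDeriv_le_of_forall_mem_sphere_norm_le (c := 0) (R := R)
      (C := |C| * (2 * R) ^ n) k hR0 hF.diffContOnCl (fun z hz => by
        have hz' : ‖z‖ = R := by simpa using hz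
        refine (hb z).trans ?_
        rw [hz']
        gcongr
        · exact le_abs_self C
        · linarith)
    refine h.trans ?_
    rw [div_le_iff₀ (by positivity), mul_pow]
    obtain ⟨j, rfl⟩ := Nat.exists_eq_add_of_lt hk
    have hj : R ^ n ≤ R⁻¹ * R ^ (n + j + 1) := by
      rw [pow_succ, mul_comm, mul_assoc, mul_inv_cancel₀ hR0.ne', mul_one]
      exact pow_le_pow_right₀ hR (by omega)
    calc ((n + j + 1).factorial : ℝ) * (|C| * (2 ^ n * R ^ n))
        = (n + j + 1).factorial * |C| * 2 ^ n * R ^ n := by ring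
      _ ≤ (n + j + 1).factorial * |C| * 2 ^ n * (R⁻¹ * R ^ (n + j + 1)) := by gcongr
      _ = _ := by ring
  have hlim : Filter.Tendsto (fun R : ℝ => k.factorial * |C| * 2 ^ n * R⁻¹) Filter.atTop
      (nhds (k.factorial * |C| * 2 ^ n * 0)) := tendsto_inv_atTop_zero.const_mul _
  rw [mul_zero] at hlim
  have := ge_of_tendsto hlim ((Filter.eventually_ge_atTop 1).mono hbd)
  simpa using this

lemma exists_polynomial_of_iteratedDeriv_eq_zero {F : ℂ → ℂ} (hF : Differentiable ℂ F) {n : ℕ}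
    (h : ∀ k, n < k → iteratedDeriv k F 0 = 0) :
    ∃ p : Polynomial ℂ, p.natDegree ≤ n ∧ ∀ z, F z = p.eval z := by
  refine ⟨∑ k ∈ Finset.range (n + 1),
    Polynomial.C ((k.factorial : ℂ)⁻¹ * iteratedDeriv k F 0) * Polynomial.X ^ k, ?_, fun z => ?_⟩
  · refine Polynomial.natDegree_sum_le_of_forall_le _ _ (fun k hk => ?_)
    exact (Polynomial.natDegree_C_mul_X_pow_le _ _).trans (by simp at hk; omega)
  · have h1 := Complex.hasSum_taylorSeries_of_entire hF 0 z
    have h2 := hasSum_sum_of_ne_finset_zero (s := Finset.range (n + 1))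
      (f := fun k => ((k.factorial : ℂ))⁻¹ • (z - 0) ^ k • iteratedDeriv k F 0)
      (L := SummationFilter.unconditional ℕ) (fun k hk => by
        simp at hk; simp [h k (by omega)])
    rw [h1.unique h2, Polynomial.eval_finsetSum]
    refine Finset.sum_congr rfl fun k _ => ?_
    simp; ring

/-- An entire function of polynomial growth is a polynomial. -/
lemma exists_polynomial_of_polynomial_growth {F : ℂ → ℂ} (hF : Differentiable ℂ F)
    {C : ℝ} {n : ℕ} (hb : ∀ z, ‖F z‖ ≤ C * (1 + ‖z‖) ^ n) :
    ∃ p : Polynomial ℂ, p.natDegree ≤ n ∧ ∀ z, F z = p.eval z :=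
  exists_polynomial_of_iteratedDeriv_eq_zero hF
    fun _ hk => iteratedDeriv_zero_eq_zero_of_polynomial_growth hF hb hk

/-- The logarithm is a primitive of `φ'/φ`, normalized at `0`; multiplying `φ` by the exponential of
its opposite gives zero derivative. -/
lemma exists_entire_log {φ : ℂ → ℂ} (hφ : Differentiable ℂ φ) (h0 : ∀ z, φ z ≠ 0) :
    ∃ h : ℂ → ℂ, Differentiable ℂ h ∧ ∀ z, φ z = Complex.exp (h z) := by
  have hd : Differentiable ℂ (fun z => deriv φ z / φ z) :=
    (hφ.contDiff (n := 2)).differentiable_deriv_two.div hφ h0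
  obtain ⟨g, hg0, hg⟩ := hd.isExactOn_univ.with_val_at 0 (Complex.log (φ 0))
  have hg' : ∀ z, HasDerivAt g (deriv φ z / φ z) z := fun z => hg z (Set.mem_univ z)
  refine ⟨g, fun z => (hg' z).differentiableAt, fun z => ?_⟩
  have hconst : ∀ z, HasDerivAt (fun z => φ z * Complex.exp (-g z)) 0 z := fun z => by
    have := (hφ z).hasDerivAt.mul ((hg' z).neg.cexp)
    convert! this using 1
    field_simp [h0 z]
    ring
  have := is_const_of_deriv_eq_zero (f := fun z => φ z * Complex.exp (-g z))
    (fun z => (hconst z).differentiableAt) (fun z => (hconst z).deriv) z 0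
  simp only [hg0, Complex.exp_neg, Complex.exp_log (h0 0), mul_inv_cancel₀ (h0 0)] at this
  rwa [mul_inv_eq_one₀ (Complex.exp_ne_zero _)] at this

/-- An entire function whose real part is `O(|z|²)` is a polynomial of degree at most two. -/
lemma exists_quadratic_of_re_le {h : ℂ → ℂ} (hh : Differentiable ℂ h) {C : ℝ}
    (hb : ∀ z, (h z).re ≤ C * (1 + ‖z‖) ^ 2) :
    ∃ p : Polynomial ℂ, p.natDegree ≤ 2 ∧ ∀ z, h z = p.eval z := by
  refine exists_polynomial_of_polynomial_growth hh (C := 8 * (|C| + 1) + 3 * ‖h 0‖) (n := 2) ?_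
  intro z
  have hz := norm_nonneg z
  -- At this radius `R - ‖z‖ = ‖z‖ + 1` is comparable to `R`, so Borel–Carathéodory costs only a
  -- constant factor.
  set R := 2 * ‖z‖ + 1 with hR
  have hM : 0 < (|C| + 1) * (1 + R) ^ 2 := by positivity
  have h1 := Complex.borelCaratheodory (f := h) (M := (|C| + 1) * (1 + R) ^ 2) (R := R) (z := z)
    hM hh.differentiableOn (fun w hw => ?_) (by positivity) (by simp [hR]; linarith)
  · refine h1.trans ?_
    have e : R - ‖z‖ = ‖z‖ + 1 := by rw [hR]; ring
    have e2 : R + ‖z‖ ≤ 3 * (1 + ‖z‖) := by rw [hR]; linarith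
    have e3 : 1 + R = 2 * (1 + ‖z‖) := by rw [hR]; ring
    rw [e, e3, ← add_div, div_le_iff₀ (by positivity)]
    have h0 := norm_nonneg (h 0)
    have hC := abs_nonneg C
    calc 2 * ((|C| + 1) * (2 * (1 + ‖z‖)) ^ 2) * ‖z‖ + ‖h 0‖ * (R + ‖z‖)
        ≤ 2 * ((|C| + 1) * (2 * (1 + ‖z‖)) ^ 2) * (‖z‖ + 1)
          + ‖h 0‖ * (3 * (1 + ‖z‖) ^ 3) := by
          gcongr
          · linarith
          · refine e2.trans ?_
            gcongr
            exact le_self_pow₀ (by linarith) (by norm_num)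
      _ = _ := by ring
  · have hw' : ‖w‖ < R := by simpa using hw
    refine (hb w).trans ?_
    gcongr
    · exact (le_abs_self C).trans (by linarith)

/-- Along the ray the polynomial would tend to zero, which only the zero polynomial does. -/
lemma norm_eval_eq_zero_of_forall_exp {P : Polynomial ℂ} {c C : ℝ} (hc : 0 < c) {θ : ℂ} (hθ : θ ≠ 0)
    (h : ∀ r : ℝ, 0 ≤ r → ‖P.eval (r * θ)‖ * Real.exp (c * r ^ 2) ≤ C) : P = 0 := by
  have h2 : Filter.Tendsto (fun r : ℝ => ‖(P.comp (Polynomial.C θ * Polynomial.X)).eval (r : ℂ)‖)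
      Filter.atTop (nhds 0) := by
    have : Filter.Tendsto (fun r : ℝ => |C| * (Real.exp (c * r ^ 2))⁻¹) Filter.atTop
        (nhds (|C| * 0)) := by
      refine Filter.Tendsto.const_mul _ (Filter.Tendsto.inv_tendsto_atTop ?_)
      exact Real.tendsto_exp_atTop.comp
        (Filter.Tendsto.const_mul_atTop hc (Filter.tendsto_pow_atTop (by norm_num)))
    rw [mul_zero] at this
    refine squeeze_zero' (Filter.Eventually.of_forall fun _ => norm_nonneg _) ?_ this
    filter_upwards [Filter.eventually_ge_atTop 0] with r hr
    rw [← div_eq_mul_inv, le_div_iff₀ (Real.exp_pos _)]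
    have := (h r hr).trans (le_abs_self C)
    simpa [mul_comm θ] using this
  set p := P.comp (Polynomial.C θ * Polynomial.X) with hp
  have hp0 : p = 0 := by
    by_contra hne
    have hlead : 0 < p.degree ∨ p.degree ≤ 0 := lt_or_ge _ _
    rcases hlead with hd | hd
    · have h3 : Filter.Tendsto (fun r : ℝ => ‖p.eval (r : ℂ)‖) Filter.atTop Filter.atTop := by
        refine Polynomial.tendsto_norm_atTop p hd ?_
        simpa using Filter.tendsto_abs_atTop_atTop
      exact not_tendsto_nhds_of_tendsto_atTop h3 _ h2
    · rw [Polynomial.eq_C_of_degree_le_zero hd] at h2 hne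
      simp only [Polynomial.eval_C] at h2
      have := tendsto_nhds_unique h2 tendsto_const_nhds
      apply hne
      rw [norm_eq_zero.1 this.symm, Polynomial.C_0]
  apply Polynomial.funext
  intro z
  have := congrArg (Polynomial.eval (z / θ)) hp0
  simpa [hp, mul_div_cancel₀ _ hθ, Polynomial.eval_comp] using this

/-- The Gaussian exponent of an entire function `P(z) e^{a z²}` is bounded by its growth. -/
lemma norm_le_of_gaussian_growth {P : Polynomial ℂ} (hP : P ≠ 0) {a : ℂ} {C c : ℝ}
    (hb : ∀ z, ‖P.eval z * Complex.exp (a * z ^ 2)‖ ≤ C * Real.exp (c * ‖z‖ ^ 2)) : ‖a‖ ≤ c := by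
  by_contra! hlt
  -- The direction of steepest growth: here `a θ² = ‖a‖`, so the Gaussian factor has modulus `e^{‖a‖
  -- r²}`.
  set θ : ℂ := Complex.exp (-(a.arg / 2 : ℝ) * Complex.I) with hθ
  have hθ1 : ‖θ‖ = 1 := by
    rw [hθ]; exact_mod_cast Complex.norm_exp_ofReal_mul_I (-(a.arg / 2))
  have hθa : a * θ ^ 2 = ‖a‖ := by
    have h1 : θ ^ 2 = Complex.exp (-(a.arg * Complex.I)) := by
      rw [hθ, ← Complex.exp_nat_mul]; congr 1; push_cast; ring
    conv_lhs => rw [← Complex.norm_mul_exp_arg_mul_I a]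
    rw [h1, mul_assoc, ← Complex.exp_add]; simp
  refine hP (norm_eval_eq_zero_of_forall_exp (sub_pos.2 hlt) (θ := θ) (C := C)
    (by rw [hθ]; exact Complex.exp_ne_zero _) (fun r hr => ?_))
  have h1 := hb (r * θ)
  have h2 : a * (r * θ) ^ 2 = ((‖a‖ * r ^ 2 : ℝ) : ℂ) := by
    rw [mul_pow, mul_left_comm, hθa]; push_cast; ring
  rw [norm_mul, h2, Complex.norm_exp_ofReal, norm_mul, hθ1] at h1
  simp only [Complex.norm_real, mul_one, Real.norm_eq_abs, sq_abs] at h1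
  rw [sub_mul, Real.exp_sub, ← mul_div_assoc, div_le_iff₀ (Real.exp_pos _)]
  exact h1

lemma exists_eval_eq_of_mul_eq {ψ : ℂ → ℂ} (hψ : Continuous ψ) {D : Polynomial ℂ} {ρ : ℂ}
    (h : ∀ z, (z - ρ) * ψ z = D.eval z) :
    ∃ D' : Polynomial ℂ, D = (Polynomial.X - Polynomial.C ρ) * D' ∧ ∀ z, ψ z = D'.eval z := by
  have hroot : D.IsRoot ρ := by simp [Polynomial.IsRoot, ← h ρ]
  obtain ⟨D', rfl⟩ := Polynomial.dvd_iff_isRoot.2 hroot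
  refine ⟨D', rfl, fun z => ?_⟩
  have hd : Dense {z : ℂ | z ≠ ρ} := dense_compl_singleton ρ
  refine congrFun (Continuous.ext_on hd hψ D'.continuous (fun z hz => ?_)) z
  have := h z
  simp only [Polynomial.eval_mul, Polynomial.eval_sub, Polynomial.eval_X,
    Polynomial.eval_C] at this
  exact mul_left_cancel₀ (sub_ne_zero.2 hz) this

lemma differentiable_dslope {φ : ℂ → ℂ} (hφ : Differentiable ℂ φ) (ρ : ℂ) :
    Differentiable ℂ (dslope φ ρ) := by
  rw [← differentiableOn_univ] at hφ ⊢
  exact (Complex.differentiableOn_dslope Filter.univ_mem).2 hφ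

/-- Away from `ρ`, division by `z - ρ` decreases the modulus; near `ρ` compactness suffices. The
rate `c` is unchanged, so zeros can be removed repeatedly at a fixed rate. -/
lemma dslope_growth {φ : ℂ → ℂ} (hφ : Differentiable ℂ φ) {ρ : ℂ} (h0 : φ ρ = 0) {C c : ℝ}
    (hc : 0 ≤ c) (hb : ∀ z, ‖φ z‖ ≤ C * Real.exp (c * ‖z‖ ^ 2)) :
    ∃ C', ∀ z, ‖dslope φ ρ z‖ ≤ C' * Real.exp (c * ‖z‖ ^ 2) := by
  obtain ⟨B, hB⟩ := (isCompact_closedBall ρ 1).exists_bound_of_continuousOn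
    (differentiable_dslope hφ ρ).continuous.continuousOn
  refine ⟨max C B, fun z => ?_⟩
  rcases le_total (dist z ρ) 1 with hz | hz
  · have hB0 : 0 ≤ B := (norm_nonneg _).trans (hB z hz)
    have h1 : 1 ≤ Real.exp (c * ‖z‖ ^ 2) := Real.one_le_exp (by positivity)
    refine (hB z hz).trans ((le_mul_of_one_le_right hB0 h1).trans ?_)
    gcongr
    exact le_max_right _ _
  · have hne : z ≠ ρ := by rintro rfl; simp at hz; linarith
    rw [dslope_of_ne _ hne, slope_def_field, h0, sub_zero, norm_div, ← dist_eq_norm z ρ]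
    refine (div_le_self (norm_nonneg _) hz).trans ((hb z).trans ?_)
    gcongr
    exact le_max_left _ _

/-- An entire function of order two for which `φ(z) φ(iz)` is a nonzero polynomial is the product
of a polynomial and a Gaussian. -/
lemma exists_polynomial_mul_gaussian {φ : ℂ → ℂ} (hφ : Differentiable ℂ φ) {C c : ℝ} (hc : 0 ≤ c)
    (hb : ∀ z, ‖φ z‖ ≤ C * Real.exp (c * ‖z‖ ^ 2)) {D : Polynomial ℂ} (hD0 : D ≠ 0)
    (hD : ∀ z, φ z * φ (Complex.I * z) = D.eval z) :
    ∃ (P : Polynomial ℂ) (a : ℂ), P ≠ 0 ∧ ∀ z, φ z = P.eval z * Complex.exp (a * z ^ 2) := by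
  induction hn : D.natDegree using Nat.strong_induction_on generalizing φ C D with
  | _ n ih =>
  by_cases hz : ∃ ρ, φ ρ = 0
  · obtain ⟨ρ, hρ⟩ := hz
    have hmul : ∀ z, φ z = (z - ρ) * dslope φ ρ z := fun z => by
      have := sub_smul_dslope φ ρ z
      rw [hρ, sub_zero, smul_eq_mul] at this
      exact this.symm
    have hd := differentiable_dslope hφ ρ
    obtain ⟨C', hC'⟩ := dslope_growth hφ hρ hc hb
    have hcont := hd.continuous
    -- A zero `ρ` of `φ` contributes the roots `ρ` and `-iρ` to `D`. Dividing them out one after the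
    -- other also covers `ρ = 0`, and lowers the degree by two in the relation for `φ(z)/(z - ρ)`.
    obtain ⟨D1, rfl, hD1⟩ := exists_eval_eq_of_mul_eq
      (ψ := fun z => dslope φ ρ z * ((Complex.I * z - ρ) * dslope φ ρ (Complex.I * z)))
      (by fun_prop) (D := D) (ρ := ρ) (fun z => by rw [← hD z, hmul z, hmul (Complex.I * z)]; ring)
    obtain ⟨D2, rfl, hD2⟩ := exists_eval_eq_of_mul_eq
      (ψ := fun z => Complex.I * (dslope φ ρ z * dslope φ ρ (Complex.I * z)))
      (by fun_prop) (D := D1) (ρ := -Complex.I * ρ) (fun z => by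
        rw [← hD1 z]
        linear_combination (ρ * dslope φ ρ z * dslope φ ρ (Complex.I * z)) * Complex.I_sq)
    have hD20 : D2 ≠ 0 := by rintro rfl; simp at hD0
    have hdeg : (Polynomial.C (-Complex.I) * D2).natDegree < n := by
      rw [← hn, Polynomial.natDegree_mul (Polynomial.X_sub_C_ne_zero _)
        (mul_ne_zero (Polynomial.X_sub_C_ne_zero _) hD20),
        Polynomial.natDegree_mul (Polynomial.X_sub_C_ne_zero _) hD20,
        Polynomial.natDegree_C_mul (by simp), Polynomial.natDegree_X_sub_C,
        Polynomial.natDegree_X_sub_C]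
      omega
    obtain ⟨P, a, hP, hPa⟩ := ih _ hdeg hd hC' (D := Polynomial.C (-Complex.I) * D2)
      (mul_ne_zero (by simp) hD20) (fun z => by
        rw [Polynomial.eval_mul, ← hD2 z, Polynomial.eval_C]
        linear_combination (dslope φ ρ z * dslope φ ρ (Complex.I * z)) * Complex.I_sq) rfl
    refine ⟨(Polynomial.X - Polynomial.C ρ) * P, a,
      mul_ne_zero (Polynomial.X_sub_C_ne_zero _) hP, fun z => ?_⟩
    rw [hmul z, hPa z]
    simp [mul_assoc]
  · push Not at hz
    obtain ⟨h, hh, hexp⟩ := exists_entire_log hφ hz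
    have hC : 0 < C := by
      have := (norm_pos_iff.2 (hz 0)).trans_le (hb 0)
      exact pos_of_mul_pos_left this (Real.exp_pos _).le
    obtain ⟨q, hq, hqe⟩ := exists_quadratic_of_re_le hh (C := |Real.log C| + c) (fun z => by
      have h1 := hb z
      rw [hexp z, Complex.norm_exp, ← Real.le_log_iff_exp_le (by positivity),
        Real.log_mul hC.ne' (Real.exp_ne_zero _), Real.log_exp] at h1
      refine h1.trans ?_
      have := norm_nonneg z
      have h2 : 1 ≤ (1 + ‖z‖) ^ 2 := one_le_pow₀ (by linarith)
      rw [add_mul]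
      gcongr ?_ + c * ?_ ^ 2
      · exact (le_abs_self _).trans (le_mul_of_one_le_right (abs_nonneg _) h2)
      · linarith)
    set b := q.coeff 1 with hb'
    set a := q.coeff 2 with ha'
    have hqz : ∀ z, q.eval z = q.coeff 0 + b * z + a * z ^ 2 := fun z => by
      rw [Polynomial.eval_eq_sum_range' (n := 3) (by omega)]
      simp [Finset.sum_range_succ, hb', ha']
    have hDroot : ∀ z, D.eval z ≠ 0 := fun z => by
      rw [← hD z]; exact mul_ne_zero (hz _) (hz _)
    have hDdeg : D.degree = 0 := by
      by_contra hne
      obtain ⟨z, hz'⟩ := Complex.exists_root (f := D) (by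
        rw [Polynomial.degree_eq_natDegree hD0] at hne ⊢
        exact_mod_cast Nat.pos_of_ne_zero (by exact_mod_cast hne))
      exact hDroot z hz'
    have hDconst : ∀ z, D.eval z = D.eval 0 := fun z => by
      rw [Polynomial.eq_C_of_degree_eq_zero hDdeg]; simp
    -- Without zeros `D` is constant. In the exponent of `φ(z) φ(iz)` the quadratic terms cancel and
    -- the linear ones add up to `(1 + i) b z`.
    have hsum : ∀ z, Complex.exp ((1 + Complex.I) * b * z) = 1 := fun z => by
      have h1 := hDconst z
      rw [← hD z, ← hD 0, hexp, hexp, hexp, hexp, hqe, hqe, hqe, hqe, hqz, hqz, hqz, hqz,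
        ← Complex.exp_add, ← Complex.exp_add] at h1
      have h2 : q.coeff 0 + b * z + a * z ^ 2 +
          (q.coeff 0 + b * (Complex.I * z) + a * (Complex.I * z) ^ 2) =
          (q.coeff 0 + b * 0 + a * 0 ^ 2 +
          (q.coeff 0 + b * (Complex.I * 0) + a * (Complex.I * 0) ^ 2)) +
          (1 + Complex.I) * b * z := by
        linear_combination (a * z ^ 2) * Complex.I_sq
      rw [h2, Complex.exp_add] at h1
      exact mul_left_cancel₀ (Complex.exp_ne_zero _) (h1.trans (mul_one _).symm)
    have hb0 : b = 0 := by
      have h1 : HasDerivAt (fun z => Complex.exp ((1 + Complex.I) * b * z))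
          (Complex.exp ((1 + Complex.I) * b * 0) * ((1 + Complex.I) * b * 1)) 0 :=
        ((hasDerivAt_id (0 : ℂ)).const_mul ((1 + Complex.I) * b)).cexp
      have h2 : HasDerivAt (fun z => Complex.exp ((1 + Complex.I) * b * z)) 0 0 := by
        simp only [hsum]; exact hasDerivAt_const _ _
      have h3 := h1.unique h2
      have h4 : (1 + Complex.I) ≠ 0 := fun h => by simpa using congrArg Complex.re h
      simpa [h4] using h3
    refine ⟨Polynomial.C (Complex.exp (q.coeff 0)), a, by simp, fun z => ?_⟩
    rw [hexp, hqe, hqz, hb0, Polynomial.eval_C, ← Complex.exp_add]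
    ring_nf

/-! ### Phragmén–Lindelöf for products, and the resulting one-variable constraints. -/

lemma one_add_norm_le_two_mul_norm_one_add {w : ℂ} (hw : 0 ≤ w.re) : 1 + ‖w‖ ≤ 2 * ‖1 + w‖ := by
  have h1 : 1 ≤ ‖1 + w‖ := by
    have := Complex.re_le_norm (1 + w)
    simp at this; linarith
  have h2 : ‖w‖ ≤ ‖1 + w‖ := by
    rw [← sq_le_sq₀ (norm_nonneg _) (norm_nonneg _), Complex.sq_norm, Complex.sq_norm,
      Complex.normSq_apply, Complex.normSq_apply]
    simp; nlinarith
  linarith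

/-- Phragmén–Lindelöf in a sector of opening less than `π / 2`, for functions of order two with
polynomial growth on the edges. -/
lemma norm_le_of_sector {Ψ : ℂ → ℂ} (hΨ : Differentiable ℂ Ψ) {α A B C : ℝ} {K : ℕ} (hα : 0 < α)
    (hα' : α < Real.pi / 2) (hgr : ∀ z, ‖Ψ z‖ ≤ A * Real.exp (B * ‖z‖ ^ 2))
    (h1 : ∀ ρ : ℝ, 0 ≤ ρ → ‖Ψ (ρ * Complex.exp (α * Complex.I))‖ ≤ C * (1 + ρ) ^ K)
    (h2 : ∀ ρ : ℝ, 0 ≤ ρ → ‖Ψ (ρ * Complex.I)‖ ≤ C * (1 + ρ) ^ K)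
    {ρ θ : ℝ} (hρ : 0 < ρ) (hθ : α ≤ θ) (hθ' : θ ≤ Real.pi / 2) :
    ‖Ψ (ρ * Complex.exp (θ * Complex.I))‖ ≤ C * 2 ^ K * (1 + ρ) ^ K := by
  have hre : ∀ ζ : ℂ, α ≤ ζ.im → ζ.im ≤ Real.pi / 2 → 0 ≤ (Complex.exp ζ).re := fun ζ ha hb => by
    rw [Complex.exp_re]
    exact mul_nonneg (Real.exp_pos _).le (Real.cos_nonneg_of_neg_pi_div_two_le_of_le
      (by linarith) hb)
  have hne : ∀ ζ : ℂ, α ≤ ζ.im → ζ.im ≤ Real.pi / 2 → 1 + Complex.exp ζ ≠ 0 :=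
    fun ζ ha hb h => by
      have := hre ζ ha hb
      have h' := congrArg Complex.re h
      simp only [Complex.add_re, Complex.one_re, Complex.zero_re] at h'
      linarith
  -- In logarithmic coordinates the sector is a strip. Dividing by `(1 + w)^K`, with `|1 + w|`
  -- comparable to `1 + |w|` in the right half-plane, turns polynomial edge bounds into constant
  -- ones.
  set f : ℂ → ℂ := fun ζ => Ψ (Complex.exp ζ) / (1 + Complex.exp ζ) ^ K with hf
  have hcl : closure (Complex.im ⁻¹' Set.Ioo α (Real.pi / 2)) ⊆
      Complex.im ⁻¹' Set.Icc α (Real.pi / 2) :=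
    closure_minimal (Set.preimage_mono Set.Ioo_subset_Icc_self)
      (isClosed_Icc.preimage Complex.continuous_im)
  have hdiff : DiffContOnCl ℂ f (Complex.im ⁻¹' Set.Ioo α (Real.pi / 2)) := by
    refine DifferentiableOn.diffContOnCl fun ζ hζ => ?_
    have hζ' := hcl hζ
    refine DifferentiableAt.differentiableWithinAt ?_
    refine DifferentiableAt.div ((hΨ _).comp ζ Complex.differentiableAt_exp) ?_
      (pow_ne_zero _ (hne ζ hζ'.1 hζ'.2))
    fun_prop
  have hfn : ∀ ζ, ‖f ζ‖ = ‖Ψ (Complex.exp ζ)‖ / ‖1 + Complex.exp ζ‖ ^ K := fun ζ => by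
    simp [hf, norm_pow]
  have hedge : ∀ ζ : ℂ, α ≤ ζ.im → ζ.im ≤ Real.pi / 2 →
      ‖Ψ (Complex.exp ζ)‖ ≤ C * (1 + ‖Complex.exp ζ‖) ^ K → ‖f ζ‖ ≤ C * 2 ^ K := by
    intro ζ ha hb h
    have hC : 0 ≤ C := by
      have := (norm_nonneg _).trans (h1 0 le_rfl)
      simpa using this
    rw [hfn, div_le_iff₀ (pow_pos (norm_pos_iff.2 (hne ζ ha hb)) _), mul_assoc, ← mul_pow]
    refine h.trans ?_
    gcongr
    exact one_add_norm_le_two_mul_norm_one_add (hre ζ ha hb)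
  have hexp : ∀ ζ : ℂ, Complex.exp ζ = (Real.exp ζ.re : ℝ) * Complex.exp (ζ.im * Complex.I) := by
    intro ζ
    conv_lhs => rw [← Complex.re_add_im ζ, Complex.exp_add]
    push_cast; rfl
  have key := PhragmenLindelof.horizontal_strip (f := f) (a := α) (b := Real.pi / 2)
    (C := C * 2 ^ K) (z := Real.log ρ + θ * Complex.I) hdiff ?_ ?_ ?_ (by simpa using hθ)
    (by simpa using hθ')
  · have he : Complex.exp (Real.log ρ + θ * Complex.I) = ρ * Complex.exp (θ * Complex.I) := by
      rw [Complex.exp_add, ← Complex.ofReal_exp, Real.exp_log hρ]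
    have hn : ‖(ρ : ℂ) * Complex.exp (θ * Complex.I)‖ = ρ := by
      rw [norm_mul, Complex.norm_exp_ofReal_mul_I, mul_one, Complex.norm_real,
        Real.norm_of_nonneg hρ.le]
    have hi : (Real.log ρ + θ * Complex.I : ℂ).im = θ := by simp
    rw [hfn, div_le_iff₀ (pow_pos (norm_pos_iff.2 (hne _ (by rw [hi]; exact hθ)
      (by rw [hi]; exact hθ'))) _), he] at key
    refine key.trans ?_
    have hC : 0 ≤ C := by
      have := (norm_nonneg _).trans (h1 0 le_rfl)
      simpa using this
    gcongr
    refine (norm_add_le _ _).trans ?_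
    rw [hn, norm_one]
  -- Growth of order two is admissible in a strip of width `π/2 - α` because `2 < π/(π/2 - α)`; this
  -- is where `0 < α` is needed.
  · refine ⟨2, ?_, |B|, Asymptotics.IsBigO.of_bound |A| ?_⟩
    · rw [lt_div_iff₀ (by linarith)]; linarith
    · refine Filter.eventually_inf_principal.2 (Filter.Eventually.of_forall fun ζ hζ => ?_)
      have h1n : 1 ≤ ‖1 + Complex.exp ζ‖ := by
        have h1 := Complex.re_le_norm (1 + Complex.exp ζ)
        have h2 := hre ζ hζ.1.le hζ.2.le
        simp only [Complex.add_re, Complex.one_re] at h1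
        linarith
      rw [hfn, Real.norm_of_nonneg (Real.exp_pos _).le]
      refine (div_le_self (norm_nonneg _) (one_le_pow₀ h1n)).trans ((hgr _).trans ?_)
      rw [Complex.norm_exp, ← Real.exp_nat_mul]
      push_cast
      gcongr
      · exact le_abs_self A
      · exact le_abs_self B
      · exact le_abs_self _
  · intro ζ hζ
    refine hedge ζ hζ.ge (by linarith) ?_
    have := h1 (Real.exp ζ.re) (Real.exp_pos _).le
    rw [Complex.norm_exp]
    rwa [← hζ, ← hexp] at this
  · intro ζ hζ
    refine hedge ζ (by linarith) hζ.le ?_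
    have := h2 (Real.exp ζ.re) (Real.exp_pos _).le
    rw [Complex.norm_exp]
    have hI : Complex.I = Complex.exp (ζ.im * Complex.I) := by
      rw [hζ]; push_cast; exact Complex.exp_pi_div_two_mul_I.symm
    rwa [hI, ← hexp] at this

/-- Phragmén–Lindelöf at the critical opening: a product of two entire functions of order two grows
polynomially in the first quadrant if it does so along suitable pairs of rays. -/
lemma norm_mul_le_of_quadrant {E F : ℂ → ℂ} (hE : Differentiable ℂ E)
    (hF : Differentiable ℂ F) {A B C : ℝ} {K : ℕ}
    (hEgr : ∀ z, ‖E z‖ ≤ A * Real.exp (B * ‖z‖ ^ 2))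
    (hFgr : ∀ z, ‖F z‖ ≤ A * Real.exp (B * ‖z‖ ^ 2))
    (h1 : ∀ u : ℂ, ‖u‖ = 1 → ∀ r : ℝ, 0 ≤ r → ‖E r‖ * ‖F (u * r)‖ ≤ C * (1 + r) ^ K)
    (h2 : ∀ u : ℂ, ‖u‖ = 1 → ∀ r : ℝ, 0 ≤ r → ‖E (u * r)‖ * ‖F (Complex.I * r)‖ ≤ C * (1 + r) ^ K)
    {z : ℂ} (hre : 0 ≤ z.re) (him : 0 ≤ z.im) :
    ‖E z * F z‖ ≤ C * 2 ^ K * (1 + ‖z‖) ^ K := by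
  have hEc := hE.continuous
  have hC : 0 ≤ C := by
    have := h1 1 (by simp) 0 le_rfl
    simp only [add_zero, one_pow, mul_one] at this
    exact le_trans (by positivity) this
  have hA : 0 ≤ A := by
    have := (norm_nonneg _).trans (hEgr 0)
    simpa using this
  -- The quadrant is the critical opening for order two, so it is replaced by the sector from `α` to
  -- `π/2`. Rotating `E` by `-α` puts its argument on the positive axis along the lower edge, while
  -- `F` stays on the imaginary axis along the upper one; the hypotheses then bound both edges
  -- uniformly in `α`.
  set Φ : ℝ → ℂ → ℂ := fun α w => E (Complex.exp (-α * Complex.I) * w) * F w with hΦ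
  have hexpn : ∀ α : ℝ, ‖Complex.exp (-α * Complex.I)‖ = 1 := fun α => by
    exact_mod_cast Complex.norm_exp_ofReal_mul_I (-α)
  have hexpn' : ∀ α : ℝ, ‖Complex.exp (α * Complex.I)‖ = 1 := Complex.norm_exp_ofReal_mul_I
  have hΦd : ∀ α, Differentiable ℂ (Φ α) := fun α =>
    (hE.comp (differentiable_id.const_mul _)).mul hF
  have hedge1 : ∀ α ρ : ℝ, 0 ≤ ρ →
      ‖Φ α (ρ * Complex.exp (α * Complex.I))‖ ≤ C * (1 + ρ) ^ K := fun α ρ hρ => by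
    refine le_trans (le_of_eq ?_) (h1 _ (hexpn' α) ρ hρ)
    have e1 : Complex.exp (-α * Complex.I) * (ρ * Complex.exp (α * Complex.I)) = ρ := by
      have : Complex.exp (-α * Complex.I) * Complex.exp (α * Complex.I) = 1 := by
        rw [← Complex.exp_add]; simp
      linear_combination (ρ : ℂ) * this
    simp only [hΦ]
    rw [e1, norm_mul, mul_comm (ρ : ℂ)]
  have hedge2 : ∀ α ρ : ℝ, 0 ≤ ρ → ‖Φ α (ρ * Complex.I)‖ ≤ C * (1 + ρ) ^ K := fun α ρ hρ => by
    refine le_trans (le_of_eq ?_)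
      (h2 (Complex.exp (-α * Complex.I) * Complex.I) (by rw [norm_mul, hexpn]; simp) ρ hρ)
    simp only [hΦ]
    rw [norm_mul, mul_comm (ρ : ℂ), mul_assoc]
  have hgr : ∀ α w, ‖Φ α w‖ ≤ A * A * Real.exp ((2 * B) * ‖w‖ ^ 2) := fun α w => by
    have h3 := hEgr (Complex.exp (-α * Complex.I) * w)
    rw [norm_mul, hexpn, one_mul] at h3
    calc ‖Φ α w‖ ≤ (A * Real.exp (B * ‖w‖ ^ 2)) * (A * Real.exp (B * ‖w‖ ^ 2)) := by
          simp only [hΦ]; rw [norm_mul]; gcongr; exact hFgr w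
      _ = A * A * (Real.exp (B * ‖w‖ ^ 2) * Real.exp (B * ‖w‖ ^ 2)) := by ring
      _ = _ := by rw [← Real.exp_add]; ring_nf
  have hΦ0 : Φ 0 z = E z * F z := by simp [hΦ]
  rw [← hΦ0]
  have hz : z = ‖z‖ * Complex.exp (z.arg * Complex.I) := (Complex.norm_mul_exp_arg_mul_I z).symm
  have harg0 : 0 ≤ z.arg := Complex.arg_nonneg_iff.2 him
  have harg1 : z.arg ≤ Real.pi / 2 :=
    (le_abs_self _).trans (Complex.abs_arg_le_pi_div_two_iff.2 hre)
  have h2K : (1 : ℝ) ≤ 2 ^ K := one_le_pow₀ (by norm_num)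
  rcases harg0.eq_or_lt with h0 | h0
  · rw [← h0] at hz
    have := hedge1 0 ‖z‖ (norm_nonneg z)
    rw [← hz] at this
    refine this.trans ?_
    gcongr
    exact le_mul_of_one_le_right hC h2K
  · have hz0 : 0 < ‖z‖ := by
      rw [norm_pos_iff]; rintro rfl; simp at h0
    have hcont : Continuous fun α => Φ α z := by
      simp only [hΦ]; fun_prop
    -- The bound does not depend on `α`, so it passes to the limit `α → 0⁺`.
    have hlim : Filter.Tendsto (fun α => ‖Φ α z‖) (nhdsWithin 0 (Set.Ioi 0)) (nhds ‖Φ 0 z‖) :=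
      (hcont.norm.tendsto 0).mono_left nhdsWithin_le_nhds
    refine le_of_tendsto hlim ?_
    have hpi := Real.pi_pos
    filter_upwards [self_mem_nhdsWithin, nhdsWithin_le_nhds (Iio_mem_nhds h0),
      nhdsWithin_le_nhds (Iio_mem_nhds (half_pos hpi))] with α ha hb hc
    have := norm_le_of_sector (hΦd α) ha hc (hgr α) (hedge1 α) (hedge2 α) hz0
      (le_of_lt hb) harg1
    rwa [← hz] at this

/-- An entire function `φ` of order two for which `φ(±r) φ(ur)`, with `u` a unit and `r` real, is
of polynomial growth, has the property that `φ(z) φ(iz)` is a polynomial. -/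
lemma exists_polynomial_eval_eq_mul_rotate {φ : ℂ → ℂ} (hφ : Differentiable ℂ φ) {A B C : ℝ}
    {K : ℕ} (hgr : ∀ z, ‖φ z‖ ≤ A * Real.exp (B * ‖z‖ ^ 2))
    (h1 : ∀ u : ℂ, ‖u‖ = 1 → ∀ r : ℝ, ‖φ r‖ * ‖φ (u * r)‖ ≤ C * (1 + |r|) ^ K) :
    ∃ D : Polynomial ℂ, D.natDegree ≤ K ∧ ∀ z, φ z * φ (Complex.I * z) = D.eval z := by
  have hu : ∀ v : ℂ, ‖v‖ = 1 → Differentiable ℂ (fun z => φ (v * z)) ∧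
      ∀ z, ‖φ (v * z)‖ ≤ A * Real.exp (B * ‖z‖ ^ 2) := fun v hv =>
    ⟨hφ.comp (differentiable_id.const_mul v), fun z => by
      refine (hgr _).trans_eq ?_
      rw [norm_mul, hv, one_mul]⟩
  have h2 : ∀ u : ℂ, ‖u‖ = 1 → ∀ r : ℝ, ‖φ (-r)‖ * ‖φ (u * r)‖ ≤ C * (1 + |r|) ^ K := by
    intro u hu r
    simpa using h1 (-u) (by rwa [norm_neg]) (-r)
  have hpos : ∀ v w : ℂ, (v = 1 ∨ v = -1) → (w = Complex.I ∨ w = -Complex.I) →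
      ∀ z : ℂ, 0 ≤ z.re → 0 ≤ z.im → ‖φ (v * z) * φ (w * z)‖ ≤ C * 2 ^ K * (1 + ‖z‖) ^ K := by
    intro v w hv hw z hre him
    have hv1 : ‖v‖ = 1 := by rcases hv with rfl | rfl <;> simp
    have hw1 : ‖w‖ = 1 := by rcases hw with rfl | rfl <;> simp
    refine norm_mul_le_of_quadrant (hu v hv1).1 (hu w hw1).1 (hu v hv1).2 (hu w hw1).2
      (fun u hu r hr => ?_) (fun u hu r hr => ?_) hre him
    · simp only [← mul_assoc w u]
      rw [← abs_of_nonneg hr, Complex.ofReal_inj.2 (abs_of_nonneg hr)]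
      rcases hv with rfl | rfl
      · simpa using h1 (w * u) (by rw [norm_mul, hw1, hu, one_mul]) r
      · simpa using h2 (w * u) (by rw [norm_mul, hw1, hu, one_mul]) r
    · have e : ‖φ (v * (u * r))‖ * ‖φ (w * (Complex.I * r))‖ =
          ‖φ (w * Complex.I * r)‖ * ‖φ (v * u * r)‖ := by
        rw [mul_assoc w, mul_assoc v]; ring
      rw [e, ← abs_of_nonneg hr, Complex.ofReal_inj.2 (abs_of_nonneg hr)]
      rcases hw with rfl | rfl
      · rw [Complex.I_mul_I]
        simpa using h2 (v * u) (by rw [norm_mul, hv1, hu, one_mul]) r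
      · rw [neg_mul, Complex.I_mul_I, neg_neg]
        simpa using h1 (v * u) (by rw [norm_mul, hv1, hu, one_mul]) r
  refine exists_polynomial_of_polynomial_growth (C := C * 2 ^ K)
    (hφ.mul (hu Complex.I Complex.norm_I).1) fun z => ?_
  -- A fourth root of unity `t` brings `z` back to the first quadrant; there `φ(z) φ(iz)` becomes,
  -- up to the order of the factors, a product with arguments `±y` and `±iy`.
  have main : ∀ t v w : ℂ, ‖t‖ = 1 → (v = 1 ∨ v = -1) → (w = Complex.I ∨ w = -Complex.I) →
      (∀ x : ℂ, φ (t * x) * φ (Complex.I * (t * x)) = φ (v * x) * φ (w * x)) →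
      ∀ y : ℂ, z = t * y → 0 ≤ y.re → 0 ≤ y.im →
        ‖φ z * φ (Complex.I * z)‖ ≤ C * 2 ^ K * (1 + ‖z‖) ^ K := by
    intro t v w ht hv hw hx y hy hre him
    have h3 : ‖z‖ = ‖y‖ := by rw [hy, norm_mul, ht, one_mul]
    rw [h3, hy, hx]
    exact hpos v w hv hw y hre him
  have hII := Complex.I_mul_I
  rcases le_total 0 z.re with hr | hr <;> rcases le_total 0 z.im with hi | hi
  · exact main 1 1 Complex.I (by simp) (by simp) (by simp) (by simp) z (by simp) hr hi
  · refine main (-Complex.I) 1 (-Complex.I) (by simp) (by simp) (by simp) (fun x => ?_)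
      (Complex.I * z) ?_ (by simpa using hi) (by simpa using hr)
    · rw [show Complex.I * (-Complex.I * x) = 1 * x by linear_combination (-x) * hII, mul_comm]
    · linear_combination z * hII
  · refine main Complex.I (-1) Complex.I (by simp) (by simp) (by simp) (fun x => ?_)
      (-Complex.I * z) ?_ (by simpa using hi) (by simpa using hr)
    · rw [show Complex.I * (Complex.I * x) = -1 * x by linear_combination x * hII, mul_comm]
    · linear_combination z * hII
  · refine main (-1) (-1) (-Complex.I) (by simp) (by simp) (by simp) (fun x => ?_)
      (-z) (by ring) (by simpa using hr) (by simpa using hi)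
    rw [show Complex.I * (-1 * x) = -Complex.I * x by ring]

lemma exists_pos_le_norm_eval {Q : Polynomial ℂ} (hQ : Q ≠ 0) :
    ∃ c > 0, ∃ R₀ : ℝ, ∀ r : ℝ, R₀ ≤ r → c ≤ ‖Q.eval (r : ℂ)‖ := by
  rcases lt_or_ge 0 Q.degree with hd | hd
  · have h : Filter.Tendsto (fun r : ℝ => ‖Q.eval (r : ℂ)‖) Filter.atTop Filter.atTop :=
      Polynomial.tendsto_norm_atTop Q hd (by simpa using Filter.tendsto_abs_atTop_atTop)
    obtain ⟨R₀, hR⟩ := Filter.eventually_atTop.1 (h.eventually_ge_atTop 1)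
    exact ⟨1, one_pos, R₀, hR⟩
  · rw [Polynomial.eq_C_of_degree_le_zero hd] at hQ ⊢
    exact ⟨‖Q.coeff 0‖, norm_pos_iff.2 (by simpa using hQ), 0, fun r _ => by simp⟩

/-- If `φ(z) = P(z) e^{a z²}` is such that `φ(r) φ(ur)` is of polynomial growth for real `r`
whenever `|Im u| ≤ 1`, then `a` is real. -/
lemma im_eq_zero_of_norm_mul_le {P : Polynomial ℂ} (hP : P ≠ 0) {a : ℂ} {φ : ℂ → ℂ}
    (hφ : ∀ z, φ z = P.eval z * Complex.exp (a * z ^ 2)) {C : ℝ} {K : ℕ}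
    (h : ∀ u : ℂ, |u.im| ≤ 1 → ∀ r : ℝ, ‖φ r‖ * ‖φ (u * r)‖ ≤ C * (1 + |r|) ^ K) :
    a.im = 0 := by
  by_contra hne
  -- With `u = ε + i` one has `1 + u² = ε² + 2iε`, and the displayed quantity is `Re (a (1 + u²))`.
  -- A small `ε` of sign opposite to `Im a` makes it positive, so `φ(r) φ(ur)` would grow
  -- exponentially.
  obtain ⟨ε, hε⟩ : ∃ ε : ℝ, 0 < ε ^ 2 * a.re - 2 * ε * a.im := by
    refine ⟨-a.im / (|a.re| + 1), ?_⟩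
    have h1 : 0 < |a.re| + 1 := by positivity
    have h2 := neg_abs_le a.re
    have h3 : 0 < a.im ^ 2 := by positivity
    have : (-a.im / (|a.re| + 1)) ^ 2 * a.re - 2 * (-a.im / (|a.re| + 1)) * a.im =
        a.im ^ 2 * (a.re + 2 * (|a.re| + 1)) / (|a.re| + 1) ^ 2 := by
      field_simp
      ring
    rw [this]
    have : 0 < a.re + 2 * (|a.re| + 1) := by linarith [abs_nonneg a.re]
    positivity
  set u : ℂ := ε + Complex.I with hu
  have hu0 : u ≠ 0 := fun h => by simpa [hu] using congrArg Complex.im h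
  have hcomp : P.comp (Polynomial.C u * Polynomial.X) ≠ 0 := by
    intro h0
    apply hP
    apply Polynomial.funext
    intro z
    have := congrArg (Polynomial.eval (z / u)) h0
    simpa [Polynomial.eval_comp, mul_div_cancel₀ _ hu0] using this
  have hQ : P * P.comp (Polynomial.C u * Polynomial.X) ≠ 0 := mul_ne_zero hP hcomp
  obtain ⟨c, hc, R₀, hR₀⟩ := exists_pos_le_norm_eval hQ
  set δ := ε ^ 2 * a.re - 2 * ε * a.im with hδ
  have hC : 0 ≤ C := by
    have := h 0 (by simp) 0
    simp only [abs_zero, add_zero, one_pow, mul_one] at this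
    exact le_trans (by positivity) this
  have hbd : ∀ r : ℝ, 1 ≤ r → R₀ ≤ r → c * Real.exp (δ * r) ≤ C * 2 ^ K * r ^ K := by
    intro r hr hr'
    have hexp : Real.exp (δ * r ^ 2) =
        ‖Complex.exp (a * r ^ 2)‖ * ‖Complex.exp (a * (u * r) ^ 2)‖ := by
      rw [← norm_mul, ← Complex.exp_add, Complex.norm_exp]
      congr 1
      have e : a * r ^ 2 + a * (u * r) ^ 2 =
          ((r ^ 2 : ℝ) : ℂ) * (a * ((ε ^ 2 : ℝ) + (2 * ε : ℝ) * Complex.I)) := by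
        rw [hu]; push_cast
        linear_combination (a * r ^ 2) * Complex.I_sq
      rw [e, Complex.re_ofReal_mul, Complex.mul_re]
      simp only [Complex.add_re, Complex.add_im, Complex.ofReal_re, Complex.ofReal_im,
        Complex.re_ofReal_mul, Complex.im_ofReal_mul, Complex.I_re, Complex.I_im]
      ring
    have h1 := h u (by simp [hu]) r
    calc c * Real.exp (δ * r)
        ≤ ‖(P * P.comp (Polynomial.C u * Polynomial.X)).eval (r : ℂ)‖ * Real.exp (δ * r ^ 2) := by
          gcongr
          · exact hR₀ r hr'
          · nlinarith
      _ = ‖φ r‖ * ‖φ (u * r)‖ := by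
          simp only [hφ, hexp, norm_mul, Polynomial.eval_mul, Polynomial.eval_comp,
            Polynomial.eval_C, Polynomial.eval_X]
          ring
      _ ≤ C * (1 + |r|) ^ K := h1
      _ ≤ C * 2 ^ K * r ^ K := by
          rw [mul_assoc, ← mul_pow, abs_of_nonneg (by linarith)]
          gcongr
          linarith
  have hlo := (isLittleO_pow_exp_pos_mul_atTop (k := K) hε).bound
    (show 0 < c / (2 * (C * 2 ^ K + 1)) by positivity)
  obtain ⟨R, hR1, hR2, hR3⟩ := (hlo.and ((Filter.eventually_ge_atTop 1).and
    (Filter.eventually_ge_atTop R₀))).exists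
  have h6 := hbd R hR2 hR3
  have hRK : 0 < R ^ K := by positivity
  rw [Real.norm_of_nonneg hRK.le, Real.norm_of_nonneg (Real.exp_pos _).le, div_mul_eq_mul_div,
    le_div_iff₀ (by positivity)] at hR1
  have : 0 ≤ C * 2 ^ K * R ^ K := by positivity
  nlinarith

/-! ### Power series coefficients, and polynomial division from growth bounds. -/

/-- `φ` is the sum, on the whole complex plane, of the power series with coefficients `c`. -/
def HasCoeffs (φ : ℂ → ℂ) (c : ℕ → ℂ) : Prop := ∀ ζ, HasSum (fun k => c k * ζ ^ k) (φ ζ)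

namespace HasCoeffs

lemma summable_norm {φ : ℂ → ℂ} {c : ℕ → ℂ} (h : HasCoeffs φ c) (ζ : ℂ) :
    Summable fun k => ‖c k * ζ ^ k‖ := (h ζ).summable.norm

lemma differentiable {φ : ℂ → ℂ} {c : ℕ → ℂ} (h : HasCoeffs φ c) : Differentiable ℂ φ := by
  intro z
  have hs : Summable fun k => ‖c k‖ * (‖z‖ + 1) ^ k := by
    have := h.summable_norm ((‖z‖ + 1 : ℝ) : ℂ)
    refine this.congr fun k => ?_
    rw [norm_mul, norm_pow, Complex.norm_real, Real.norm_of_nonneg (by positivity)]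
  have hd := Complex.differentiableOn_tsum_of_summable_norm (u := fun k => ‖c k‖ * (‖z‖ + 1) ^ k)
    (F := fun k ζ => c k * ζ ^ k) (U := Metric.ball 0 (‖z‖ + 1)) hs
    (fun k => (by fun_prop : Differentiable ℂ fun ζ => c k * ζ ^ k).differentiableOn)
    Metric.isOpen_ball (fun k ζ hζ => by
      have : ‖ζ‖ ≤ ‖z‖ + 1 := by simpa using (Metric.mem_ball.1 hζ).le
      rw [norm_mul, norm_pow]
      gcongr)
  have he : (fun ζ => ∑' k, c k * ζ ^ k) = φ := funext fun ζ => (h ζ).tsum_eq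
  rw [he] at hd
  exact hd.differentiableAt (Metric.isOpen_ball.mem_nhds (by simp))

lemma unique {φ : ℂ → ℂ} {b c : ℕ → ℂ} (hb : HasCoeffs φ b) (hc : HasCoeffs φ c) : b = c := by
  have h : ∀ a : ℕ → ℂ, HasCoeffs φ a →
      HasFPowerSeriesAt φ (FormalMultilinearSeries.ofScalars ℂ a) 0 := fun a ha =>
    hasFPowerSeriesAt_iff.2 (Filter.Eventually.of_forall fun z => by
      simpa [FormalMultilinearSeries.coeff_ofScalars, mul_comm] using ha z)
  have := (h b hb).eq_formalMultilinearSeries (h c hc)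
  funext k
  have h2 := congrArg (fun p => FormalMultilinearSeries.coeff p k) this
  simpa [FormalMultilinearSeries.coeff_ofScalars] using h2

lemma mul {φ ψ : ℂ → ℂ} {b c : ℕ → ℂ} (hb : HasCoeffs φ b) (hc : HasCoeffs ψ c) :
    HasCoeffs (fun ζ => φ ζ * ψ ζ)
      (fun n => ∑ ij ∈ Finset.HasAntidiagonal.antidiagonal n, b ij.1 * c ij.2) := by
  intro ζ
  have h1 := tsum_mul_tsum_eq_tsum_sum_antidiagonal_of_summable_norm (hb.summable_norm ζ)
    (hc.summable_norm ζ)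
  have h2 := (summable_norm_sum_mul_antidiagonal_of_summable_norm (hb.summable_norm ζ)
    (hc.summable_norm ζ)).of_norm.hasSum
  rw [← h1, (hb ζ).tsum_eq, (hc ζ).tsum_eq] at h2
  convert! h2 using 2 with n
  rw [Finset.sum_mul]
  refine Finset.sum_congr rfl fun ij hij => ?_
  rw [← Finset.HasAntidiagonal.mem_antidiagonal.1 hij, pow_add]
  ring

lemma comp_mul {φ : ℂ → ℂ} {c : ℕ → ℂ} (h : HasCoeffs φ c) (t : ℂ) :
    HasCoeffs (fun ζ => φ (t * ζ)) (fun k => t ^ k * c k) := fun ζ => by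
  convert! h (t * ζ) using 2 with k
  rw [mul_pow]; ring

lemma mul_deriv {φ : ℂ → ℂ} {c : ℕ → ℂ} (h : HasCoeffs φ c) :
    HasCoeffs (fun ζ => ζ * deriv φ ζ) (fun k => k * c k) := by
  have hT : ∀ ψ : ℂ → ℂ, Differentiable ℂ ψ →
      HasCoeffs ψ (fun k => (k.factorial : ℂ)⁻¹ * iteratedDeriv k ψ 0) := fun ψ hψ ζ => by
    convert! Complex.hasSum_taylorSeries_of_entire hψ 0 ζ using 2 with k
    simp; ring
  have hd : Differentiable ℂ (deriv φ) :=
    (h.differentiable.contDiff (n := 2)).differentiable_deriv_two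
  intro ζ
  have h1 := (hT _ hd ζ).mul_left ζ
  rw [h.unique (hT φ h.differentiable)]
  refine (hasSum_nat_add_iff' 1).1 ?_
  simp only [Finset.sum_range_one, Nat.cast_zero, zero_mul, sub_zero]
  convert! h1 using 2 with k
  simp only [iteratedDeriv_succ', Nat.factorial_succ]
  push_cast
  have : ((k : ℂ) + 1) ≠ 0 := by exact_mod_cast k.succ_ne_zero
  rw [mul_inv, pow_succ]
  field_simp

lemma polynomial (p : Polynomial ℂ) : HasCoeffs (fun ζ => p.eval ζ) p.coeff := fun ζ => by
  have h := hasSum_sum_of_ne_finset_zero (s := Finset.range (p.natDegree + 1))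
    (f := fun k => p.coeff k * ζ ^ k) (L := SummationFilter.unconditional ℕ) (fun k hk => by
      rw [Polynomial.coeff_eq_zero_of_natDegree_lt (by simpa using hk), zero_mul])
  rwa [← Polynomial.eval_eq_sum_range] at h

lemma gaussian (a : ℂ) : HasCoeffs (fun ζ => Complex.exp (a * ζ ^ 2))
    (fun k => if Even k then ((k / 2).factorial : ℂ)⁻¹ * a ^ (k / 2) else 0) := fun ζ => by
  have h := NormedSpace.expSeries_div_hasSum_exp (a * ζ ^ 2)
  rw [← Complex.exp_eq_exp_ℂ] at h
  have hinj : Function.Injective (fun n : ℕ => 2 * n) := fun m n h => by simpa using h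
  rw [← hinj.hasSum_iff]
  · convert! h using 2 with n
    simp [mul_pow, ← pow_mul]
    ring
  · intro k hk
    have : ¬ Even k := fun ⟨m, hm⟩ => hk ⟨m, by simp; omega⟩
    simp [this]

end HasCoeffs

/-- A polynomial dominated by `(1 + |s|)² |D(s)|` is a multiple of `D`, the quotient having degree
at most two. -/
lemma exists_eq_mul_of_norm_le {E D : Polynomial ℂ} (hD : D ≠ 0) {C : ℝ}
    (h : ∀ s, D.eval s ≠ 0 → ‖E.eval s‖ ≤ C * (1 + ‖s‖) ^ 2 * ‖D.eval s‖) :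
    ∃ r : Polynomial ℂ, r.natDegree ≤ 2 ∧ E = D * r := by
  induction hn : D.natDegree generalizing E D with
  | zero =>
    rw [Polynomial.eq_C_of_natDegree_eq_zero hn] at h hD ⊢
    have hc : D.coeff 0 ≠ 0 := by simpa using hD
    obtain ⟨p, hp, hpe⟩ := exists_polynomial_of_polynomial_growth (F := fun z => E.eval z)
      E.differentiable (C := C * ‖D.coeff 0‖) (n := 2) (fun z => by
        have := h z (by simpa using hc)
        simp only [Polynomial.eval_C] at this
        linarith)
    refine ⟨Polynomial.C (D.coeff 0)⁻¹ * p, (Polynomial.natDegree_C_mul_le _ _).trans hp, ?_⟩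
    rw [← mul_assoc, ← Polynomial.C_mul, mul_inv_cancel₀ hc, Polynomial.C_1, one_mul]
    exact Polynomial.funext hpe
  | succ n ih =>
    -- Continuity extends the inequality to the zeros of `D`, where it forces `E` to vanish; after a
    -- common factor is cancelled it is recovered at `ρ` in the same way.
    have hall : ∀ {E D : Polynomial ℂ}, D ≠ 0 →
        ∀ T : Set ℂ, T.Finite →
        (∀ s ∉ T, D.eval s ≠ 0 → ‖E.eval s‖ ≤ C * (1 + ‖s‖) ^ 2 * ‖D.eval s‖) →
        ∀ s, ‖E.eval s‖ ≤ C * (1 + ‖s‖) ^ 2 * ‖D.eval s‖ := by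
      intro E D hD T hT h s
      have hd : Dense (T ∪ (D.roots.toFinset : Set ℂ))ᶜ :=
        (hT.union (Finset.finite_toSet _)).countable.dense_compl ℝ
      have hcl : IsClosed {s : ℂ | ‖E.eval s‖ ≤ C * (1 + ‖s‖) ^ 2 * ‖D.eval s‖} := by
        have h1 := E.continuous
        have h2 := D.continuous
        exact isClosed_le (by fun_prop) (by fun_prop)
      refine hcl.closure_subset_iff.2 (fun s hs => ?_) (hd s)
      simp only [Set.compl_union, Set.mem_inter_iff, Set.mem_compl_iff, Finset.mem_coe,
        Multiset.mem_toFinset, Polynomial.mem_roots hD] at hs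
      exact h s hs.1 hs.2
    obtain ⟨ρ, hρ⟩ := Complex.exists_root (f := D) (Polynomial.natDegree_pos_iff_degree_pos.1
      (by omega))
    have hE0 : E.IsRoot ρ := by
      have := hall hD ∅ Set.finite_empty (fun s _ => h s) ρ
      rw [hρ, norm_zero, mul_zero] at this
      simpa using this
    obtain ⟨D', rfl⟩ := Polynomial.dvd_iff_isRoot.2 hρ
    obtain ⟨E', rfl⟩ := Polynomial.dvd_iff_isRoot.2 hE0
    have hD' : D' ≠ 0 := right_ne_zero_of_mul hD
    have h' := hall hD' {ρ} (Set.finite_singleton ρ) (E := E') (fun s hs hDs => by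
      have hs' : s - ρ ≠ 0 := sub_ne_zero.2 hs
      have := h s (by simp [hs', hDs])
      simp only [Polynomial.eval_mul, Polynomial.eval_sub, Polynomial.eval_X, Polynomial.eval_C,
        norm_mul] at this
      have hp := norm_pos_iff.2 hs'
      rw [mul_left_comm] at this
      exact le_of_mul_le_mul_left this hp)
    obtain ⟨r, hr, hr'⟩ := ih hD' (fun s _ => h' s) (by
      rw [Polynomial.natDegree_mul (Polynomial.X_sub_C_ne_zero _) hD',
        Polynomial.natDegree_X_sub_C] at hn
      omega)
    exact ⟨r, hr, by rw [hr', mul_assoc]⟩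

namespace MvPolynomial

lemma IsHomogeneous.eval_smul {σ : Type*} {p : MvPolynomial σ ℂ} {n : ℕ} (hp : p.IsHomogeneous n)
    (t : ℂ) (z : σ → ℂ) : eval (t • z) p = t ^ n * eval z p := by
  rw [eval_eq, eval_eq, Finset.mul_sum]
  refine Finset.sum_congr rfl fun d hd => ?_
  have h1 : d.degree = n := by
    by_contra hne
    exact (mem_support_iff.1 hd) (hp.coeff_eq_zero hne)
  have h2 : ∏ i ∈ d.support, t ^ d i = t ^ n := by
    rw [Finset.prod_pow_eq_pow_sum, ← h1]; rfl
  simp only [Pi.smul_apply, smul_eq_mul, mul_pow, Finset.prod_mul_distrib, h2]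
  ring

/-- The restriction of a polynomial to the line spanned by `v`. -/
noncomputable def restrictLine {σ : Type*} (p : MvPolynomial σ ℂ) (v : σ → ℂ) : Polynomial ℂ :=
  aeval (fun i => Polynomial.C (v i) * Polynomial.X) p

lemma eval_restrictLine {σ : Type*} (p : MvPolynomial σ ℂ) (v : σ → ℂ) (s : ℂ) :
    (p.restrictLine v).eval s = eval (s • v) p := by
  rw [restrictLine, aeval_def, eval₂_eq, Polynomial.eval_finsetSum, eval_eq]
  refine Finset.sum_congr rfl fun d _ => ?_
  rw [Polynomial.eval_mul, Polynomial.eval_prod]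
  congr 1
  · simp
  · exact Finset.prod_congr rfl fun i _ => by
      rw [Polynomial.eval_pow, Polynomial.eval_mul, Polynomial.eval_C, Polynomial.eval_X,
        Pi.smul_apply, smul_eq_mul, mul_comm]

lemma coeff_restrictLine {σ : Type*} (p : MvPolynomial σ ℂ) (v : σ → ℂ) (k : ℕ) :
    (p.restrictLine v).coeff k = eval v (homogeneousComponent k p) := by
  have h : p.restrictLine v = ∑ i ∈ Finset.range (p.totalDegree + 1),
      Polynomial.C (eval v (homogeneousComponent i p)) * Polynomial.X ^ i := by
    refine Polynomial.funext fun s => ?_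
    rw [eval_restrictLine]
    conv_lhs => rw [← sum_homogeneousComponent p]
    rw [map_sum, Polynomial.eval_finsetSum]
    refine Finset.sum_congr rfl fun i _ => ?_
    rw [(homogeneousComponent_isHomogeneous i p).eval_smul, Polynomial.eval_mul,
      Polynomial.eval_C, Polynomial.eval_pow, Polynomial.eval_X, mul_comm]
  rw [h, Polynomial.finsetSum_coeff]
  simp only [Polynomial.coeff_C_mul_X_pow, Finset.sum_ite_eq, Finset.mem_range]
  split_ifs with hk
  · rfl
  · rw [homogeneousComponent_eq_zero _ _ (by omega), map_zero]

/-- On each line through the origin the quotient is a polynomial of degree at most two by the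
one-variable case. Its three coefficients depend polynomially on the direction, since solving for
them divides only by the constant `D(0)`. -/
lemma exists_eq_mul_of_norm_le_of_eval_zero_ne {σ : Type*} [Fintype σ] {E D : MvPolynomial σ ℂ}
    (hD : eval 0 D ≠ 0) {C : ℝ} (hC : 0 ≤ C)
    (h : ∀ z : σ → ℂ, eval z D ≠ 0 → ‖eval z E‖ ≤ C * (1 + ‖z‖) ^ 2 * ‖eval z D‖) :
    ∃ q, E = D * q := by
  set δ := eval 0 D with hδ
  set e := fun k => homogeneousComponent k E with he
  set d := fun k => homogeneousComponent k D with hd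
  -- The components of degree 0, 1 and 2 of the quotient, from the triangular system that compares
  -- homogeneous components in `E = D q`.
  set R0 : MvPolynomial σ ℂ := MvPolynomial.C δ⁻¹ * e 0
  set R1 : MvPolynomial σ ℂ := MvPolynomial.C δ⁻¹ * (e 1 - d 1 * R0) with hR1
  set R2 : MvPolynomial σ ℂ := MvPolynomial.C δ⁻¹ * (e 2 - d 1 * R1 - d 2 * R0) with hR2
  refine ⟨R0 + R1 + R2, MvPolynomial.funext fun v => ?_⟩
  have hd0 : (D.restrictLine v).coeff 0 = δ := by
    rw [Polynomial.coeff_zero_eq_eval_zero, eval_restrictLine, zero_smul]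
  have hne : D.restrictLine v ≠ 0 := fun h0 => hD (by rw [← hd0, h0]; simp)
  obtain ⟨r, hr, hEr⟩ := exists_eq_mul_of_norm_le (E := E.restrictLine v) hne
    (C := C * (1 + ‖v‖) ^ 2) (fun s hs => by
      rw [eval_restrictLine] at hs ⊢
      rw [eval_restrictLine]
      refine (h _ hs).trans ?_
      have h1 := norm_nonneg v
      have h2 := norm_nonneg s
      have h3 : (1 + ‖s • v‖) ^ 2 ≤ (1 + ‖v‖) ^ 2 * (1 + ‖s‖) ^ 2 := by
        rw [← mul_pow, norm_smul]
        gcongr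
        nlinarith
      refine mul_le_mul_of_nonneg_right ?_ (norm_nonneg _)
      rw [mul_assoc]
      exact mul_le_mul_of_nonneg_left h3 hC)
  have hck : ∀ k, eval v (e k) = (D.restrictLine v * r).coeff k := fun k => by
    rw [← hEr, coeff_restrictLine]
  have hdk : ∀ k, (D.restrictLine v).coeff k = eval v (d k) := fun k => coeff_restrictLine _ _ _
  have h0 := hck 0
  have h1 := hck 1
  have h2 := hck 2
  have hdd : eval v (d 0) = δ := by rw [← hdk, hd0]
  simp only [Polynomial.coeff_mul, Finset.Nat.sum_antidiagonal_eq_sum_range_succ_mk,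
    Finset.sum_range_succ, Finset.sum_range_zero, hdk, zero_add, Nat.sub_zero, Nat.sub_self,
    Nat.reduceSub] at h0 h1 h2
  rw [hdd] at h0 h1 h2
  have r0 : r.coeff 0 = eval v R0 := by
    simp only [R0, map_mul, eval_C, h0]; field_simp
  have r1 : r.coeff 1 = eval v R1 := by
    simp only [hR1, map_mul, map_sub, eval_C, h1, r0]; field_simp; ring
  have r2 : r.coeff 2 = eval v R2 := by
    simp only [hR2, map_mul, map_sub, eval_C, h2, r1, r0]; field_simp; ring
  have hr1 : r.eval 1 = eval v (R0 + R1 + R2) := by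
    rw [Polynomial.eval_eq_sum_range' (n := 3) (by omega)]
    simp [Finset.sum_range_succ, r0, r1, r2]
  have := congrArg (Polynomial.eval 1) hEr
  rw [Polynomial.eval_mul, eval_restrictLine, eval_restrictLine, one_smul, hr1] at this
  rw [map_mul, this]

/-- A polynomial in several variables dominated by `(1 + ‖z‖)² |D(z)|` is a multiple of `D`. -/
lemma exists_eq_mul_of_norm_le {σ : Type*} [Fintype σ] {E D : MvPolynomial σ ℂ} (hD : D ≠ 0)
    {C : ℝ} (hC : 0 ≤ C)
    (h : ∀ z : σ → ℂ, eval z D ≠ 0 → ‖eval z E‖ ≤ C * (1 + ‖z‖) ^ 2 * ‖eval z D‖) :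
    ∃ q, E = D * q := by
  -- Translating by a point where `D` does not vanish reduces to the case `D(0) ≠ 0`.
  obtain ⟨u, hu⟩ : ∃ u, eval u D ≠ 0 := by
    by_contra! h0
    exact hD (MvPolynomial.funext fun z => by simpa using h0 z)
  have hsh : ∀ (w z : σ → ℂ) (p : MvPolynomial σ ℂ),
      eval z (aeval (fun i => X i + MvPolynomial.C (w i)) p : MvPolynomial σ ℂ) =
        eval (z + w) p := by
    intro w z p
    rw [← coe_aeval_eq_eval, RingHom.coe_coe, ← AlgHom.comp_apply, comp_aeval]
    simp only [map_add, aeval_X, aeval_C, Algebra.algebraMap_self, RingHom.id_apply]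
    rfl
  obtain ⟨q, hq⟩ := exists_eq_mul_of_norm_le_of_eval_zero_ne
    (E := aeval (fun i => X i + MvPolynomial.C (u i)) E)
    (D := aeval (fun i => X i + MvPolynomial.C (u i)) D) (C := C * (1 + ‖u‖) ^ 2)
    (by rwa [hsh, zero_add]) (by positivity) (fun z hz => by
      rw [hsh] at hz ⊢
      rw [hsh]
      refine (h _ hz).trans ?_
      have h1 := norm_nonneg u
      have h2 := norm_nonneg z
      have h3 := norm_add_le z u
      have h4 : (1 + ‖z + u‖) ^ 2 ≤ (1 + ‖u‖) ^ 2 * (1 + ‖z‖) ^ 2 := by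
        rw [← mul_pow]
        gcongr
        nlinarith
      refine mul_le_mul_of_nonneg_right ?_ (norm_nonneg _)
      rw [mul_assoc]
      exact mul_le_mul_of_nonneg_left h4 hC)
  refine ⟨aeval (fun i => X i + MvPolynomial.C (-u i)) q, MvPolynomial.funext fun z => ?_⟩
  have := congrArg (eval (z - u)) hq
  rw [map_mul, hsh, hsh, sub_add_cancel] at this
  have h2 := hsh (-u) z q
  rw [← sub_eq_add_neg] at h2
  rw [map_mul, this, ← h2]
  rfl

end MvPolynomial

namespace MvPolynomial

lemma eq_mul_homogeneousComponent {σ : Type*} {E D q : MvPolynomial σ ℂ} {m n : ℕ}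
    (hE : E.IsHomogeneous (m + n)) (hD : D.IsHomogeneous m) (h : E = D * q) :
    E = D * homogeneousComponent n q := by
  let _ : GradedAlgebra (homogeneousSubmodule σ ℂ) := gradedAlgebra
  have h1 := DirectSum.coe_decompose_mul_add_of_left_mem (homogeneousSubmodule σ ℂ)
    (b := q) (j := n) ((mem_homogeneousSubmodule m D).2 hD)
  rw [← h] at h1
  have h2 : ∀ (p : MvPolynomial σ ℂ) (i : ℕ),
      (DirectSum.decompose (homogeneousSubmodule σ ℂ) p i : MvPolynomial σ ℂ) =
        homogeneousComponent i p := fun p i => decomposition.decompose'_apply p i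
  rw [h2, h2, homogeneousComponent_eq_self hE] at h1
  exact h1

end MvPolynomial

/-! ### From one variable to several: the Gaussian exponent as a quadratic form. -/

open MvPolynomial in

/-- The functional equation satisfied by the logarithmic derivative of an entire function `φ` with
`φ(z) φ(iz)` polynomial of degree `M`: it determines the Gaussian exponent of `φ`. -/
lemma HasCoeffs.top_coeff_eq {φ : ℂ → ℂ} {D P : Polynomial ℂ} {a : ℂ} (hP : P ≠ 0)
    (hφ : ∀ ζ, φ ζ = P.eval ζ * Complex.exp (a * ζ ^ 2))
    (hD : ∀ ζ, φ ζ * φ (Complex.I * ζ) = D.eval ζ) {e : ℕ → ℂ}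
    (he : HasCoeffs (fun ζ => ζ * deriv φ ζ * φ (Complex.I * ζ)) e) :
    D.natDegree = 2 * P.natDegree ∧ e (D.natDegree + 2) = 2 * a * D.coeff D.natDegree := by
  set Q := P.comp (Polynomial.C Complex.I * Polynomial.X) with hQ
  have hexp : ∀ ζ : ℂ, Complex.exp (a * ζ ^ 2) * Complex.exp (a * (Complex.I * ζ) ^ 2) = 1 := by
    intro ζ
    rw [← Complex.exp_add, ← Complex.exp_zero]
    congr 1
    linear_combination (a * ζ ^ 2) * Complex.I_sq
  have hQe : ∀ ζ, Q.eval ζ = P.eval (Complex.I * ζ) := fun ζ => by simp [hQ, Polynomial.eval_comp]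
  have hDPQ : D = P * Q := Polynomial.funext fun ζ => by
    rw [← hD, hφ, hφ, Polynomial.eval_mul, hQe]
    linear_combination (P.eval ζ * P.eval (Complex.I * ζ)) * hexp ζ
  have hQdeg : Q.natDegree = P.natDegree := by
    rw [hQ, Polynomial.natDegree_comp, Polynomial.natDegree_C_mul_X _ Complex.I_ne_zero, mul_one]
  have hQ0 : Q ≠ 0 := by
    intro h0
    rw [h0] at hQe
    apply hP
    refine Polynomial.funext fun ζ => ?_
    have h1 := hQe (-Complex.I * ζ)
    have h2 : Complex.I * (-Complex.I * ζ) = ζ := by linear_combination (-ζ) * Complex.I_sq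
    rw [h2] at h1
    simpa using h1.symm
  have hdeg : D.natDegree = 2 * P.natDegree := by
    rw [hDPQ, Polynomial.natDegree_mul hP hQ0, hQdeg]; ring
  refine ⟨hdeg, ?_⟩
  have hderiv : ∀ ζ, deriv φ ζ = P.derivative.eval ζ * Complex.exp (a * ζ ^ 2) +
      P.eval ζ * (Complex.exp (a * ζ ^ 2) * (2 * a * ζ)) := by
    intro ζ
    have h1 : HasDerivAt (fun ζ : ℂ => a * ζ ^ 2) (a * (2 * ζ)) ζ := by
      simpa using (hasDerivAt_pow 2 ζ).const_mul a
    have h2 := (P.hasDerivAt ζ).mul h1.cexp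
    rw [show φ = fun ζ => P.eval ζ * Complex.exp (a * ζ ^ 2) from funext hφ]
    have h3 := h2.deriv
    simp only [Pi.mul_def] at h3
    rw [h3]
    ring
  -- The two exponentials cancel, leaving `ζ P'(ζ) P(iζ) + 2a ζ² D(ζ)`; the first term has degree at
  -- most `deg D`, so the coefficient of degree `deg D + 2` comes from the second alone.
  have hpoly : HasCoeffs (fun ζ => ζ * deriv φ ζ * φ (Complex.I * ζ))
      (Polynomial.X * P.derivative * Q + Polynomial.C (2 * a) * Polynomial.X ^ 2 * D).coeff := by
    convert! HasCoeffs.polynomial _ using 1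
    funext ζ
    rw [hderiv, hφ (Complex.I * ζ), hDPQ]
    simp only [Polynomial.eval_add, Polynomial.eval_mul, Polynomial.eval_X, Polynomial.eval_C,
      Polynomial.eval_pow, hQe]
    linear_combination (ζ * P.derivative.eval ζ * P.eval (Complex.I * ζ) +
      2 * a * ζ ^ 2 * P.eval ζ * P.eval (Complex.I * ζ)) * hexp ζ
  rw [he.unique hpoly, Polynomial.coeff_add]
  have h1 : (Polynomial.X * P.derivative * Q).coeff (D.natDegree + 2) = 0 := by
    apply Polynomial.coeff_eq_zero_of_natDegree_lt
    refine lt_of_le_of_lt (Polynomial.natDegree_mul_le.trans (add_le_add_left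
      Polynomial.natDegree_mul_le _)) ?_
    have := Polynomial.natDegree_derivative_le P
    rw [Polynomial.natDegree_X, hQdeg]
    omega
  rw [h1, zero_add, mul_assoc, Polynomial.coeff_C_mul, Polynomial.coeff_X_pow_mul]

open MvPolynomial in

/-- A family of entire functions of order two, whose Taylor coefficients depend polynomially on
the direction, and for which `φ_z(ζ) φ_z(iζ)` is polynomial of bounded degree for sufficiently many
`z`, is given by the product of a polynomial and the exponential of a quadratic form. -/
lemma exists_mvPolynomial_mul_exp {d : ℕ} {g : ℕ → MvPolynomial (Fin d) ℂ}
    (hg : ∀ k, (g k).IsHomogeneous k) (hne : ∃ k, g k ≠ 0) {φ : (Fin d → ℂ) → ℂ → ℂ}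
    (hφ : ∀ z, HasCoeffs (φ z) fun k => eval z (g k)) {C c : ℝ} (hc : 0 ≤ c)
    (hgr : ∀ z ζ, ‖φ z ζ‖ ≤ C * Real.exp (c * ‖z‖ ^ 2 * ‖ζ‖ ^ 2)) {S : Set (Fin d → ℂ)}
    (hS : ∀ p : MvPolynomial (Fin d) ℂ, (∀ z ∈ S, eval z p = 0) → p = 0) {K : ℕ}
    (hK : ∀ z ∈ S, ∃ D : Polynomial ℂ, D.natDegree ≤ K ∧
      ∀ ζ, φ z ζ * φ z (Complex.I * ζ) = D.eval ζ) :
    ∃ P q Δ : MvPolynomial (Fin d) ℂ, q.IsHomogeneous 2 ∧ Δ ≠ 0 ∧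
      (∀ z, φ z 1 = eval z P * Complex.exp (eval z q)) ∧
      ∀ z, eval z Δ ≠ 0 → ∃ p : Polynomial ℂ, p ≠ 0 ∧
        ∀ ζ, φ z ζ = p.eval ζ * Complex.exp (eval z q * ζ ^ 2) := by
  set D : ℕ → MvPolynomial (Fin d) ℂ := fun n => ∑ ij ∈ Finset.HasAntidiagonal.antidiagonal n,
    g ij.1 * (MvPolynomial.C (Complex.I ^ ij.2) * g ij.2) with hD
  have hDc : ∀ z, HasCoeffs (fun ζ => φ z ζ * φ z (Complex.I * ζ)) fun k => eval z (D k) := by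
    intro z
    convert! (hφ z).mul ((hφ z).comp_mul Complex.I) using 1
    funext n
    simp [hD, map_sum]
  set E : ℕ → MvPolynomial (Fin d) ℂ := fun n => ∑ ij ∈ Finset.HasAntidiagonal.antidiagonal n,
    (MvPolynomial.C (ij.1 : ℂ) * g ij.1) * (MvPolynomial.C (Complex.I ^ ij.2) * g ij.2) with hE
  have hEc : ∀ z, HasCoeffs (fun ζ => ζ * deriv (φ z) ζ * φ z (Complex.I * ζ))
      fun k => eval z (E k) := by
    intro z
    convert! (hφ z).mul_deriv.mul ((hφ z).comp_mul Complex.I) using 1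
    funext n
    simp [hE, map_sum]
  have hDhom : ∀ n, (D n).IsHomogeneous n := fun n => by
    refine IsHomogeneous.sum _ _ _ fun ij hij => ?_
    rw [← Finset.HasAntidiagonal.mem_antidiagonal.1 hij]
    exact (hg _).mul ((hg _).C_mul _)
  have hEhom : ∀ n, (E n).IsHomogeneous n := fun n => by
    refine IsHomogeneous.sum _ _ _ fun ij hij => ?_
    rw [← Finset.HasAntidiagonal.mem_antidiagonal.1 hij]
    exact ((hg _).C_mul _).mul ((hg _).C_mul _)
  -- Each coefficient is a polynomial in the direction. Vanishing on `S`, it vanishes identically,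
  -- so the degree bound extends to all complex directions.
  have hDK : ∀ k, K < k → D k = 0 := fun k hk => hS _ fun z hz => by
    obtain ⟨p, hp, hpe⟩ := hK z hz
    have h1 : HasCoeffs (fun ζ => φ z ζ * φ z (Complex.I * ζ)) p.coeff := by
      simp only [hpe]; exact HasCoeffs.polynomial p
    have := congrFun ((hDc z).unique h1) k
    rw [this]
    exact Polynomial.coeff_eq_zero_of_natDegree_lt (by omega)
  have hDne : ∃ k, D k ≠ 0 := by
    classical
    set n := Nat.find hne with hn
    have hgn : g n ≠ 0 := Nat.find_spec hne
    have hlt : ∀ m, m < n → g m = 0 := fun m hm => by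
      by_contra h; exact Nat.find_min hne hm h
    refine ⟨n + n, ?_⟩
    -- For `n` minimal with `g n ≠ 0`, the degree `2n` coefficient of the product reduces to a
    -- single term.
    have : D (n + n) = g n * (MvPolynomial.C (Complex.I ^ n) * g n) := by
      simp only [hD]
      refine Finset.sum_eq_single (n, n) (fun ij hij hne' => ?_) (fun h => ?_)
      · have h1 := Finset.HasAntidiagonal.mem_antidiagonal.1 hij
        rcases lt_or_ge ij.1 n with h2 | h2
        · rw [hlt _ h2, zero_mul]
        · rcases lt_or_ge ij.2 n with h3 | h3
          · rw [hlt _ h3, mul_zero, mul_zero]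
          · exact absurd (Prod.ext (by simp; omega) (by simp; omega)) hne'
      · exact absurd (Finset.HasAntidiagonal.mem_antidiagonal.2 (by simp)) h
    rw [this]
    refine mul_ne_zero hgn (mul_ne_zero ?_ hgn)
    rw [Ne, MvPolynomial.C_eq_zero]
    exact pow_ne_zero _ Complex.I_ne_zero
  classical
  obtain ⟨M, hM, hMmax⟩ : ∃ M, D M ≠ 0 ∧ ∀ k, M < k → D k = 0 := by
    obtain ⟨k₀, hk₀⟩ := hDne
    have hk₀K : k₀ ≤ K := by
      by_contra h; exact hk₀ (hDK _ (by omega))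
    refine ⟨Nat.findGreatest (fun k => D k ≠ 0) K,
      Nat.findGreatest_spec (P := fun k => D k ≠ 0) hk₀K hk₀, fun k hk => ?_⟩
    rcases le_or_gt k K with h | h
    · by_contra hne'; exact Nat.findGreatest_is_greatest hk h hne'
    · exact hDK k h
  have key : ∀ z, eval z (D M) ≠ 0 → ∃ (p : Polynomial ℂ) (a : ℂ), p ≠ 0 ∧ p.natDegree ≤ M ∧
      (∀ ζ, φ z ζ = p.eval ζ * Complex.exp (a * ζ ^ 2)) ∧ ‖a‖ ≤ c * ‖z‖ ^ 2 ∧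
      eval z (E (M + 2)) = 2 * a * eval z (D M) := by
    intro z hz
    set Dz : Polynomial ℂ := ∑ k ∈ Finset.range (M + 1),
      Polynomial.C (eval z (D k)) * Polynomial.X ^ k with hDz
    have hcoeff : ∀ k, Dz.coeff k = eval z (D k) := fun k => by
      rw [hDz, Polynomial.finsetSum_coeff]
      simp only [Polynomial.coeff_C_mul_X_pow, Finset.sum_ite_eq, Finset.mem_range]
      split_ifs with hk
      · rfl
      · rw [hMmax k (by omega), map_zero]
    have hDze : ∀ ζ, φ z ζ * φ z (Complex.I * ζ) = Dz.eval ζ := fun ζ => by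
      have h1 := HasCoeffs.polynomial Dz ζ
      simp only [hcoeff] at h1
      exact (hDc z ζ).unique h1
    have hDz0 : Dz ≠ 0 := fun h => hz (by rw [← hcoeff, h, Polynomial.coeff_zero])
    have hdeg : Dz.natDegree = M := by
      refine le_antisymm (Polynomial.natDegree_le_iff_coeff_eq_zero.2 fun k hk => ?_)
        (Polynomial.le_natDegree_of_ne_zero (by rwa [hcoeff]))
      rw [hcoeff, hMmax k hk, map_zero]
    have hgrz : ∀ ζ, ‖φ z ζ‖ ≤ C * Real.exp ((c * ‖z‖ ^ 2) * ‖ζ‖ ^ 2) := hgr z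
    obtain ⟨p, a, hp, hpe⟩ := exists_polynomial_mul_gaussian (hφ z).differentiable
      (by positivity) hgrz hDz0 hDze
    have h2 := HasCoeffs.top_coeff_eq hp hpe hDze (hEc z)
    rw [hdeg, hcoeff] at h2
    exact ⟨p, a, hp, by omega, hpe, norm_le_of_gaussian_growth hp
      (fun ζ => by rw [← hpe]; exact hgrz ζ), h2.2⟩
  -- Where `D M` does not vanish, the exponent is the quotient of `E (M + 2)` by `2 D M`. The
  -- order-two growth bounds it by `c ‖z‖²`, so the division is exact.
  obtain ⟨q', hq'⟩ := MvPolynomial.exists_eq_mul_of_norm_le (E := E (M + 2)) hM (C := 2 * c)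
    (by positivity) (fun z hz => by
      obtain ⟨p, a, -, -, -, ha, hE⟩ := key z hz
      rw [hE, norm_mul, norm_mul]
      have : ‖a‖ ≤ c * (1 + ‖z‖) ^ 2 := ha.trans (by gcongr; linarith)
      simp only [Complex.norm_ofNat]
      rw [mul_assoc 2 c]
      gcongr)
  have hq := eq_mul_homogeneousComponent (hEhom _) (hDhom _) hq'
  set q := MvPolynomial.C (2⁻¹ : ℂ) * homogeneousComponent 2 q' with hqdef
  have hqhom : q.IsHomogeneous 2 := (homogeneousComponent_isHomogeneous _ _).C_mul _
  have haq : ∀ z, eval z (D M) ≠ 0 → ∀ a, eval z (E (M + 2)) = 2 * a * eval z (D M) →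
      a = eval z q := fun z hz a ha => by
    rw [hq, map_mul, mul_comm] at ha
    have := mul_right_cancel₀ hz ha
    rw [hqdef, map_mul, eval_C, this]
    ring
  set e : ℕ → MvPolynomial (Fin d) ℂ := fun k =>
    if Even k then MvPolynomial.C ((k / 2).factorial : ℂ)⁻¹ * (-q) ^ (k / 2) else 0 with he
  -- The coefficients in `ζ` of `φ_z(ζ) e^{-q(z) ζ²}`, polynomial in `z` because `q` is. Beyond
  -- degree `M` they vanish wherever `D M` does not, hence everywhere.
  set p : ℕ → MvPolynomial (Fin d) ℂ := fun n => ∑ ij ∈ Finset.HasAntidiagonal.antidiagonal n,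
    g ij.1 * e ij.2 with hp
  have hpc : ∀ z, HasCoeffs (fun ζ => φ z ζ * Complex.exp (-eval z q * ζ ^ 2))
      fun k => eval z (p k) := by
    intro z
    convert! (hφ z).mul (HasCoeffs.gaussian (-eval z q)) using 1
    funext n
    simp only [hp, map_sum, map_mul]
    refine Finset.sum_congr rfl fun ij _ => ?_
    simp only [he]
    split_ifs <;> simp
  have hpM : ∀ k, M < k → p k = 0 := fun k hk => by
    have h0 : D M * p k = 0 := MvPolynomial.funext fun z => by
      rw [map_mul, map_zero, mul_eq_zero]
      by_contra! h
      obtain ⟨pz, a, -, hdeg, hpe, -, hE⟩ := key z h.1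
      have ha := haq z h.1 a hE
      have h1 : HasCoeffs (fun ζ => φ z ζ * Complex.exp (-eval z q * ζ ^ 2)) pz.coeff := by
        convert! HasCoeffs.polynomial pz using 1
        funext ζ
        rw [hpe, ha, mul_assoc, ← Complex.exp_add]
        simp
      have h2 := congrFun ((hpc z).unique h1) k
      exact h.2 (by rw [h2]; exact Polynomial.coeff_eq_zero_of_natDegree_lt (by omega))
    exact (mul_eq_zero.1 h0).resolve_left hM
  refine ⟨∑ k ∈ Finset.range (M + 1), p k, q, D M, hqhom, hM, fun z => ?_, fun z hz => ?_⟩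
  · have h1 := hpc z 1
    have h2 := hasSum_sum_of_ne_finset_zero (s := Finset.range (M + 1))
      (f := fun k => eval z (p k) * 1 ^ k) (L := SummationFilter.unconditional ℕ) (fun k hk => by
        rw [hpM k (by simpa [Nat.lt_succ_iff] using hk), map_zero, zero_mul])
    have h3 := h1.unique h2
    simp only [one_pow, mul_one] at h3
    rw [map_sum, ← h3, mul_assoc, ← Complex.exp_add]
    simp
  · obtain ⟨pz, a, hpz, -, hpe, -, hE⟩ := key z hz
    rw [haq z hz a hE] at hpe
    exact ⟨pz, hpz, hpe⟩

/-! ### Polynomials at real points, real quadratic forms, and integration of coefficients. -/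

namespace MvPolynomial

/-- A polynomial in complex variables vanishing at almost all real points of a neighbourhood of the
origin is zero. -/
lemma eq_zero_of_ae_eval_ofReal_eq_zero {d : ℕ} {p : MvPolynomial (Fin d) ℂ}
    {U : Set (EuclideanSpace ℝ (Fin d))} (hU : IsOpen U) (h0 : 0 ∈ U)
    (h : ∀ᵐ x ∂(volume.restrict U), eval (fun i => (x i : ℂ)) p = 0) : p = 0 := by
  have hcont : Continuous fun x : EuclideanSpace ℝ (Fin d) => eval (fun i => (x i : ℂ)) p :=
    p.continuous_eval.comp (by fun_prop)
  have hall : Set.EqOn (fun x : EuclideanSpace ℝ (Fin d) => eval (fun i => (x i : ℂ)) p)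
      (fun _ => 0) U :=
    Measure.eqOn_open_of_ae_eq h hU hcont.continuousOn continuousOn_const
  set e : (Fin d → ℝ) → EuclideanSpace ℝ (Fin d) := fun x => WithLp.toLp 2 x with he
  have hec : Continuous e := PiLp.continuous_toLp 2 _
  obtain ⟨ε, hε, hball⟩ := Metric.isOpen_iff.1 (hU.preimage hec) 0 (by simpa [he] using h0)
  refine funext_set (fun _ => (fun x : ℝ => (x : ℂ)) '' Set.Ioo (-ε) ε)
    (fun i => (Set.Ioo_infinite (by linarith)).image Complex.ofReal_injective.injOn)
    (fun z hz => ?_)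
  choose! x hx hxz using fun i => hz i (Set.mem_univ i)
  have hz' : z = fun i => ((x i : ℝ) : ℂ) := _root_.funext fun i => (hxz i).symm
  have hxU : e x ∈ U := hball (by
    rw [mem_ball_zero_iff, pi_norm_lt_iff hε]
    exact fun i => abs_lt.2 (hx i))
  rw [hz', map_zero]
  exact hall hxU

lemma eval_ofReal_map_conj {d : ℕ} (p : MvPolynomial (Fin d) ℂ) (x : Fin d → ℝ) :
    eval (fun i => (x i : ℂ)) (map (starRingEnd ℂ) p) =
      starRingEnd ℂ (eval (fun i => (x i : ℂ)) p) := by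
  rw [eval_map, eval₂_eq, eval_eq, map_sum]
  refine Finset.sum_congr rfl fun m _ => ?_
  simp [map_prod]

/-- A quadratic form taking real values at real points is given there by a real symmetric
matrix. -/
lemma IsHomogeneous.exists_isSymm_matrix {d : ℕ} {q : MvPolynomial (Fin d) ℂ}
    (hq : q.IsHomogeneous 2)
    (hre : ∀ x : EuclideanSpace ℝ (Fin d), (eval (fun i => (x i : ℂ)) q).im = 0) :
    ∃ B : Matrix (Fin d) (Fin d) ℝ, B.IsSymm ∧ ∀ x : EuclideanSpace ℝ (Fin d),
      eval (fun i => (x i : ℂ)) q =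
        ((-Real.pi * inner ℝ (Matrix.toEuclideanLin B x) x : ℝ) : ℂ) := by
  -- The constant Hessian of `q`: Euler's identity applied twice recovers `q` from it, and commuting
  -- derivatives make it symmetric.
  set c : Fin d → Fin d → ℂ := fun i j => coeff 0 (pderiv i (pderiv j q)) with hc
  have hsecond : ∀ i j, pderiv i (pderiv j q) = MvPolynomial.C (c i j) := fun i j => by
    have h1 : (pderiv i (pderiv j q)).IsHomogeneous 0 := hq.pderiv.pderiv
    rw [← totalDegree_zero_iff_isHomogeneous] at h1
    exact totalDegree_eq_zero_iff_eq_C.1 h1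
  have heuler : ∀ z, eval z q = 2⁻¹ * ∑ i, ∑ j, c i j * (z j * z i) := fun z => by
    have h1 := congrArg (eval z) hq.sum_X_mul_pderiv
    have h2 : ∀ j, eval z (pderiv j q) = ∑ i, z i * c i j := fun j => by
      have h3 := congrArg (eval z) (hq.pderiv (i := j)).sum_X_mul_pderiv
      simp only [hsecond, Nat.add_one_sub_one, one_smul, map_sum, map_mul, eval_X, eval_C] at h3
      exact h3.symm
    simp only [map_sum, map_mul, eval_X, h2, nsmul_eq_mul, Nat.cast_ofNat] at h1
    have h4 : (2 : ℂ) * eval z q = ∑ i, ∑ j, c i j * (z j * z i) := by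
      rw [Finset.sum_comm]
      rw [map_ofNat] at h1
      rw [← h1]
      refine Finset.sum_congr rfl fun j _ => ?_
      rw [Finset.mul_sum]
      exact Finset.sum_congr rfl fun i _ => by ring
    rw [← h4]; ring
  refine ⟨Matrix.of fun i j => -(2 * Real.pi)⁻¹ * (c i j).re, ?_, fun x => ?_⟩
  · ext i j
    simp only [Matrix.transpose_apply, Matrix.of_apply, hc]
    have h1 : ⁅pderiv i, pderiv j⁆ = (0 : Derivation ℂ (MvPolynomial (Fin d) ℂ) _) :=
      derivation_ext fun k => by
        rw [Derivation.commutator_apply, pderiv_X, pderiv_X, Pi.single_apply, Pi.single_apply]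
        split_ifs <;> simp
    have h2 := congrArg (fun D => D q) h1
    rw [Derivation.commutator_apply, Derivation.zero_apply, sub_eq_zero] at h2
    rw [h2]
  · have h1 : eval (fun i => (x i : ℂ)) q = ((eval (fun i => (x i : ℂ)) q).re : ℂ) :=
      Complex.ext (by simp) (by simp [hre x])
    rw [h1]
    congr 1
    rw [heuler]
    have h2 : (2⁻¹ * ∑ i, ∑ j, c i j * ((x j : ℂ) * (x i : ℂ))).re =
        2⁻¹ * ∑ i, ∑ j, (c i j).re * (x j * x i) := by
      rw [show (2⁻¹ : ℂ) = ((2⁻¹ : ℝ) : ℂ) by push_cast; rfl, Complex.re_ofReal_mul, Complex.re_sum]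
      congr 1
      refine Finset.sum_congr rfl fun i _ => ?_
      rw [Complex.re_sum]
      refine Finset.sum_congr rfl fun j _ => ?_
      rw [← Complex.ofReal_mul, Complex.re_mul_ofReal]
    rw [h2, PiLp.inner_apply]
    simp only [Matrix.toLpLin_apply, Matrix.mulVec, dotProduct, Matrix.of_apply, RCLike.inner_apply,
      conj_trivial, Finset.mul_sum]
    refine Finset.sum_congr rfl fun i _ => Finset.sum_congr rfl fun j _ => ?_
    have := Real.pi_ne_zero
    field_simp

/-- Integrating a polynomial whose coefficients are polynomials in the variable of integration. -/
lemma exists_eval_eq_integral {d : ℕ} {σ : Type*} {h : EuclideanSpace ℝ (Fin d) → ℂ}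
    (hh : ∀ r : MvPolynomial (Fin d) ℂ, Integrable fun x => h x * eval (fun i => (x i : ℂ)) r)
    (q : MvPolynomial σ (MvPolynomial (Fin d) ℂ)) :
    ∃ P : MvPolynomial σ ℂ, P.support ⊆ q.support ∧
      ∀ z, eval z P = ∫ x, h x * eval₂ (eval fun i => (x i : ℂ)) z q := by
  classical
  refine ⟨∑ β ∈ q.support, monomial β (∫ x, h x * eval (fun i => (x i : ℂ)) (coeff β q)),
    ?_, fun z => ?_⟩
  · refine (support_sum).trans (Finset.biUnion_subset.2 fun β hβ => ?_)
    exact (support_monomial_subset).trans (Finset.singleton_subset_iff.2 hβ)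
  · rw [map_sum]
    simp only [eval_monomial, eval₂_eq, Finset.mul_sum]
    rw [integral_finsetSum]
    · refine Finset.sum_congr rfl fun β _ => ?_
      rw [← integral_mul_const]
      refine integral_congr_ae (Filter.Eventually.of_forall fun x => ?_)
      simp only [Finsupp.prod]
      ring
    · intro β _
      refine ((hh (coeff β q)).mul_const (∏ i ∈ β.support, z i ^ β i)).congr ?_
      exact Filter.Eventually.of_forall fun x => by simp only; ring

end MvPolynomial

/-! ### The Fourier–Laplace transform and its Taylor coefficients. -/

/-- The complex bilinear extension of the Euclidean scalar product, in its second variable. -/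
noncomputable def complexPairing {d : ℕ} (x : EuclideanSpace ℝ (Fin d)) (z : Fin d → ℂ) : ℂ :=
  ∑ i, (x i : ℂ) * z i

/-- The Fourier transform at complex arguments. -/
noncomputable def fourierLaplace {d : ℕ} (h : EuclideanSpace ℝ (Fin d) → ℂ) (z : Fin d → ℂ) : ℂ :=
  ∫ x, h x * Complex.exp (-2 * Real.pi * Complex.I * complexPairing x z)

lemma complexPairing_ofReal {d : ℕ} (x y : EuclideanSpace ℝ (Fin d)) :
    complexPairing x (fun i => (y i : ℂ)) = (inner ℝ x y : ℝ) := by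
  simp [complexPairing, PiLp.inner_apply, mul_comm]

lemma complexPairing_smul {d : ℕ} (x : EuclideanSpace ℝ (Fin d)) (ζ : ℂ) (z : Fin d → ℂ) :
    complexPairing x (ζ • z) = ζ * complexPairing x z := by
  simp only [complexPairing, Pi.smul_apply, smul_eq_mul, Finset.mul_sum]
  exact Finset.sum_congr rfl fun i _ => by ring

lemma continuous_complexPairing {d : ℕ} (z : Fin d → ℂ) :
    Continuous fun x : EuclideanSpace ℝ (Fin d) => complexPairing x z := by
  unfold complexPairing; fun_prop

lemma abs_apply_le_norm {d : ℕ} (x : EuclideanSpace ℝ (Fin d)) (i : Fin d) : |x i| ≤ ‖x‖ := by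
  simpa using PiLp.norm_apply_le x i

lemma norm_complexPairing_le {d : ℕ} (x : EuclideanSpace ℝ (Fin d)) (z : Fin d → ℂ) :
    ‖complexPairing x z‖ ≤ d * ‖z‖ * ‖x‖ := by
  refine (norm_sum_le _ _).trans ?_
  refine (Finset.sum_le_card_nsmul _ _ (‖z‖ * ‖x‖) fun i _ => ?_).trans_eq (by simp [mul_assoc])
  rw [norm_mul, mul_comm]
  have := abs_apply_le_norm x i
  gcongr
  · exact norm_le_pi_norm z i
  · simpa using this

lemma fourierLaplace_ofReal {d : ℕ} (h : EuclideanSpace ℝ (Fin d) → ℂ)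
    (y : EuclideanSpace ℝ (Fin d)) : fourierLaplace h (fun i => (y i : ℂ)) = 𝓕 h y := by
  rw [Real.fourier_eq', fourierLaplace]
  refine integral_congr_ae (Filter.Eventually.of_forall fun x => ?_)
  simp only [smul_eq_mul]
  rw [mul_comm, complexPairing_ofReal]
  congr 2
  push_cast; ring

lemma MvPolynomial.exists_norm_eval_le {d : ℕ} (p : MvPolynomial (Fin d) ℂ) :
    ∃ C, 0 ≤ C ∧ ∀ z : Fin d → ℂ, ‖eval z p‖ ≤ C * (1 + ‖z‖) ^ p.totalDegree := by
  refine ⟨∑ m ∈ p.support, ‖coeff m p‖, by positivity, fun z => ?_⟩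
  rw [eval_eq, Finset.sum_mul]
  refine (norm_sum_le _ _).trans (Finset.sum_le_sum fun m hm => ?_)
  rw [norm_mul, norm_prod]
  gcongr
  have hz := norm_nonneg z
  calc ∏ i ∈ m.support, ‖z i ^ m i‖ ≤ ∏ i ∈ m.support, (1 + ‖z‖) ^ m i := by
        refine Finset.prod_le_prod (fun _ _ => norm_nonneg _) fun i _ => ?_
        rw [norm_pow]
        gcongr
        linarith [norm_le_pi_norm z i]
    _ = (1 + ‖z‖) ^ m.degree := by rw [Finset.prod_pow_eq_pow_sum]; rfl
    _ ≤ (1 + ‖z‖) ^ p.totalDegree := by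
        refine pow_le_pow_right₀ (by linarith) ?_
        rw [Finsupp.degree_apply]
        exact le_totalDegree hm

lemma norm_ofReal_le {d : ℕ} (x : EuclideanSpace ℝ (Fin d)) : ‖fun i => (x i : ℂ)‖ ≤ ‖x‖ :=
  (pi_norm_le_iff_of_nonneg (norm_nonneg x)).2 fun i => by simpa using abs_apply_le_norm x i

lemma one_add_pow_le_exp (n : ℕ) {t : ℝ} (ht : 0 ≤ t) :
    (1 + t) ^ n ≤ n.factorial * Real.exp 1 * Real.exp t := by
  have h := Real.pow_div_factorial_le_exp (x := 1 + t) (by linarith) n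
  rw [div_le_iff₀ (by positivity), Real.exp_add] at h
  linarith

lemma integrable_exp_neg_mul_sq_norm {d : ℕ} {b : ℝ} (hb : 0 < b) :
    Integrable fun x : EuclideanSpace ℝ (Fin d) => Real.exp (-b * ‖x‖ ^ 2) := by
  have h := GaussianFourier.integrable_cexp_neg_mul_sq_norm_add
    (V := EuclideanSpace ℝ (Fin d)) (b := (b : ℂ)) (by simpa using hb) 0 0
  refine h.norm.congr (Filter.Eventually.of_forall fun x => ?_)
  simp only
  rw [Complex.norm_exp]
  congr 1
  rw [← Complex.ofReal_neg, ← Complex.ofReal_pow]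
  simp [-Complex.ofReal_pow]

lemma neg_mul_sq_add_mul_le {b : ℝ} (hb : 0 < b) (c t : ℝ) :
    -b * t ^ 2 + c * t ≤ -(b / 2) * t ^ 2 + c ^ 2 / (2 * b) := by
  have h : -b * t ^ 2 + c * t = -(b / 2) * t ^ 2 + c ^ 2 / (2 * b) - (b * t - c) ^ 2 / (2 * b) := by
    field_simp; ring
  have : 0 ≤ (b * t - c) ^ 2 / (2 * b) := by positivity
  linarith

lemma integrable_exp_neg_sq_add {d : ℕ} {b : ℝ} (hb : 0 < b) (c : ℝ) :
    Integrable fun x : EuclideanSpace ℝ (Fin d) => Real.exp (-b * ‖x‖ ^ 2 + c * ‖x‖) := by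
  refine ((integrable_exp_neg_mul_sq_norm (d := d) (half_pos hb)).const_mul
    (Real.exp (c ^ 2 / (2 * b)))).mono' (by fun_prop) (Filter.Eventually.of_forall fun x => ?_)
  rw [Real.norm_of_nonneg (Real.exp_pos _).le, ← Real.exp_add, Real.exp_le_exp]
  linarith [neg_mul_sq_add_mul_le hb c ‖x‖]

lemma MeasureTheory.MemLp.integrable_norm_mul_exp {d : ℕ} {f : EuclideanSpace ℝ (Fin d) → ℂ}
    (hf : MemLp f 2) {b : ℝ} (hb : 0 < b) (c : ℝ) :
    Integrable fun x => ‖f x‖ * Real.exp (-b * ‖x‖ ^ 2 + c * ‖x‖) := by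
  have h : MemLp (fun x : EuclideanSpace ℝ (Fin d) => Real.exp (-b * ‖x‖ ^ 2 + c * ‖x‖)) 2 := by
    refine (memLp_two_iff_integrable_sq (by fun_prop)).2 ?_
    refine (integrable_exp_neg_sq_add (d := d) (b := 2 * b) (by positivity) (2 * c)).congr
      (Filter.Eventually.of_forall fun x => ?_)
    simp only [← Real.exp_nat_mul]
    congr 1; push_cast; ring
  exact hf.norm.integrable_mul h

/-- The function `h` has finite exponential moments of every order. -/
structure HasExpMoments {d : ℕ} (h : EuclideanSpace ℝ (Fin d) → ℂ) : Prop where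
  aestronglyMeasurable : AEStronglyMeasurable h
  integrable (c : ℝ) : Integrable fun x => ‖h x‖ * Real.exp (c * ‖x‖)

lemma MeasureTheory.MemLp.hasExpMoments {d : ℕ} {f : EuclideanSpace ℝ (Fin d) → ℂ}
    (hf : MemLp f 2) {b : ℝ} (hb : 0 < b) :
    HasExpMoments fun x => f x * (Real.exp (-b * ‖x‖ ^ 2) : ℂ) where
  aestronglyMeasurable := hf.1.mul (by fun_prop)
  integrable c := by
    refine (hf.integrable_norm_mul_exp hb c).congr (Filter.Eventually.of_forall fun x => ?_)
    simp only
    rw [Real.exp_add, norm_mul, Complex.norm_real, Real.norm_of_nonneg (Real.exp_pos _).le]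
    ring

namespace HasExpMoments

variable {d : ℕ} {h : EuclideanSpace ℝ (Fin d) → ℂ}

lemma integrable_mul (hh : HasExpMoments h) {g : EuclideanSpace ℝ (Fin d) → ℂ}
    (hg : Continuous g) {C c : ℝ} (hC : ∀ x, ‖g x‖ ≤ C * Real.exp (c * ‖x‖)) :
    Integrable fun x => h x * g x := by
  refine ((hh.integrable c).const_mul C).mono'
    (hh.aestronglyMeasurable.mul hg.aestronglyMeasurable) (Filter.Eventually.of_forall fun x => ?_)
  rw [norm_mul]
  calc ‖h x‖ * ‖g x‖ ≤ ‖h x‖ * (C * Real.exp (c * ‖x‖)) := by gcongr; exact hC x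
    _ = _ := by ring

lemma integrable_mul_eval (hh : HasExpMoments h) (r : MvPolynomial (Fin d) ℂ) :
    Integrable fun x => h x * MvPolynomial.eval (fun i => (x i : ℂ)) r := by
  obtain ⟨C, hC0, hC⟩ := r.exists_norm_eval_le
  refine hh.integrable_mul (r.continuous_eval.comp (by fun_prop))
    (C := C * (r.totalDegree.factorial * Real.exp 1)) (c := 1) fun x => (hC _).trans ?_
  rw [mul_assoc, one_mul]
  gcongr
  refine le_trans ?_ (one_add_pow_le_exp _ (norm_nonneg x))
  gcongr
  exact norm_ofReal_le x

/-- The Taylor expansion of the Fourier–Laplace transform along complex lines. -/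
lemma hasCoeffs_integral (hh : HasExpMoments h) (a : ℂ) (z : Fin d → ℂ) :
    HasCoeffs (fun ζ => ∫ x, h x * Complex.exp (a * complexPairing x (ζ • z)))
      fun k => a ^ k / k.factorial * ∫ x, h x * complexPairing x z ^ k := by
  intro ζ
  set L := ‖a * ζ‖ * (d * ‖z‖) with hL
  set F : ℕ → EuclideanSpace ℝ (Fin d) → ℂ := fun k x =>
    h x * ((a * ζ * complexPairing x z) ^ k / k.factorial) with hF
  have hterm : ∀ k x, ‖(a * ζ * complexPairing x z) ^ k / k.factorial‖ ≤
      (L * ‖x‖) ^ k / k.factorial := fun k x => by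
    rw [norm_div, norm_pow, norm_mul, Complex.norm_natCast, hL, mul_assoc ‖a * ζ‖]
    gcongr
    exact norm_complexPairing_le x z
  have hL0 : 0 ≤ L := by positivity
  have hFi : ∀ k, Integrable (F k) := fun k =>
    hh.integrable_mul (C := 1) (c := L)
      (by have := continuous_complexPairing z; fun_prop) fun x => by
        rw [one_mul]
        exact (hterm k x).trans (Real.pow_div_factorial_le_exp _ (by positivity) k)
  have hsum : Summable fun k => ∫ x, ‖F k x‖ := by
    refine summable_of_sum_range_le (c := ∫ x, ‖h x‖ * Real.exp (L * ‖x‖))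
      (fun k => by positivity) fun n => ?_
    rw [← integral_finsetSum _ fun k _ => (hFi k).norm]
    refine integral_mono (integrable_finsetSum _ fun k _ => (hFi k).norm) (hh.integrable L)
      fun x => ?_
    simp only [hF, norm_mul, ← Finset.mul_sum]
    gcongr
    refine (Finset.sum_le_sum fun k _ => hterm k x).trans
      (Real.sum_le_exp_of_nonneg (by positivity) n)
  have h1 := hasSum_integral_of_summable_integral_norm hFi hsum
  convert! h1 using 1
  · funext k
    simp only
    rw [← integral_const_mul, ← integral_mul_const]
    congr 1
    funext x
    simp only [hF, mul_pow]
    ring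
  · refine integral_congr_ae (Filter.Eventually.of_forall fun x => ?_)
    simp only
    have h2 := NormedSpace.expSeries_div_hasSum_exp (a * ζ * complexPairing x z)
    rw [← Complex.exp_eq_exp_ℂ] at h2
    rw [tsum_mul_left, h2.tsum_eq, complexPairing_smul, mul_assoc]

/-- Expanding the `k`-th power of the pairing gives a form of degree `k` in `z` with coefficients
polynomial in `x`; these are integrated one by one. -/
lemma exists_homogeneous_moment (hh : HasExpMoments h) (k : ℕ) :
    ∃ g : MvPolynomial (Fin d) ℂ, g.IsHomogeneous k ∧
      ∀ z, MvPolynomial.eval z g = ∫ x, h x * complexPairing x z ^ k := by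
  set q : MvPolynomial (Fin d) (MvPolynomial (Fin d) ℂ) :=
    (∑ i, MvPolynomial.C (MvPolynomial.X i) * MvPolynomial.X i) ^ k with hq
  have hqh : q.IsHomogeneous k := by
    have h1 : (∑ i, MvPolynomial.C (MvPolynomial.X i) * MvPolynomial.X i :
        MvPolynomial (Fin d) (MvPolynomial (Fin d) ℂ)).IsHomogeneous 1 :=
      MvPolynomial.IsHomogeneous.sum _ _ _ fun i _ => MvPolynomial.isHomogeneous_C_mul_X _ _
    simpa using h1.pow k
  obtain ⟨P, hP, hPe⟩ := MvPolynomial.exists_eval_eq_integral hh.integrable_mul_eval q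
  refine ⟨P, fun m hm => ?_, fun z => ?_⟩
  · exact hqh (MvPolynomial.mem_support_iff.1 (hP (MvPolynomial.mem_support_iff.2 hm)))
  · rw [hPe]
    congr 1
    funext x
    simp [hq, MvPolynomial.eval₂_pow, MvPolynomial.eval₂_sum, MvPolynomial.eval₂_mul,
      complexPairing]

end HasExpMoments

/-- The growth of the Fourier–Laplace transform of the product of an `L²` function and a
Gaussian. -/
lemma MeasureTheory.MemLp.exists_norm_fourierLaplace_le {d : ℕ} {f : EuclideanSpace ℝ (Fin d) → ℂ}
    (hf : MemLp f 2) : ∃ C, ∀ z, ‖fourierLaplace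
      (fun x => f x * (Real.exp (-Real.pi * ‖x‖ ^ 2) : ℂ)) z‖ ≤
        C * Real.exp (2 * Real.pi * d ^ 2 * ‖z‖ ^ 2) := by
  have hpi := Real.pi_pos
  refine ⟨∫ x, ‖f x‖ * Real.exp (-(Real.pi / 2) * ‖x‖ ^ 2 + 0 * ‖x‖), fun z => ?_⟩
  rw [fourierLaplace, ← integral_mul_const]
  refine norm_integral_le_of_norm_le ((hf.integrable_norm_mul_exp (by positivity) 0).mul_const _)
    (Filter.Eventually.of_forall fun x => ?_)
  rw [norm_mul, norm_mul, Complex.norm_real, Real.norm_of_nonneg (Real.exp_pos _).le,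
    mul_assoc ‖f x‖, mul_assoc ‖f x‖, ← Real.exp_add]
  gcongr
  have h1 : ‖Complex.exp (-2 * Real.pi * Complex.I * complexPairing x z)‖ ≤
      Real.exp (2 * Real.pi * d * ‖z‖ * ‖x‖) := by
    refine (Complex.norm_exp_le_exp_norm _).trans (Real.exp_le_exp.2 ?_)
    rw [norm_mul]
    have h2 : ‖-2 * (Real.pi : ℂ) * Complex.I‖ = 2 * Real.pi := by
      simp [abs_of_pos hpi]
    rw [h2]
    have := norm_complexPairing_le x z
    calc 2 * Real.pi * ‖complexPairing x z‖ ≤ 2 * Real.pi * (d * ‖z‖ * ‖x‖) := by gcongr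
      _ = _ := by ring
  refine (mul_le_mul_of_nonneg_left h1 (Real.exp_pos _).le).trans ?_
  rw [← Real.exp_add]
  refine Real.exp_le_exp.2 ?_
  -- Half of the Gaussian absorbs the linear exponent, at the cost of `e^{2π d² ‖z‖²}`; the other
  -- half keeps the integral finite. The factor `d` is due to the sup norm on `z`.
  have h3 := neg_mul_sq_add_mul_le hpi (2 * Real.pi * d * ‖z‖) ‖x‖
  have h4 : (2 * Real.pi * d * ‖z‖) ^ 2 / (2 * Real.pi) = 2 * Real.pi * d ^ 2 * ‖z‖ ^ 2 := by
    field_simp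
  rw [h4] at h3
  linarith

/-- Both transforms have the same integrals against compactly supported smooth functions: the `L²`
one through tempered distributions, the integral one by exchanging the transform between the
factors. -/
lemma fourier_toLp_ae_eq {d : ℕ} {f : EuclideanSpace ℝ (Fin d) → ℂ} (h1 : Integrable f)
    (h2 : MemLp f 2) :
    ⇑(𝓕 (h2.toLp f) : Lp ℂ 2 (volume : Measure (EuclideanSpace ℝ (Fin d)))) =ᵐ[volume] 𝓕 f := by
  have hcont : Continuous (𝓕 f) :=
    VectorFourier.fourierIntegral_continuous Real.continuous_fourierChar
      (by exact continuous_inner) h1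
  refine ae_eq_of_integral_contDiff_smul_eq
    ((Lp.memLp _).locallyIntegrable (by norm_num)) hcont.locallyIntegrable fun g hg hgs => ?_
  have hgC : HasCompactSupport fun x => (g x : ℂ) := hgs.comp_left (g := ((↑) : ℝ → ℂ)) rfl
  have hgD : ContDiff ℝ (⊤ : ℕ∞) fun x => (g x : ℂ) := Complex.ofRealCLM.contDiff.comp hg
  set φ := hgC.toSchwartzMap hgD
  have hφ : ∀ x, φ x = (g x : ℂ) := fun x => rfl
  have key := DFunLike.congr_fun (Lp.fourier_toTemperedDistribution_eq (h2.toLp f)) φ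
  rw [TemperedDistribution.fourier_apply, Lp.toTemperedDistribution_apply,
    Lp.toTemperedDistribution_apply] at key
  have e1 : ∫ x, g x • (𝓕 (h2.toLp f) : Lp ℂ 2 (volume : Measure (EuclideanSpace ℝ (Fin d)))) x
      = ∫ x, φ x • (𝓕 (h2.toLp f) : Lp ℂ 2 (volume : Measure (EuclideanSpace ℝ (Fin d)))) x := by
    simp [hφ]
  rw [e1, ← key]
  have e2 : ∫ x, (𝓕 φ) x • (h2.toLp f) x = ∫ x, (𝓕 (φ : EuclideanSpace ℝ (Fin d) → ℂ)) x • f x := by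
    refine integral_congr_ae ?_
    filter_upwards [h2.coeFn_toLp] with x hx
    rw [hx, SchwartzMap.fourier_coe]
  rw [e2]
  have e3 : ∫ x, (𝓕 (φ : EuclideanSpace ℝ (Fin d) → ℂ)) x • f x = ∫ x, φ x • 𝓕 f x := by
    simpa using! (VectorFourier.integral_fourierIntegral_smul_eq_flip
      (L := innerₗ (EuclideanSpace ℝ (Fin d))) Real.continuous_fourierChar continuous_inner
      φ.integrable h1)
  rw [e3]
  simp [hφ]

lemma norm_gaussianWave {d : ℕ} (y x : EuclideanSpace ℝ (Fin d)) :
    ‖Complex.exp (-(Real.pi : ℂ) * ‖x‖ ^ 2 + 2 * Real.pi * Complex.I * (inner ℝ y x : ℝ))‖ =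
      Real.exp (-Real.pi * ‖x‖ ^ 2) := by
  rw [Complex.norm_exp]
  congr 1
  have : (2 * (Real.pi : ℂ) * Complex.I * (inner ℝ y x : ℝ)).re = 0 := by simp
  rw [Complex.add_re, this, add_zero]
  norm_cast

/-- Parseval's identity against a modulated Gaussian, whose Fourier transform is the Gaussian
centred at `y`. -/
lemma fourierLaplace_gaussian_eq_integral {d : ℕ}
    (f : Lp ℂ 2 (volume : Measure (EuclideanSpace ℝ (Fin d)))) (y : EuclideanSpace ℝ (Fin d)) :
    fourierLaplace (fun x => f x * (Real.exp (-Real.pi * ‖x‖ ^ 2) : ℂ)) (fun i => (y i : ℂ)) =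
      ∫ t, (𝓕 f : Lp ℂ 2 (volume : Measure (EuclideanSpace ℝ (Fin d)))) t *
        (Real.exp (-Real.pi * ‖y - t‖ ^ 2) : ℂ) := by
  set u : EuclideanSpace ℝ (Fin d) → ℂ := fun x =>
    Complex.exp (-(Real.pi : ℂ) * ‖x‖ ^ 2 + 2 * Real.pi * Complex.I * (inner ℝ y x : ℝ))
  have hu : Continuous u := by fun_prop
  have hu1 : Integrable u := by
    rw [← integrable_norm_iff hu.aestronglyMeasurable]
    exact (integrable_exp_neg_mul_sq_norm Real.pi_pos).congr
      (Filter.Eventually.of_forall fun x => (norm_gaussianWave y x).symm)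
  have hu2 : MemLp u 2 := by
    rw [memLp_two_iff_integrable_sq_norm hu.aestronglyMeasurable]
    refine (integrable_exp_neg_mul_sq_norm (d := d) (b := 2 * Real.pi) (by positivity)).congr
      (Filter.Eventually.of_forall fun x => ?_)
    simp only [u, norm_gaussianWave, ← Real.exp_nat_mul]
    congr 1; push_cast; ring
  have hFu : ∀ t, 𝓕 u t = (Real.exp (-Real.pi * ‖y - t‖ ^ 2) : ℂ) := fun t => by
    have := fourier_gaussian_innerProductSpace' (V := EuclideanSpace ℝ (Fin d))
      (b := (Real.pi : ℂ)) (by simpa using Real.pi_pos) y t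
    have hpi : (Real.pi : ℂ) ≠ 0 := by exact_mod_cast Real.pi_ne_zero
    rw [show u = _ from rfl, this, div_self hpi, Complex.one_cpow, one_mul, Complex.ofReal_exp]
    congr 1
    push_cast
    field_simp
  have hin := Lp.inner_fourier_eq (hu2.toLp u) f
  rw [L2.inner_def, L2.inner_def] at hin
  have hL : fourierLaplace (fun x => f x * (Real.exp (-Real.pi * ‖x‖ ^ 2) : ℂ))
      (fun i => (y i : ℂ)) = ∫ x, inner ℂ ((hu2.toLp u) x) (f x) := by
    rw [fourierLaplace]
    refine integral_congr_ae ?_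
    filter_upwards [hu2.coeFn_toLp] with x hx
    rw [hx, RCLike.inner_apply, complexPairing_ofReal, mul_assoc, Complex.ofReal_exp,
      ← Complex.exp_add, ← Complex.exp_conj]
    congr 2
    rw [real_inner_comm]
    have h2c : (starRingEnd ℂ) 2 = 2 := Complex.conj_ofReal 2
    simp [h2c]
  rw [hL, ← hin]
  refine integral_congr_ae ?_
  filter_upwards [fourier_toLp_ae_eq hu1 hu2] with t ht
  rw [ht, hFu, RCLike.inner_apply, Complex.conj_ofReal]

/-! ### The polynomial estimate extracted from the integral. -/

/-- The pointwise inequality behind the estimate: it compares the kernel arising from the product of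
two values of the transform with the weight in the integral, at a polynomial cost in `y`. -/
lemma one_add_rpow_mul_exp_le {N : ℝ} {K : ℕ} (hK : N ≤ K) {d : ℕ}
    (x t y : EuclideanSpace ℝ (Fin d)) :
    (1 + ‖x‖ + ‖t‖) ^ N * (Real.exp (-Real.pi * ‖x‖ ^ 2 + 2 * Real.pi * |inner ℝ x y|) *
      Real.exp (-Real.pi * ‖y - t‖ ^ 2)) ≤
      (10 ^ K + K.factorial * Real.exp 1 * Real.exp 1) * (1 + ‖y‖) ^ K *
        Real.exp (2 * Real.pi * |inner ℝ x t|) := by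
  have hpi := Real.pi_gt_three
  have hx := norm_nonneg x
  have ht := norm_nonneg t
  have hy := norm_nonneg y
  have h1y : (1 : ℝ) ≤ (1 + ‖y‖) ^ K := one_le_pow₀ (by linarith)
  have hpow : (1 + ‖x‖ + ‖t‖) ^ N ≤ (1 + ‖x‖ + ‖t‖) ^ K := by
    rw [← Real.rpow_natCast]
    exact Real.rpow_le_rpow_of_exponent_le (by linarith) hK
  refine (mul_le_mul_of_nonneg_right hpow (by positivity)).trans ?_
  rw [← Real.exp_add]
  have hb : ‖t‖ ≤ ‖y‖ + ‖y - t‖ := by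
    have := norm_sub_le y (y - t); rwa [sub_sub_cancel] at this
  -- When `‖x‖ + ‖t‖` is at most `10 ‖y‖`, the power is polynomial in `y` and `2‖x‖‖y - t‖ ≤ ‖x‖² +
  -- ‖y - t‖²` replaces `y` by `t` in the scalar product. Otherwise `y` is negligible and the
  -- Gaussians beat every power of `‖x‖ + ‖t‖`; the factor `10` leaves a decay of at least `π S²/5`
  -- in the exponent.
  rcases le_or_gt (‖x‖ + ‖t‖) (10 * ‖y‖) with h | h
  · have e1 : |inner ℝ x y| ≤ |inner ℝ x t| + ‖x‖ * ‖y - t‖ := by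
      have : inner ℝ x y = inner ℝ x t + inner ℝ x (y - t) := by
        rw [← inner_add_right]; congr 1; abel
      rw [this]
      exact (abs_add_le _ _).trans (by gcongr; exact abs_real_inner_le_norm _ _)
    have e2 : Real.exp (-Real.pi * ‖x‖ ^ 2 + 2 * Real.pi * |inner ℝ x y| +
        -Real.pi * ‖y - t‖ ^ 2) ≤ Real.exp (2 * Real.pi * |inner ℝ x t|) := by
      refine Real.exp_le_exp.2 ?_
      nlinarith [mul_le_mul_of_nonneg_left e1 Real.pi_pos.le,
        mul_nonneg Real.pi_pos.le (sq_nonneg (‖x‖ - ‖y - t‖))]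
    refine mul_le_mul ?_ e2 (Real.exp_pos _).le (by positivity)
    calc (1 + ‖x‖ + ‖t‖) ^ K ≤ (10 * (1 + ‖y‖)) ^ K := by gcongr; linarith
      _ = 10 ^ K * (1 + ‖y‖) ^ K := mul_pow _ _ _
      _ ≤ _ := by gcongr; exact le_add_of_nonneg_right (by positivity)
  · set S := ‖x‖ + ‖t‖
    have e1 : |inner ℝ x y| ≤ ‖x‖ * ‖y‖ := abs_real_inner_le_norm _ _
    have e2 : -Real.pi * ‖x‖ ^ 2 + 2 * Real.pi * |inner ℝ x y| + -Real.pi * ‖y - t‖ ^ 2 ≤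
        1 - S := by
      have hxy : ‖x‖ * ‖y‖ ≤ S * (S / 10) := by
        refine mul_le_mul (by simp only [S]; linarith) (by linarith) hy (by positivity)
      have hsum : 9 / 10 * S ≤ ‖x‖ + ‖y - t‖ := by simp only [S] at h ⊢; linarith
      have hS : 0 ≤ S := by positivity
      have hsq : 81 / 100 * S ^ 2 ≤ 2 * (‖x‖ ^ 2 + ‖y - t‖ ^ 2) := by
        nlinarith [sq_nonneg (‖x‖ - ‖y - t‖), norm_nonneg (y - t)]
      have : 0 ≤ ‖x‖ ^ 2 + ‖y - t‖ ^ 2 - 2 * |inner ℝ x y| - S ^ 2 / 5 := by nlinarith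
      nlinarith [sq_nonneg (S - 1), mul_nonneg Real.pi_pos.le this]
    have e3 := one_add_pow_le_exp K (t := S) (by positivity)
    have e4 : Real.exp (1 - S) * Real.exp S = Real.exp 1 := by rw [← Real.exp_add]; congr 1; ring
    calc (1 + ‖x‖ + ‖t‖) ^ K * Real.exp (-Real.pi * ‖x‖ ^ 2 + 2 * Real.pi * |inner ℝ x y| +
          -Real.pi * ‖y - t‖ ^ 2)
        ≤ (K.factorial * Real.exp 1 * Real.exp S) * Real.exp (1 - S) := by
          rw [add_assoc]; gcongr
      _ = K.factorial * Real.exp 1 * Real.exp 1 := by rw [mul_assoc, mul_comm (Real.exp S), e4]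
      _ ≤ (10 ^ K + K.factorial * Real.exp 1 * Real.exp 1) * 1 * 1 := by
          rw [mul_one, mul_one]; exact le_add_of_nonneg_left (by positivity)
      _ ≤ _ := by gcongr; exact Real.one_le_exp (by positivity)

/-- For real `y`, the modulus of the exponential kernel at `uy` depends on `u` only through its
imaginary part. -/
lemma enorm_fourierLaplace_gaussian_le {d : ℕ} (f : EuclideanSpace ℝ (Fin d) → ℂ)
    (y : EuclideanSpace ℝ (Fin d)) {u : ℂ} (hu : |u.im| ≤ 1) :
    ‖fourierLaplace (fun x => f x * (Real.exp (-Real.pi * ‖x‖ ^ 2) : ℂ))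
      (u • fun i => (y i : ℂ))‖ₑ ≤ ∫⁻ x, ‖f x‖ₑ *
        ENNReal.ofReal (Real.exp (-Real.pi * ‖x‖ ^ 2 + 2 * Real.pi * |inner ℝ x y|)) := by
  refine (enorm_integral_le_lintegral_enorm _).trans (lintegral_mono fun x => ?_)
  rw [mul_assoc, enorm_mul, complexPairing_smul, complexPairing_ofReal]
  gcongr
  rw [← ofReal_norm]
  refine ENNReal.ofReal_le_ofReal ?_
  rw [norm_mul, Complex.norm_real, Real.norm_of_nonneg (Real.exp_pos _).le, Complex.norm_exp,
    ← Real.exp_add]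
  refine Real.exp_le_exp.2 (by
    have : (-2 * (Real.pi : ℂ) * Complex.I * (u * (inner ℝ x y : ℝ))).re =
        2 * Real.pi * (u.im * inner ℝ x y) := by simp
    rw [this]
    gcongr
    refine (le_abs_self _).trans ?_
    rw [abs_mul]
    exact mul_le_of_le_one_left (abs_nonneg _) hu)

/-- One factor is bounded by an integral over `f`, the other by an integral over its transform.
Tonelli combines them into a double integral, which the kernel comparison dominates. -/
lemma exists_norm_fourierLaplace_mul_le {d : ℕ} {N : ℝ}
    (f : Lp ℂ 2 (volume : Measure (EuclideanSpace ℝ (Fin d))))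
    (hI : (∫⁻ p : EuclideanSpace ℝ (Fin d) × EuclideanSpace ℝ (Fin d),
          ENNReal.ofReal (beurlingIntegrand N (⇑f)
            (⇑(𝓕 f : Lp ℂ 2 (volume : Measure (EuclideanSpace ℝ (Fin d))))) p.1 p.2)
          ∂((volume : Measure (EuclideanSpace ℝ (Fin d))).prod volume)) < ∞) :
    ∃ (K : ℕ) (C : ℝ), 0 ≤ C ∧ ∀ (y : EuclideanSpace ℝ (Fin d)) (u : ℂ), |u.im| ≤ 1 →
      ‖fourierLaplace (fun x => f x * (Real.exp (-Real.pi * ‖x‖ ^ 2) : ℂ))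
        (fun i => (y i : ℂ))‖ *
      ‖fourierLaplace (fun x => f x * (Real.exp (-Real.pi * ‖x‖ ^ 2) : ℂ))
        (u • fun i => (y i : ℂ))‖ ≤ C * (1 + ‖y‖) ^ K := by
  set I := ∫⁻ p : EuclideanSpace ℝ (Fin d) × EuclideanSpace ℝ (Fin d),
          ENNReal.ofReal (beurlingIntegrand N (⇑f)
            (⇑(𝓕 f : Lp ℂ 2 (volume : Measure (EuclideanSpace ℝ (Fin d))))) p.1 p.2)
          ∂((volume : Measure (EuclideanSpace ℝ (Fin d))).prod volume)
  set F : Lp ℂ 2 (volume : Measure (EuclideanSpace ℝ (Fin d))) := 𝓕 f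
  set K := ⌈N⌉₊
  have hK : N ≤ K := Nat.le_ceil N
  set c : ℝ := 10 ^ K + K.factorial * Real.exp 1 * Real.exp 1
  have hc : 0 ≤ c := by positivity
  refine ⟨K, c * I.toReal, by positivity, fun y u hu => ?_⟩
  set h := fun x => f x * (Real.exp (-Real.pi * ‖x‖ ^ 2) : ℂ)
  have h1 : ‖fourierLaplace h (fun i => (y i : ℂ))‖ₑ ≤
      ∫⁻ t, ‖F t‖ₑ * ENNReal.ofReal (Real.exp (-Real.pi * ‖y - t‖ ^ 2)) := by
    rw [fourierLaplace_gaussian_eq_integral]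
    refine (enorm_integral_le_lintegral_enorm _).trans_eq (lintegral_congr fun t => ?_)
    rw [enorm_mul, ← ofReal_norm (Complex.ofReal _), Complex.norm_real,
      Real.norm_of_nonneg (Real.exp_pos _).le]
  have h2 := enorm_fourierLaplace_gaussian_le f y hu
  have hf : AEMeasurable (fun x => ‖f x‖ₑ *
      ENNReal.ofReal (Real.exp (-Real.pi * ‖x‖ ^ 2 + 2 * Real.pi * |inner ℝ x y|))) :=
    (Lp.aestronglyMeasurable f).enorm.mul (by fun_prop)
  have hF : AEMeasurable (fun t => ‖F t‖ₑ *
      ENNReal.ofReal (Real.exp (-Real.pi * ‖y - t‖ ^ 2))) :=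
    (Lp.aestronglyMeasurable F).enorm.mul (by fun_prop)
  have h3 : ‖fourierLaplace h (fun i => (y i : ℂ))‖ₑ *
      ‖fourierLaplace h (u • fun i => (y i : ℂ))‖ₑ ≤
      ENNReal.ofReal (c * (1 + ‖y‖) ^ K) * I := by
    rw [mul_comm]
    refine (mul_le_mul' h2 h1).trans ?_
    rw [← lintegral_prod_mul hf hF, ← lintegral_const_mul' _ _ ENNReal.ofReal_ne_top]
    refine lintegral_mono fun p => ?_
    rw [← ofReal_norm, ← ofReal_norm, ← ENNReal.ofReal_mul (norm_nonneg _),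
      ← ENNReal.ofReal_mul (norm_nonneg _), ← ENNReal.ofReal_mul (by positivity),
      ← ENNReal.ofReal_mul (by positivity)]
    refine ENNReal.ofReal_le_ofReal ?_
    have key := one_add_rpow_mul_exp_le hK p.1 p.2 y
    have hpos : (0 : ℝ) < (1 + ‖p.1‖ + ‖p.2‖) ^ N := by positivity
    rw [← le_div_iff₀' hpos] at key
    rw [beurlingIntegrand]
    calc _ = ‖f p.1‖ * ‖F p.2‖ * _ := by rw [mul_mul_mul_comm]
      _ ≤ ‖f p.1‖ * ‖F p.2‖ * _ := mul_le_mul_of_nonneg_left key (by positivity)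
      _ = _ := by ring
  have h4 := ENNReal.toReal_mono (ENNReal.mul_ne_top ENNReal.ofReal_ne_top hI.ne) h3
  rw [ENNReal.toReal_mul, ENNReal.toReal_mul, toReal_enorm, toReal_enorm,
    ENNReal.toReal_ofReal (by positivity)] at h4
  exact h4.trans_eq (by ring)

lemma MvPolynomial.eq_zero_of_eval_ofReal_eq_zero {d : ℕ} {p : MvPolynomial (Fin d) ℂ}
    (h : ∀ x : EuclideanSpace ℝ (Fin d), eval (fun i => (x i : ℂ)) p = 0) : p = 0 :=
  eq_zero_of_ae_eval_ofReal_eq_zero isOpen_univ (Set.mem_univ _) (Filter.Eventually.of_forall h)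

lemma HasExpMoments.integrable_self {d : ℕ} {h : EuclideanSpace ℝ (Fin d) → ℂ}
    (hh : HasExpMoments h) : Integrable h := by
  rw [← integrable_norm_iff hh.aestronglyMeasurable]
  simpa using hh.integrable 0

lemma MeasureTheory.MemLp.mul_gaussian {d : ℕ} {f : EuclideanSpace ℝ (Fin d) → ℂ}
    (hf : MemLp f 2) :
    MemLp (fun x => f x * (Real.exp (-Real.pi * ‖x‖ ^ 2) : ℂ)) 2 := by
  refine hf.of_le (hf.1.mul (by fun_prop)) (Filter.Eventually.of_forall fun x => ?_)
  rw [norm_mul, Complex.norm_real, Real.norm_of_nonneg (Real.exp_pos _).le]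
  refine mul_le_of_le_one_right (norm_nonneg _) (Real.exp_le_one_iff.2 ?_)
  have := mul_nonneg Real.pi_pos.le (sq_nonneg ‖x‖)
  linarith

lemma ae_eq_of_fourier_eq {d : ℕ} {g h : EuclideanSpace ℝ (Fin d) → ℂ}
    (hg1 : Integrable g) (hg2 : MemLp g 2) (hh1 : Integrable h) (hh2 : MemLp h 2)
    (H : 𝓕 g = 𝓕 h) : g =ᵐ[volume] h := by
  have h3 : (𝓕 (hg2.toLp g) : Lp ℂ 2 (volume : Measure (EuclideanSpace ℝ (Fin d)))) =
      𝓕 (hh2.toLp h) := by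
    refine Lp.ext ?_
    refine (fourier_toLp_ae_eq hg1 hg2).trans ?_
    rw [H]
    exact (fourier_toLp_ae_eq hh1 hh2).symm
  exact (MemLp.toLp_eq_toLp_iff hg2 hh2).1 ((Lp.fourierTransformₗᵢ _ ℂ).injective h3)

/-- The several-variable structure theorem is applied with the real vectors as its set of
directions, on which no nonzero polynomial vanishes identically. -/
lemma exists_polyGaussian_eq_fourier {d : ℕ} {N : ℝ}
    {f : Lp ℂ 2 (volume : Measure (EuclideanSpace ℝ (Fin d)))} (hf : f ≠ 0)
    (hI : (∫⁻ p : EuclideanSpace ℝ (Fin d) × EuclideanSpace ℝ (Fin d),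
          ENNReal.ofReal (beurlingIntegrand N (⇑f)
            (⇑(𝓕 f : Lp ℂ 2 (volume : Measure (EuclideanSpace ℝ (Fin d))))) p.1 p.2)
          ∂((volume : Measure (EuclideanSpace ℝ (Fin d))).prod volume)) < ∞) :
    ∃ (P : MvPolynomial (Fin d) ℂ) (B : Matrix (Fin d) (Fin d) ℝ), P ≠ 0 ∧ B.IsSymm ∧
      𝓕 (fun x => f x * (Real.exp (-Real.pi * ‖x‖ ^ 2) : ℂ)) = polyGaussian P B := by
  have hf2 : MemLp (⇑f) 2 := Lp.memLp f
  obtain ⟨K, C, hC0, hC⟩ := exists_norm_fourierLaplace_mul_le f hI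
  obtain ⟨C', hC'⟩ := hf2.exists_norm_fourierLaplace_le
  have hh := hf2.hasExpMoments Real.pi_pos
  have hh2 := hf2.mul_gaussian
  set h := fun x => f x * (Real.exp (-Real.pi * ‖x‖ ^ 2) : ℂ) with hdef
  obtain ⟨y₀, hy₀⟩ : ∃ y, 𝓕 h y ≠ 0 := by
    by_contra! hcon
    refine hf (Lp.eq_zero_iff_ae_eq_zero.2 ?_)
    have hz : 𝓕 h = 𝓕 (fun _ : EuclideanSpace ℝ (Fin d) => (0 : ℂ)) := by
      funext y
      rw [hcon, Real.fourier_eq']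
      simp
    filter_upwards [ae_eq_of_fourier_eq hh.integrable_self hh2 (integrable_zero _ _ _)
      MemLp.zero' hz] with x hx
    have : Complex.exp (-(Real.pi : ℂ) * ‖x‖ ^ 2) ≠ 0 := Complex.exp_ne_zero _
    simpa [hdef] using hx
  set φ : (Fin d → ℂ) → ℂ → ℂ := fun z ζ => fourierLaplace h (ζ • z) with hφdef
  set a : ℂ := -2 * Real.pi * Complex.I with ha
  choose g hg hge using hh.exists_homogeneous_moment
  have hφ : ∀ z, HasCoeffs (φ z) fun k =>
      MvPolynomial.eval z (MvPolynomial.C (a ^ k / k.factorial) * g k) := fun z => by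
    have := hh.hasCoeffs_integral a z
    simp only [map_mul, MvPolynomial.eval_C, hge]
    exact this
  have hgr : ∀ z ζ, ‖φ z ζ‖ ≤ C' * Real.exp ((2 * Real.pi * d ^ 2) * ‖z‖ ^ 2 * ‖ζ‖ ^ 2) :=
    fun z ζ => (hC' _).trans_eq (by rw [norm_smul]; congr 2; ring)
  have hφ1 : ∀ y : EuclideanSpace ℝ (Fin d), φ (fun i => (y i : ℂ)) 1 = 𝓕 h y := fun y => by
    simp only [hφdef, one_smul, fourierLaplace_ofReal]
  have hbound : ∀ y : EuclideanSpace ℝ (Fin d), ∀ u : ℂ, |u.im| ≤ 1 → ∀ r : ℝ,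
      ‖φ (fun i => (y i : ℂ)) r‖ * ‖φ (fun i => (y i : ℂ)) (u * r)‖ ≤
        C * (1 + ‖y‖) ^ K * (1 + |r|) ^ K := fun y u hu r => by
    have e1 : (fun i => ((r • y) i : ℂ)) = (r : ℂ) • fun i => (y i : ℂ) := by
      ext i; simp
    have := hC (r • y) u hu
    rw [e1, smul_smul] at this
    refine this.trans ?_
    rw [mul_assoc, ← mul_pow, norm_smul, Real.norm_eq_abs]
    have h1 := norm_nonneg y
    have h2 := abs_nonneg r
    gcongr
    nlinarith
  obtain ⟨P, q, Δ, hq, hΔ, hP, hpq⟩ := exists_mvPolynomial_mul_exp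
    (g := fun k => MvPolynomial.C (a ^ k / k.factorial) * g k)
    (fun k => by simpa using (MvPolynomial.isHomogeneous_C _ _).mul (hg k))
    (by
      by_contra! hcon
      refine hy₀ ?_
      rw [← hφ1]
      have := hφ (fun i => (y₀ i : ℂ)) 1
      simp only [hcon, map_zero, zero_mul] at this
      exact this.unique hasSum_zero)
    hφ (by positivity) hgr
    (S := Set.range fun (y : EuclideanSpace ℝ (Fin d)) i => (y i : ℂ))
    (fun p hp => MvPolynomial.eq_zero_of_eval_ofReal_eq_zero fun x => hp _ ⟨x, rfl⟩)
    (K := K) (by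
      rintro _ ⟨y, rfl⟩
      refine exists_polynomial_eval_eq_mul_rotate (hφ _).differentiable
        (A := C') (B := 2 * Real.pi * d ^ 2 * ‖fun i => (y i : ℂ)‖ ^ 2) (hgr _)
        (fun u hu r => hbound y u ((Complex.abs_im_le_norm u).trans_eq hu) r))
  -- At real `y` with `Δ(y) ≠ 0` the exponent is real. Multiplying by `Δ` gives a polynomial
  -- identity at every real point, and `Δ ≠ 0` can then be cancelled.
  have hqconj : q = MvPolynomial.map (starRingEnd ℂ) q := by
    rw [← sub_eq_zero]
    refine (mul_eq_zero.1 (MvPolynomial.eq_zero_of_eval_ofReal_eq_zero (p := (q - _) * Δ)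
      fun y => ?_)).resolve_right hΔ
    by_cases hy : MvPolynomial.eval (fun i => (y i : ℂ)) Δ = 0
    · rw [map_mul, hy, mul_zero]
    obtain ⟨p, hp, hpe⟩ := hpq _ hy
    have him := im_eq_zero_of_norm_mul_le hp hpe (hbound y)
    rw [map_mul, map_sub, MvPolynomial.eval_ofReal_map_conj, Complex.conj_eq_iff_im.2 him,
      sub_self, zero_mul]
  obtain ⟨B, hB, hBq⟩ := hq.exists_isSymm_matrix fun x => by
    rw [← Complex.conj_eq_iff_im, ← MvPolynomial.eval_ofReal_map_conj, ← hqconj]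
  refine ⟨P, B, ?_, hB, funext fun y => ?_⟩
  · rintro rfl
    refine hy₀ ?_
    rw [← hφ1, hP, map_zero, zero_mul]
  · rw [← hφ1, hP, hBq, polyGaussian, Complex.ofReal_exp]

/-! ### Quadratic forms, and square-integrability of polynomial Gaussians. -/

namespace Matrix

variable {d : ℕ} {B : Matrix (Fin d) (Fin d) ℝ}

lemma inner_toEuclideanLin_eq_dotProduct (B : Matrix (Fin d) (Fin d) ℝ)
    (x y : EuclideanSpace ℝ (Fin d)) :
    inner ℝ (toEuclideanLin B x) y = y.ofLp ⬝ᵥ (B *ᵥ x.ofLp) := by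
  rw [EuclideanSpace.inner_eq_star_dotProduct, star_trivial, ofLp_toLpLin,
    toLin'_apply]

lemma IsSymm.inner_toEuclideanLin_comm (hB : B.IsSymm) (x y : EuclideanSpace ℝ (Fin d)) :
    inner ℝ (toEuclideanLin B x) y = inner ℝ (toEuclideanLin B y) x := by
  rw [inner_toEuclideanLin_eq_dotProduct, inner_toEuclideanLin_eq_dotProduct,
    dotProduct_mulVec, ← mulVec_transpose, hB.eq, dotProduct_comm]

lemma IsSymm.inner_toEuclideanLin_add (hB : B.IsSymm) (x y : EuclideanSpace ℝ (Fin d)) :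
    inner ℝ (toEuclideanLin B (x + y)) (x + y) = inner ℝ (toEuclideanLin B x) x +
      2 * inner ℝ (toEuclideanLin B y) x + inner ℝ (toEuclideanLin B y) y := by
  rw [map_add, inner_add_left, inner_add_right, inner_add_right,
    hB.inner_toEuclideanLin_comm x y]
  ring

lemma IsSymm.posDef_of_inner_pos (hB : B.IsSymm)
    (h : ∀ x : EuclideanSpace ℝ (Fin d), x ≠ 0 → 0 < inner ℝ (toEuclideanLin B x) x) :
    B.PosDef := by
  refine posDef_iff_dotProduct_mulVec.2 ⟨?_, fun x hx => ?_⟩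
  · rw [IsHermitian, conjTranspose_eq_transpose_of_trivial, hB.eq]
  · have := h (WithLp.toLp 2 x) (by simpa using hx)
    rwa [inner_toEuclideanLin_eq_dotProduct] at this

lemma PosDef.isSymm (hB : B.PosDef) : B.IsSymm := by
  have := hB.isHermitian
  rwa [IsHermitian, conjTranspose_eq_transpose_of_trivial] at this

lemma PosDef.inner_toEuclideanLin_pos (hB : B.PosDef) {x : EuclideanSpace ℝ (Fin d)}
    (hx : x ≠ 0) : 0 < inner ℝ (toEuclideanLin B x) x := by
  rw [inner_toEuclideanLin_eq_dotProduct]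
  exact hB.dotProduct_mulVec_pos (x := x.ofLp) (by simpa using hx)

end Matrix

lemma continuous_toEuclideanLin {d : ℕ} (B : Matrix (Fin d) (Fin d) ℝ) :
    Continuous (Matrix.toEuclideanLin B) :=
  LinearMap.continuous_of_finiteDimensional _

lemma MvPolynomial.continuous_eval_ofReal {d : ℕ} (P : MvPolynomial (Fin d) ℂ) :
    Continuous fun x : EuclideanSpace ℝ (Fin d) => eval (fun i => (x i : ℂ)) P :=
  P.continuous_eval.comp (by fun_prop)

lemma continuous_polyGaussian {d : ℕ} (P : MvPolynomial (Fin d) ℂ)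
    (B : Matrix (Fin d) (Fin d) ℝ) : Continuous (polyGaussian P B) := by
  have h1 := continuous_toEuclideanLin B
  have h2 := P.continuous_eval_ofReal
  unfold polyGaussian
  fun_prop

/-- The mass of `g²` over a unit ball escaping to infinity tends to zero; Fatou's lemma makes this
pointwise. -/
lemma ae_liminf_translate_eq_zero {d : ℕ} {g : EuclideanSpace ℝ (Fin d) → ℂ} (hg : Continuous g)
    (h2 : MemLp g 2) {ω : EuclideanSpace ℝ (Fin d)} (hω : ω ≠ 0) :
    ∀ᵐ y ∂(volume.restrict (Metric.ball (0 : EuclideanSpace ℝ (Fin d)) 1)),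
      Filter.liminf (fun n : ℕ => ‖g (y + (n : ℝ) • ω)‖ₑ ^ 2) Filter.atTop = 0 := by
  have hfin : ∫⁻ x, ‖g x‖ₑ ^ 2 ≠ ∞ := by
    have := h2.2
    rw [eLpNorm_lt_top_iff_lintegral_rpow_enorm_lt_top (by norm_num) (by norm_num)] at this
    simpa using this.ne
  have hm : ∀ n : ℕ, Measurable fun y => ‖g (y + (n : ℝ) • ω)‖ₑ ^ 2 := fun n => by
    have : Continuous fun y => g (y + (n : ℝ) • ω) := by fun_prop
    exact (this.measurable.enorm).pow_const 2
  set U := Metric.ball (0 : EuclideanSpace ℝ (Fin d)) 1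
  have htr : ∀ n : ℕ, ∫⁻ y in U, ‖g (y + (n : ℝ) • ω)‖ₑ ^ 2 =
      ∫⁻ x, (Metric.ball ((n : ℝ) • ω) 1).indicator (fun x => ‖g x‖ₑ ^ 2) x := fun n => by
    rw [← lintegral_indicator Metric.isOpen_ball.measurableSet,
      ← lintegral_add_right_eq_self ((Metric.ball ((n : ℝ) • ω) 1).indicator _) ((n : ℝ) • ω)]
    refine lintegral_congr fun y => ?_
    simp only [Set.indicator, Metric.mem_ball, dist_eq_norm, sub_zero, add_sub_cancel_right]
  have hlim : Filter.Tendsto (fun n : ℕ => ∫⁻ y in U, ‖g (y + (n : ℝ) • ω)‖ₑ ^ 2) Filter.atTop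
      (nhds 0) := by
    simp only [htr]
    have := tendsto_lintegral_of_dominated_convergence (μ := volume)
      (F := fun (n : ℕ) x => (Metric.ball ((n : ℝ) • ω) 1).indicator (fun x => ‖g x‖ₑ ^ 2) x)
      (f := fun _ => 0) (fun x => ‖g x‖ₑ ^ 2)
      (fun n => Measurable.indicator (by fun_prop) Metric.isOpen_ball.measurableSet)
      (fun n => Filter.Eventually.of_forall fun x => Set.indicator_le_self _ _ x) hfin
      (Filter.Eventually.of_forall fun x => ?_)
    · simpa using this
    · refine tendsto_const_nhds.congr' ?_
      have hωp := norm_pos_iff.2 hω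
      filter_upwards [Filter.eventually_ge_atTop ⌈(1 + ‖x‖) / ‖ω‖⌉₊] with n hn
      refine (Set.indicator_of_notMem (fun hx => ?_) _).symm
      rw [Metric.mem_ball, dist_eq_norm] at hx
      have h1 := Nat.ceil_le.1 hn
      rw [div_le_iff₀ hωp] at h1
      have h3 : ‖(n : ℝ) • ω‖ = n * ‖ω‖ := by rw [norm_smul, Real.norm_natCast]
      have h4 := norm_sub_norm_le ((n : ℝ) • ω) x
      rw [norm_sub_rev] at h4
      linarith
  have h0 : ∫⁻ y in U, Filter.liminf (fun n : ℕ => ‖g (y + (n : ℝ) • ω)‖ₑ ^ 2) Filter.atTop = 0 :=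
    le_antisymm ((lintegral_liminf_le hm).trans_eq hlim.liminf_eq) zero_le
  exact (lintegral_eq_zero_iff (Measurable.liminf hm)).1 h0

lemma MvPolynomial.exists_eval_line_eq {d : ℕ} (P : MvPolynomial (Fin d) ℂ) (y ω : Fin d → ℂ) :
    ∃ Q : Polynomial ℂ, ∀ t, Q.eval t = eval (y + t • ω) P := by
  refine ⟨aeval (fun i => Polynomial.C (y i) + Polynomial.X * Polynomial.C (ω i)) P, fun t => ?_⟩
  have : (Polynomial.evalRingHom t).comp (aeval fun i =>
      Polynomial.C (y i) + Polynomial.X * Polynomial.C (ω i)).toRingHom =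
      eval (y + t • ω) := by
    ext i <;> simp; ring
  exact DFunLike.congr_fun this P

/-- The two sign conditions keep the exponential factor along `y + nω` at least as large as at `y`.
A polynomial nonzero on this line stays bounded away from zero for large `n`, so only the zero
restriction is compatible with the vanishing liminf. -/
lemma polyGaussian_eval_eq_zero_of_liminf {d : ℕ} {P : MvPolynomial (Fin d) ℂ}
    {B : Matrix (Fin d) (Fin d) ℝ} (hB : B.IsSymm) {y ω : EuclideanSpace ℝ (Fin d)}
    (hω : inner ℝ (Matrix.toEuclideanLin B ω) ω ≤ 0)
    (hy : inner ℝ (Matrix.toEuclideanLin B ω) y ≤ 0)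
    (h : Filter.liminf (fun n : ℕ => ‖polyGaussian P B (y + (n : ℝ) • ω)‖ₑ ^ 2) Filter.atTop = 0) :
    MvPolynomial.eval (fun i => (y i : ℂ)) P = 0 := by
  obtain ⟨Q, hQ⟩ := P.exists_eval_line_eq (fun i => (y i : ℂ)) (fun i => (ω i : ℂ))
  by_cases hQ0 : Q = 0
  · have := hQ 0
    rw [hQ0, Polynomial.eval_zero, zero_smul, add_zero] at this
    exact this.symm
  obtain ⟨c, hc, R, hR⟩ := exists_pos_le_norm_eval hQ0
  set e := Real.exp (-Real.pi * inner ℝ (Matrix.toEuclideanLin B y) y)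
  have he : 0 < e := Real.exp_pos _
  have hev : ∀ᶠ n : ℕ in Filter.atTop, ENNReal.ofReal (c * e) ^ 2 ≤
      ‖polyGaussian P B (y + (n : ℝ) • ω)‖ₑ ^ 2 := by
    filter_upwards [Filter.eventually_ge_atTop ⌈R⌉₊] with n hn
    gcongr
    rw [← ofReal_norm]
    refine ENNReal.ofReal_le_ofReal ?_
    have h1 := hR n (Nat.ceil_le.1 hn)
    rw [polyGaussian, norm_mul, Complex.norm_real, Real.norm_of_nonneg (Real.exp_pos _).le]
    have h2 : (fun i => ((y + (n : ℝ) • ω) i : ℂ)) =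
        (fun i => (y i : ℂ)) + ((n : ℝ) : ℂ) • fun i => (ω i : ℂ) := by
      ext i; simp
    rw [h2, ← hQ]
    gcongr
    rw [hB.inner_toEuclideanLin_add, map_smul, inner_smul_left, inner_smul_left,
      inner_smul_right]
    simp only [conj_trivial]
    have h3 : (n : ℝ) * inner ℝ (Matrix.toEuclideanLin B ω) y ≤ 0 :=
      mul_nonpos_of_nonneg_of_nonpos (by positivity) hy
    have h4 : (n : ℝ) * (n * inner ℝ (Matrix.toEuclideanLin B ω) ω) ≤ 0 :=
      mul_nonpos_of_nonneg_of_nonpos (by positivity)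
        (mul_nonpos_of_nonneg_of_nonpos (by positivity) hω)
    refine Real.exp_le_exp.2 ?_
    nlinarith [Real.pi_pos]
  have h5 := Filter.le_liminf_of_le (by isBoundedDefault) hev
  rw [h] at h5
  exfalso
  have : ENNReal.ofReal (c * e) ^ 2 ≠ 0 := by
    have : 0 < c * e := by positivity
    simpa using this
  exact this (le_antisymm h5 zero_le)

/-- If the form were nonpositive at some `ω ≠ 0`, then for each `y` one of `ω` and `-ω` would have
the sign needed for translation, and `P` would vanish almost everywhere on a ball. -/
lemma posDef_of_memLp_polyGaussian {d : ℕ} {P : MvPolynomial (Fin d) ℂ} (hP : P ≠ 0)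
    {B : Matrix (Fin d) (Fin d) ℝ} (hB : B.IsSymm) (h2 : MemLp (polyGaussian P B) 2) :
    B.PosDef := by
  refine hB.posDef_of_inner_pos fun ω hω => ?_
  by_contra! hle
  refine hP (MvPolynomial.eq_zero_of_ae_eval_ofReal_eq_zero
    (Metric.isOpen_ball (x := (0 : EuclideanSpace ℝ (Fin d))) (ε := 1)) (by simp) ?_)
  filter_upwards [ae_liminf_translate_eq_zero (continuous_polyGaussian P B) h2 hω,
    ae_liminf_translate_eq_zero (continuous_polyGaussian P B) h2 (neg_ne_zero.2 hω)] with y h1 h3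
  rcases le_total (inner ℝ (Matrix.toEuclideanLin B ω) y) 0 with h | h
  · exact polyGaussian_eval_eq_zero_of_liminf hB hle h h1
  · exact polyGaussian_eval_eq_zero_of_liminf hB (by simpa using hle) (by simpa using h) h3

lemma Matrix.PosDef.exists_mul_sq_norm_le {d : ℕ} {A : Matrix (Fin d) (Fin d) ℝ}
    (hA : A.PosDef) : ∃ c : ℝ, 0 < c ∧ ∀ x : EuclideanSpace ℝ (Fin d),
      c * ‖x‖ ^ 2 ≤ inner ℝ (Matrix.toEuclideanLin A x) x := by
  have hcont : Continuous fun x : EuclideanSpace ℝ (Fin d) =>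
      inner ℝ (Matrix.toEuclideanLin A x) x := by
    have := continuous_toEuclideanLin A
    fun_prop
  -- The empty sphere is the case `d = 0`; otherwise `c` is the minimum of the form on the unit
  -- sphere.
  rcases (Metric.sphere (0 : EuclideanSpace ℝ (Fin d)) 1).eq_empty_or_nonempty with h | h
  · refine ⟨1, one_pos, fun x => ?_⟩
    rcases eq_or_ne x 0 with rfl | hx
    · simp
    · have : ‖x‖⁻¹ • x ∈ Metric.sphere (0 : EuclideanSpace ℝ (Fin d)) 1 := by
        simp [norm_smul, hx]
      rw [h] at this
      exact this.elim
  · obtain ⟨v, hv, hmin⟩ := (isCompact_sphere _ _).exists_isMinOn h hcont.continuousOn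
    have hv0 : v ≠ 0 := by
      rintro rfl
      simp at hv
    refine ⟨_, hA.inner_toEuclideanLin_pos hv0, fun x => ?_⟩
    rcases eq_or_ne x 0 with rfl | hx
    · simp
    have hx0 : ‖x‖ ≠ 0 := norm_ne_zero_iff.2 hx
    have h1 : ‖x‖⁻¹ • x ∈ Metric.sphere (0 : EuclideanSpace ℝ (Fin d)) 1 := by
      simp [norm_smul, hx]
    have h2 := hmin h1
    simp only [Set.mem_ofPred_eq, map_smul, inner_smul_left, inner_smul_right, conj_trivial] at h2
    calc _ ≤ (‖x‖⁻¹ * (‖x‖⁻¹ * inner ℝ (Matrix.toEuclideanLin A x) x)) * ‖x‖ ^ 2 := by gcongr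
      _ = _ := by field_simp

lemma exists_norm_polyGaussian_le {d : ℕ} (P : MvPolynomial (Fin d) ℂ)
    {A : Matrix (Fin d) (Fin d) ℝ} (hA : A.PosDef) :
    ∃ C b : ℝ, 0 ≤ C ∧ 0 < b ∧ ∀ x, ‖polyGaussian P A x‖ ≤ C * Real.exp (-b * ‖x‖ ^ 2 + ‖x‖) := by
  obtain ⟨c, hc, hcA⟩ := hA.exists_mul_sq_norm_le
  obtain ⟨C, hC0, hC⟩ := P.exists_norm_eval_le
  refine ⟨C * (P.totalDegree.factorial * Real.exp 1), Real.pi * c, by positivity, by positivity,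
    fun x => ?_⟩
  rw [polyGaussian, norm_mul, Complex.norm_real, Real.norm_of_nonneg (Real.exp_pos _).le,
    Real.exp_add]
  have h1 : ‖MvPolynomial.eval (fun i => (x i : ℂ)) P‖ ≤
      C * (P.totalDegree.factorial * Real.exp 1 * Real.exp ‖x‖) := by
    refine (hC _).trans ?_
    gcongr
    refine le_trans ?_ (one_add_pow_le_exp _ (norm_nonneg x))
    gcongr
    exact norm_ofReal_le x
  have h2 : Real.exp (-Real.pi * inner ℝ (Matrix.toEuclideanLin A x) x) ≤
      Real.exp (-(Real.pi * c) * ‖x‖ ^ 2) := by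
    refine Real.exp_le_exp.2 ?_
    nlinarith [mul_le_mul_of_nonneg_left (hcA x) Real.pi_pos.le]
  calc _ ≤ C * (P.totalDegree.factorial * Real.exp 1 * Real.exp ‖x‖) *
        Real.exp (-(Real.pi * c) * ‖x‖ ^ 2) := by gcongr
    _ = _ := by ring

lemma hasExpMoments_polyGaussian {d : ℕ} (P : MvPolynomial (Fin d) ℂ)
    {A : Matrix (Fin d) (Fin d) ℝ} (hA : A.PosDef) : HasExpMoments (polyGaussian P A) where
  aestronglyMeasurable := (continuous_polyGaussian P A).aestronglyMeasurable
  integrable c := by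
    obtain ⟨C, b, hC, hb, h⟩ := exists_norm_polyGaussian_le P hA
    refine ((integrable_exp_neg_sq_add hb (c + 1)).const_mul C).mono'
      (Continuous.aestronglyMeasurable
        (by have := continuous_polyGaussian P A; fun_prop))
      (Filter.Eventually.of_forall fun x => ?_)
    rw [norm_mul, norm_norm, Real.norm_of_nonneg (Real.exp_pos _).le]
    calc _ ≤ C * Real.exp (-b * ‖x‖ ^ 2 + ‖x‖) * Real.exp (c * ‖x‖) := by gcongr; exact h x
      _ = _ := by rw [mul_assoc, ← Real.exp_add]; congr 2; ring

lemma memLp_polyGaussian {d : ℕ} (P : MvPolynomial (Fin d) ℂ)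
    {A : Matrix (Fin d) (Fin d) ℝ} (hA : A.PosDef) : MemLp (polyGaussian P A) 2 := by
  rw [memLp_two_iff_integrable_sq_norm (continuous_polyGaussian P A).aestronglyMeasurable]
  obtain ⟨C, b, hC, hb, h⟩ := exists_norm_polyGaussian_le P hA
  refine ((integrable_exp_neg_sq_add (b := 2 * b) (by positivity) 2).const_mul (C ^ 2)).mono'
    (Continuous.aestronglyMeasurable (by have := continuous_polyGaussian P A; fun_prop))
    (Filter.Eventually.of_forall fun x => ?_)
  rw [Real.norm_of_nonneg (by positivity)]
  calc _ ≤ (C * Real.exp (-b * ‖x‖ ^ 2 + ‖x‖)) ^ 2 := by gcongr; exact h x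
    _ = _ := by rw [mul_pow, ← Real.exp_nat_mul]; congr 2; push_cast; ring

/-! ### Fourier transforms of polynomial Gaussians, and the form of `f`. -/

lemma eq_of_eq_on_real {F H : ℂ → ℂ} (hF : Differentiable ℂ F) (hH : Differentiable ℂ H)
    (h : ∀ r : ℝ, F r = H r) : F = H := by
  refine AnalyticOnNhd.eq_of_frequently_eq (z₀ := 0)
    (fun z _ => hF.analyticAt z) (fun z _ => hH.analyticAt z) ?_
  have ht : Filter.Tendsto (fun r : ℝ => (r : ℂ)) (nhdsWithin 0 {0}ᶜ) (nhdsWithin 0 {0}ᶜ) :=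
    tendsto_nhdsWithin_of_tendsto_nhds_of_eventually_within _
      ((Complex.continuous_ofReal.tendsto' 0 0 rfl).mono_left nhdsWithin_le_nhds)
      (by filter_upwards [self_mem_nhdsWithin] with r hr; simpa using hr)
  exact ht.frequently (Filter.Eventually.frequently (Filter.Eventually.of_forall h))

lemma MvPolynomial.totalDegree_aeval_le {σ τ R : Type*} [CommSemiring R] [Algebra ℂ R]
    (p : MvPolynomial σ ℂ) {f : σ → MvPolynomial τ R} (hf : ∀ i, (f i).totalDegree ≤ 1) :
    (aeval f p).totalDegree ≤ p.totalDegree := by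
  rw [aeval_def, eval₂_eq]
  refine totalDegree_finsetSum_le fun m hm => ?_
  refine (totalDegree_mul _ _).trans ?_
  rw [algebraMap_apply, totalDegree_C, zero_add]
  refine (totalDegree_finsetProd _ _).trans ?_
  refine le_trans (Finset.sum_le_sum fun i _ => ?_) (le_totalDegree hm)
  exact (totalDegree_pow _ _).trans (by nlinarith [hf i])

lemma Matrix.PosDef.toEuclideanLin_inv {d : ℕ} {A : Matrix (Fin d) (Fin d) ℝ} (hA : A.PosDef)
    (w : EuclideanSpace ℝ (Fin d)) :
    Matrix.toEuclideanLin A (Matrix.toEuclideanLin A⁻¹ w) = w := by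
  ext i
  rw [ofLp_toLpLin, ofLp_toLpLin, toLin'_apply, toLin'_apply, mulVec_mulVec,
    mul_nonsing_inv _ ((isUnit_iff_isUnit_det _).1 hA.isUnit), one_mulVec]

/-- With real exponentials in place of characters, a real translation completes the square. Both
sides are entire in the exponential parameter, so the identity extends from real values to `-i`. -/
lemma exists_fourier_polyGaussian_eq {d : ℕ} (P : MvPolynomial (Fin d) ℂ)
    {A : Matrix (Fin d) (Fin d) ℝ} (hA : A.PosDef) :
    ∃ S : MvPolynomial (Fin d) ℂ, S.totalDegree ≤ P.totalDegree ∧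
      𝓕 (polyGaussian P A) = polyGaussian S A⁻¹ := by
  -- The substitution `x - i A⁻¹ z`, of degree one in `z`; integrating `P(x - i A⁻¹ z)` against the
  -- pure Gaussian yields `S(z)` without raising the degree.
  set f : Fin d → MvPolynomial (Fin d) (MvPolynomial (Fin d) ℂ) := fun i =>
    MvPolynomial.C (MvPolynomial.X i) + ∑ j,
      MvPolynomial.C (MvPolynomial.C (-Complex.I * A⁻¹ i j)) * MvPolynomial.X j with hf
  have hf1 : ∀ i, (f i).totalDegree ≤ 1 := fun i => by
    refine (MvPolynomial.totalDegree_add _ _).trans (max_le (by simp) ?_)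
    refine MvPolynomial.totalDegree_finsetSum_le fun j _ => ?_
    refine (MvPolynomial.totalDegree_mul _ _).trans ?_
    rw [MvPolynomial.totalDegree_C, zero_add]
    exact (MvPolynomial.isHomogeneous_X _ _).totalDegree_le
  set q := MvPolynomial.aeval f P with hq
  have hqe : ∀ x z : Fin d → ℂ, MvPolynomial.eval₂ (MvPolynomial.eval x) z q =
      MvPolynomial.eval (fun i => x i + ∑ j, (-Complex.I * A⁻¹ i j) * z j) P := fun x z => by
    have : (MvPolynomial.eval₂Hom (MvPolynomial.eval x) z).comp (MvPolynomial.aeval f).toRingHom =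
        MvPolynomial.eval (fun i => x i + ∑ j, (-Complex.I * A⁻¹ i j) * z j) := by
      ext i
      · simp [MvPolynomial.algebraMap_apply]
      · simp [hf]
    exact DFunLike.congr_fun this P
  obtain ⟨S, hS, hSe⟩ := MvPolynomial.exists_eval_eq_integral
    (hasExpMoments_polyGaussian 1 hA).integrable_mul_eval q
  refine ⟨S, ?_, funext fun y => ?_⟩
  · refine le_trans ?_ (P.totalDegree_aeval_le hf1)
    exact Finset.sup_mono hS
  set Q : ℝ := inner ℝ (Matrix.toEuclideanLin A⁻¹ y) y with hQ
  set F : ℂ → ℂ := fun ζ => ∫ x, polyGaussian P A x *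
    Complex.exp (2 * Real.pi * complexPairing x (ζ • fun i => (y i : ℂ)))
  set H : ℂ → ℂ := fun ζ => MvPolynomial.eval ((Complex.I * ζ) • fun i => (y i : ℂ)) S *
    Complex.exp (Real.pi * Q * ζ ^ 2)
  have hF : Differentiable ℂ F :=
    ((hasExpMoments_polyGaussian P hA).hasCoeffs_integral (2 * Real.pi) _).differentiable
  have hH : Differentiable ℂ H := by
    obtain ⟨q', hq'⟩ := S.exists_eval_line_eq 0 (Complex.I • fun i => (y i : ℂ))
    have : H = fun ζ => q'.eval ζ * Complex.exp (Real.pi * Q * ζ ^ 2) := by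
      funext ζ
      simp only [H, hq', zero_add, smul_smul, mul_comm]
    rw [this]
    exact q'.differentiable.mul (by fun_prop)
  have hreal : ∀ r : ℝ, F r = H r := fun r => by
    -- The centre of the Gaussian once the square is completed; at `z = i r y` the substitution
    -- above becomes `x + a`.
    set a : EuclideanSpace ℝ (Fin d) := Matrix.toEuclideanLin A⁻¹ (r • y) with ha
    have haA : Matrix.toEuclideanLin A a = r • y := hA.toEuclideanLin_inv _
    simp only [F, H]
    rw [hSe, ← integral_mul_const, ← integral_add_right_eq_self _ a]
    refine integral_congr_ae (Filter.Eventually.of_forall fun x => ?_)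
    simp only [hqe]
    have e1 : (fun i => (x i : ℂ) + ∑ j, (-Complex.I * A⁻¹ i j) *
        ((Complex.I * (r : ℂ)) • fun i => (y i : ℂ)) j) = fun i => ((x + a) i : ℂ) := by
      funext i
      have : a i = ∑ j, A⁻¹ i j * (r * y j) := by
        rw [ha, Matrix.ofLp_toLpLin, Matrix.toLin'_apply]
        simp [Matrix.mulVec, dotProduct]
      rw [PiLp.add_apply, this]
      push_cast
      congr 1
      refine Finset.sum_congr rfl fun j _ => ?_
      simp only [Pi.smul_apply, smul_eq_mul]
      linear_combination (-(A⁻¹ i j : ℂ) * r * y j) * Complex.I_mul_I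
    have e2 : ((r : ℂ) • fun i => (y i : ℂ)) = fun i => ((r • y) i : ℂ) := by
      funext i; simp
    rw [e1, e2, complexPairing_ofReal, polyGaussian, polyGaussian, map_one, one_mul]
    have e3 : r ^ 2 * Q = inner ℝ a (r • y) := by
      rw [ha, hQ, map_smul, inner_smul_left, inner_smul_right]
      simp only [conj_trivial]; ring
    have e4 := hA.isSymm.inner_toEuclideanLin_add x a
    rw [haA] at e4
    have e5 : inner ℝ (r • y) x = inner ℝ x (r • y) := real_inner_comm _ _
    have e6 : inner ℝ (r • y) a = inner ℝ a (r • y) := real_inner_comm _ _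
    have e7 : ((Real.pi : ℂ) * Q * (r : ℂ) ^ 2) = ((Real.pi * (r ^ 2 * Q) : ℝ) : ℂ) := by
      push_cast; ring
    have e8 : (2 * (Real.pi : ℂ) * (inner ℝ (x + a) (r • y) : ℝ)) =
        ((2 * Real.pi * inner ℝ (x + a) (r • y) : ℝ) : ℂ) := by push_cast; ring
    have e9 : Real.exp (-Real.pi * inner ℝ (Matrix.toEuclideanLin A (x + a)) (x + a)) *
        Real.exp (2 * Real.pi * inner ℝ (x + a) (r • y)) =
        Real.exp (-Real.pi * inner ℝ (Matrix.toEuclideanLin A x) x) *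
          Real.exp (Real.pi * (r ^ 2 * Q)) := by
      rw [← Real.exp_add, ← Real.exp_add, e3, e4, inner_add_left, e5, e6]
      congr 1
      ring
    have e10 := congrArg (fun s : ℝ => (s : ℂ)) e9
    simp only [Complex.ofReal_mul (Real.exp _)] at e10
    rw [e7, e8, ← Complex.ofReal_exp, ← Complex.ofReal_exp]
    linear_combination (MvPolynomial.eval (fun i => ((x + a) i : ℂ)) P) * e10
  have hFH := congrFun (eq_of_eq_on_real hF hH hreal) (-Complex.I)
  have h1 : F (-Complex.I) = 𝓕 (polyGaussian P A) y := by
    rw [← fourierLaplace_ofReal, fourierLaplace]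
    refine integral_congr_ae (Filter.Eventually.of_forall fun x => ?_)
    simp only [complexPairing_smul]
    congr 2
    ring
  rw [← h1, hFH]
  simp only [H, polyGaussian]
  have e9 : (Complex.I * -Complex.I) = 1 := by simp
  have e10 : (-Complex.I) ^ 2 = -1 := by simp
  rw [e9, one_smul, e10, Complex.ofReal_exp]
  congr 2
  push_cast
  ring

/-- The reflection `P(-x)` of a polynomial. -/
noncomputable def MvPolynomial.reflect {d : ℕ} (P : MvPolynomial (Fin d) ℂ) :
    MvPolynomial (Fin d) ℂ :=
  aeval (fun i => C (-1) * X i) P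

lemma MvPolynomial.eval_reflect {d : ℕ} (P : MvPolynomial (Fin d) ℂ)
    (x : EuclideanSpace ℝ (Fin d)) :
    eval (fun i => (x i : ℂ)) P.reflect = eval (fun i => ((-x) i : ℂ)) P := by
  have : (eval fun i => (x i : ℂ)).comp (aeval fun i => C (-1 : ℂ) * X i).toRingHom =
      eval fun i => ((-x) i : ℂ) := by
    ext i <;> simp
  exact DFunLike.congr_fun this P

lemma MvPolynomial.totalDegree_reflect_le {d : ℕ} (P : MvPolynomial (Fin d) ℂ) :
    P.reflect.totalDegree ≤ P.totalDegree :=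
  P.totalDegree_aeval_le fun i => by
    refine (totalDegree_mul _ _).trans ?_
    rw [totalDegree_C, zero_add]
    exact (isHomogeneous_X _ _).totalDegree_le

lemma polyGaussian_reflect {d : ℕ} (P : MvPolynomial (Fin d) ℂ) (A : Matrix (Fin d) (Fin d) ℝ)
    (x : EuclideanSpace ℝ (Fin d)) : polyGaussian P.reflect A x = polyGaussian P A (-x) := by
  rw [polyGaussian, polyGaussian, MvPolynomial.eval_reflect, map_neg, inner_neg_neg]

lemma integrable_polyGaussian {d : ℕ} (P : MvPolynomial (Fin d) ℂ)
    {A : Matrix (Fin d) (Fin d) ℝ} (hA : A.PosDef) : Integrable (polyGaussian P A) :=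
  (hasExpMoments_polyGaussian P hA).integrable_self

lemma eq_of_polyGaussian_eq {d : ℕ} {P Q : MvPolynomial (Fin d) ℂ}
    {A : Matrix (Fin d) (Fin d) ℝ} (h : polyGaussian P A = polyGaussian Q A) : P = Q := by
  rw [← sub_eq_zero]
  refine MvPolynomial.eq_zero_of_eval_ofReal_eq_zero fun x => ?_
  have := congrFun h x
  rw [polyGaussian, polyGaussian] at this
  rw [map_sub, sub_eq_zero]
  exact mul_right_cancel₀ (by exact_mod_cast (Real.exp_pos _).ne') this

/-- The class of polynomials times Gaussians is stable under the Fourier transform. -/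
lemma exists_fourier_polyGaussian {d : ℕ} (P : MvPolynomial (Fin d) ℂ)
    {A : Matrix (Fin d) (Fin d) ℝ} (hA : A.PosDef) :
    ∃ S : MvPolynomial (Fin d) ℂ, S.totalDegree = P.totalDegree ∧
      𝓕 (polyGaussian P A) = polyGaussian S A⁻¹ ∧
      polyGaussian P A = 𝓕 (polyGaussian S.reflect A⁻¹) := by
  obtain ⟨S, hS, hSe⟩ := exists_fourier_polyGaussian_eq P hA
  obtain ⟨T, hT, hTe⟩ := exists_fourier_polyGaussian_eq S hA.inv
  rw [Matrix.nonsing_inv_nonsing_inv _ ((Matrix.isUnit_iff_isUnit_det _).1 hA.isUnit)] at hTe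
  have hi : Integrable (𝓕 (polyGaussian P A)) := by
    rw [hSe]; exact integrable_polyGaussian S hA.inv
  have h1 := (continuous_polyGaussian P A).fourierInv_fourier_eq (integrable_polyGaussian P hA) hi
  have h2 := (continuous_polyGaussian P A).fourier_fourierInv_eq (integrable_polyGaussian P hA) hi
  have h3 : 𝓕⁻ (polyGaussian P A) = polyGaussian S.reflect A⁻¹ := by
    funext x
    rw [Real.fourierInv_eq_fourier_neg, hSe, polyGaussian_reflect]
  have h4 : polyGaussian T.reflect A = polyGaussian P A := by
    rw [← h1]
    funext x
    rw [Real.fourierInv_eq_fourier_neg, hSe, hTe, polyGaussian_reflect]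
  -- Two transforms amount to a reflection, so `P` is recovered from `S` without raising the degree
  -- and the inequality of degrees is an equality.
  refine ⟨S, le_antisymm hS ?_, hSe, by rw [← h3, h2]⟩
  rw [← eq_of_polyGaussian_eq h4]
  exact T.totalDegree_reflect_le.trans hT

/-- Used to remove the auxiliary Gaussian: dividing by `e^{-π‖x‖²}` subtracts the identity from the
matrix. -/
lemma polyGaussian_mul_gaussian {d : ℕ} (P : MvPolynomial (Fin d) ℂ)
    (A : Matrix (Fin d) (Fin d) ℝ) (x : EuclideanSpace ℝ (Fin d)) :
    polyGaussian P (A - 1) x * (Real.exp (-Real.pi * ‖x‖ ^ 2) : ℂ) = polyGaussian P A x := by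
  rw [polyGaussian, polyGaussian, mul_assoc, ← Complex.ofReal_mul, ← Real.exp_add]
  have h1 : Matrix.toEuclideanLin (A - 1) x = Matrix.toEuclideanLin A x - x := by
    ext i
    rw [PiLp.sub_apply, Matrix.ofLp_toLpLin, Matrix.ofLp_toLpLin, Matrix.toLin'_apply,
      Matrix.toLin'_apply, Matrix.sub_mulVec, Matrix.one_mulVec]
    rfl
  rw [h1, inner_sub_left, real_inner_self_eq_norm_sq]
  congr 3
  ring

lemma exists_ae_eq_polyGaussian {d : ℕ} {N : ℝ}
    {f : Lp ℂ 2 (volume : Measure (EuclideanSpace ℝ (Fin d)))} (hf : f ≠ 0)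
    (hI : (∫⁻ p : EuclideanSpace ℝ (Fin d) × EuclideanSpace ℝ (Fin d),
          ENNReal.ofReal (beurlingIntegrand N (⇑f)
            (⇑(𝓕 f : Lp ℂ 2 (volume : Measure (EuclideanSpace ℝ (Fin d))))) p.1 p.2)
          ∂((volume : Measure (EuclideanSpace ℝ (Fin d))).prod volume)) < ∞) :
    ∃ (A : Matrix (Fin d) (Fin d) ℝ) (P : MvPolynomial (Fin d) ℂ), A.PosDef ∧ P ≠ 0 ∧
      ⇑f =ᵐ[volume] polyGaussian P A := by
  have hf2 : MemLp (⇑f) 2 := Lp.memLp f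
  have hh1 := (hf2.hasExpMoments Real.pi_pos).integrable_self
  have hh2 := hf2.mul_gaussian
  obtain ⟨Q, B, hQ, hB, hQB⟩ := exists_polyGaussian_eq_fourier hf hI
  have hBpos : B.PosDef := by
    refine posDef_of_memLp_polyGaussian hQ hB ?_
    rw [← hQB]
    exact (memLp_congr_ae (fourier_toLp_ae_eq hh1 hh2)).1 (Lp.memLp _)
  obtain ⟨S, -, -, hS⟩ := exists_fourier_polyGaussian Q hBpos
  have hfS : ⇑f =ᵐ[volume] polyGaussian S.reflect (B⁻¹ - 1) := by
    filter_upwards [ae_eq_of_fourier_eq hh1 hh2 (integrable_polyGaussian _ hBpos.inv)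
      (memLp_polyGaussian _ hBpos.inv) (hQB.trans hS)] with x hx
    rw [← polyGaussian_mul_gaussian] at hx
    exact mul_right_cancel₀ (by exact_mod_cast (Real.exp_pos _).ne') hx
  have hS0 : S.reflect ≠ 0 := by
    intro h0
    refine hf (Lp.eq_zero_iff_ae_eq_zero.2 (hfS.trans (Filter.Eventually.of_forall fun x => ?_)))
    rw [h0, polyGaussian, map_zero, zero_mul]; rfl
  refine ⟨B⁻¹ - 1, S.reflect, ?_, hS0, hfS⟩
  -- Inversion gives only `B⁻¹` positive definite; that `B⁻¹ - 1` is so follows from `f` itself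
  -- being in `L²`.
  refine posDef_of_memLp_polyGaussian hS0 ?_ ((memLp_congr_ae hfS).1 hf2)
  rw [Matrix.IsSymm, Matrix.transpose_sub, hBpos.inv.isSymm.eq, Matrix.transpose_one]

/-! ### Necessity of the degree condition. -/

lemma lintegral_dilate {d : ℕ} {κ : EuclideanSpace ℝ (Fin d) → ℝ≥0∞} (hκ : Measurable κ)
    {r : ℝ} (hr : 0 < r) :
    ∫⁻ x, ENNReal.ofReal (r ^ d) * κ (r • x) = ∫⁻ x, κ x := by
  have hm : Measurable fun x : EuclideanSpace ℝ (Fin d) => r • x := by fun_prop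
  have hκr : Measurable fun x => κ (r • x) := hκ.comp hm
  rw [lintegral_const_mul _ hκr, ← lintegral_map hκ hm,
    Measure.map_addHaar_smul _ hr.ne', lintegral_smul_measure, finrank_euclideanSpace_fin,
    smul_eq_mul, ← mul_assoc, ← ENNReal.ofReal_mul (by positivity), abs_of_pos (by positivity),
    mul_inv_cancel₀ (by positivity), ENNReal.ofReal_one, one_mul]

/-- The factor `n^d` is the Jacobian of the dilation, so after truncation near the origin the
integrals are tails of a convergent integral, and Fatou's lemma applies. The condition `1 ≤ d` makes
`{0}` negligible. -/
lemma ae_liminf_dilate_eq_zero {d : ℕ} (hd : 1 ≤ d)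
    {Φ : EuclideanSpace ℝ (Fin d) × EuclideanSpace ℝ (Fin d) → ℝ≥0∞} (hΦ : Measurable Φ)
    (hfin : ∫⁻ p, Φ p ∂((volume : Measure (EuclideanSpace ℝ (Fin d))).prod volume) ≠ ∞) :
    ∀ᵐ p ∂((volume : Measure (EuclideanSpace ℝ (Fin d))).prod volume),
      Filter.liminf (fun n : ℕ => ENNReal.ofReal ((n : ℝ) ^ d) * Φ ((n : ℝ) • p.1, p.2))
        Filter.atTop = 0 := by
  have : Nonempty (Fin d) := ⟨⟨0, hd⟩⟩
  -- The threshold grows to infinity, so the tails vanish, but more slowly than `‖nξ‖² = n² ‖ξ‖²`;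
  -- the truncation is eventually invisible at each `ξ ≠ 0`.
  set T : ℕ → Set (EuclideanSpace ℝ (Fin d) × EuclideanSpace ℝ (Fin d)) :=
    fun n => {p | (n : ℝ) < ‖p.1‖ ^ 2} with hT
  have hTm : ∀ n, MeasurableSet (T n) := fun n =>
    measurableSet_lt measurable_const (by fun_prop)
  set F : ℕ → EuclideanSpace ℝ (Fin d) × EuclideanSpace ℝ (Fin d) → ℝ≥0∞ := fun n p =>
    ENNReal.ofReal ((n : ℝ) ^ d) * (T n).indicator Φ ((n : ℝ) • p.1, p.2) with hF
  have hFm : ∀ n, Measurable (F n) := fun n =>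
    ((hΦ.indicator (hTm n)).comp (by fun_prop)).const_mul _
  have hlim1 : Filter.Tendsto (fun n => ∫⁻ p, (T n).indicator Φ p
      ∂((volume : Measure (EuclideanSpace ℝ (Fin d))).prod volume)) Filter.atTop (nhds 0) := by
    have := tendsto_lintegral_of_dominated_convergence
      (μ := (volume : Measure (EuclideanSpace ℝ (Fin d))).prod volume)
      (F := fun n => (T n).indicator Φ) (f := fun _ => 0) Φ
      (fun n => hΦ.indicator (hTm n))
      (fun n => Filter.Eventually.of_forall fun p => Set.indicator_le_self _ _ p) hfin
      (Filter.Eventually.of_forall fun p => ?_)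
    · simpa using this
    · refine tendsto_const_nhds.congr' ?_
      filter_upwards [Filter.eventually_ge_atTop ⌈‖p.1‖ ^ 2⌉₊] with n hn
      have hp : p ∉ T n := fun hp => (Nat.ceil_le.1 hn).not_gt hp
      exact (Set.indicator_of_notMem hp Φ).symm
  have hlim : Filter.Tendsto (fun n => ∫⁻ p, F n p
      ∂((volume : Measure (EuclideanSpace ℝ (Fin d))).prod volume)) Filter.atTop (nhds 0) := by
    refine hlim1.congr' ?_
    filter_upwards [Filter.eventually_ge_atTop 1] with n hn
    rw [lintegral_prod_symm' _ (hΦ.indicator (hTm n)), lintegral_prod_symm' _ (hFm n)]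
    refine lintegral_congr fun v => ?_
    exact (lintegral_dilate (κ := fun x => (T n).indicator Φ (x, v))
      ((hΦ.indicator (hTm n)).comp (by fun_prop)) (by exact_mod_cast hn)).symm
  have h0 : ∫⁻ p, Filter.liminf (fun n => F n p) Filter.atTop
      ∂((volume : Measure (EuclideanSpace ℝ (Fin d))).prod volume) = 0 :=
    le_antisymm ((lintegral_liminf_le hFm).trans_eq hlim.liminf_eq) zero_le
  have hne : ∀ᵐ p ∂((volume : Measure (EuclideanSpace ℝ (Fin d))).prod volume),
      (p : EuclideanSpace ℝ (Fin d) × EuclideanSpace ℝ (Fin d)).1 ≠ 0 :=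
    Measure.quasiMeasurePreserving_fst.ae (Measure.ae_ne volume 0)
  filter_upwards [(lintegral_eq_zero_iff (Measurable.liminf hFm)).1 h0, hne] with p hp hp0
  refine Eq.trans (Filter.liminf_congr ?_) hp
  have hp1 : 0 < ‖p.1‖ := norm_pos_iff.2 hp0
  filter_upwards [Filter.eventually_gt_atTop ⌈(‖p.1‖ ^ 2)⁻¹⌉₊, Filter.eventually_ge_atTop 1]
    with n hn hn1
  have h1 : (‖p.1‖ ^ 2)⁻¹ < n := Nat.lt_of_ceil_lt hn
  have hn0 : (0 : ℝ) < n := by exact_mod_cast hn1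
  rw [inv_lt_iff_one_lt_mul₀ (by positivity)] at h1
  have h2 : ((n : ℝ) • p.1, p.2) ∈ T n := by
    change (n : ℝ) < ‖(n : ℝ) • p.1‖ ^ 2
    rw [norm_smul, Real.norm_natCast, mul_pow]
    nlinarith
  simp only [hF, Set.indicator_of_mem h2]

namespace MvPolynomial

lemma homogeneousComponent_totalDegree_ne_zero {σ R : Type*} [CommSemiring R]
    {p : MvPolynomial σ R} (hp : p ≠ 0) : homogeneousComponent p.totalDegree p ≠ 0 := by
  obtain ⟨m, hm, hmd⟩ := Finset.exists_mem_eq_sup p.support (support_nonempty.2 hp)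
    fun s => s.sum fun _ e => e
  intro h
  have h1 := congrArg (coeff m) h
  rw [coeff_homogeneousComponent, if_pos, coeff_zero] at h1
  · exact mem_support_iff.1 hm h1
  · rw [Finsupp.degree_apply]
    exact hmd.symm

/-- Along an affine line, a polynomial grows like its top homogeneous component. -/
lemma tendsto_eval_div_pow {d : ℕ} (p : MvPolynomial (Fin d) ℂ) (ξ v : Fin d → ℂ) :
    Filter.Tendsto (fun n : ℕ => eval ((n : ℂ) • ξ + v) p / (n : ℂ) ^ p.totalDegree) Filter.atTop
      (nhds (eval ξ (homogeneousComponent p.totalDegree p))) := by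
  set m := p.totalDegree
  have hinv : Filter.Tendsto (fun n : ℕ => ((n : ℂ))⁻¹) Filter.atTop (nhds 0) :=
    tendsto_inv_atTop_nhds_zero_nat
  have hterm : ∀ k ∈ Finset.range (m + 1), Filter.Tendsto (fun n : ℕ =>
      ((n : ℂ)⁻¹) ^ (m - k) * eval (ξ + (n : ℂ)⁻¹ • v) (homogeneousComponent k p)) Filter.atTop
      (nhds (if k = m then eval ξ (homogeneousComponent m p) else 0)) := by
    intro k hk
    have h1 : Filter.Tendsto (fun n : ℕ => eval (ξ + (n : ℂ)⁻¹ • v) (homogeneousComponent k p))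
        Filter.atTop (nhds (eval ξ (homogeneousComponent k p))) := by
      refine ((homogeneousComponent k p).continuous_eval.tendsto ξ).comp ?_
      simpa using tendsto_const_nhds.add (hinv.smul (tendsto_const_nhds (x := v)))
    have h2 := (hinv.pow (m - k)).mul h1
    split_ifs with hkm
    · subst hkm
      simpa using h2
    · have : m - k ≠ 0 := by have := Finset.mem_range.1 hk; omega
      simpa [zero_pow this] using h2
  have hsum := tendsto_finsetSum _ hterm
  rw [Finset.sum_ite_eq' _ _ fun _ => eval ξ (homogeneousComponent m p),
    if_pos (Finset.self_mem_range_succ m)] at hsum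
  refine hsum.congr' ?_
  filter_upwards [Filter.eventually_ge_atTop 1] with n hn
  have hn0 : (n : ℂ) ≠ 0 := by
    have : n ≠ 0 := by omega
    exact_mod_cast this
  conv_rhs => rw [← sum_homogeneousComponent p]
  rw [map_sum, Finset.sum_div]
  refine Finset.sum_congr rfl fun k hk => ?_
  have h3 : (n : ℂ) • ξ + v = (n : ℂ) • (ξ + (n : ℂ)⁻¹ • v) := by
    rw [smul_add, smul_inv_smul₀ hn0]
  rw [h3, (homogeneousComponent_isHomogeneous k p).eval_smul]
  have h4 : (n : ℂ) ^ m = (n : ℂ) ^ k * (n : ℂ) ^ (m - k) := by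
    rw [← pow_add]; congr 1; have := Finset.mem_range.1 hk; omega
  rw [h4, inv_pow]
  field_simp

lemma exists_eval_comp_toEuclideanLin {d : ℕ} (p : MvPolynomial (Fin d) ℂ)
    (A : Matrix (Fin d) (Fin d) ℝ) :
    ∃ r : MvPolynomial (Fin d) ℂ, ∀ x : EuclideanSpace ℝ (Fin d),
      eval (fun i => (x i : ℂ)) r = eval (fun i => (Matrix.toEuclideanLin A x i : ℂ)) p := by
  refine ⟨aeval (fun i => ∑ j, C (A i j : ℂ) * X j) p, fun x => ?_⟩
  have : (eval fun i => (x i : ℂ)).comp (aeval fun i => ∑ j, C (A i j : ℂ) * X j).toRingHom =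
      eval fun i => (Matrix.toEuclideanLin A x i : ℂ) := by
    ext i
    · simp
    · simp [Matrix.ofLp_toLpLin, Matrix.toLin'_apply, Matrix.mulVec, dotProduct]
  exact DFunLike.congr_fun this p

end MvPolynomial

/-- Completing the square in `y` around `Ax`: the exponential concentrates near the graph of `A` and
no decay along it remains. -/
lemma norm_polyGaussian_mul_exp {d : ℕ} (P S : MvPolynomial (Fin d) ℂ)
    {A : Matrix (Fin d) (Fin d) ℝ} (hA : A.PosDef) (x y : EuclideanSpace ℝ (Fin d)) :
    ‖polyGaussian P A x‖ * ‖polyGaussian S A⁻¹ y‖ * Real.exp (2 * Real.pi * inner ℝ x y) =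
      ‖MvPolynomial.eval (fun i => (x i : ℂ)) P‖ * ‖MvPolynomial.eval (fun i => (y i : ℂ)) S‖ *
        Real.exp (-Real.pi * inner ℝ (Matrix.toEuclideanLin A⁻¹ (y - Matrix.toEuclideanLin A x))
          (y - Matrix.toEuclideanLin A x)) := by
  have h1 : Matrix.toEuclideanLin A⁻¹ (Matrix.toEuclideanLin A x) = x := by
    have := hA.inv.toEuclideanLin_inv x
    rwa [Matrix.nonsing_inv_nonsing_inv _ ((Matrix.isUnit_iff_isUnit_det _).1 hA.isUnit)] at this
  have h2 := hA.inv.isSymm.inner_toEuclideanLin_add y (-Matrix.toEuclideanLin A x)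
  rw [map_neg, h1, inner_neg_neg, inner_neg_left, real_inner_comm (Matrix.toEuclideanLin A x) x,
    ← sub_eq_add_neg] at h2
  rw [h2, polyGaussian, polyGaussian, norm_mul, norm_mul, Complex.norm_real, Complex.norm_real,
    Real.norm_of_nonneg (Real.exp_pos _).le, Real.norm_of_nonneg (Real.exp_pos _).le]
  have h3 : Real.exp (-Real.pi * (inner ℝ (Matrix.toEuclideanLin A⁻¹ y) y +
      2 * -inner ℝ x y + inner ℝ (Matrix.toEuclideanLin A x) x)) =
      Real.exp (-Real.pi * inner ℝ (Matrix.toEuclideanLin A x) x) *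
      Real.exp (-Real.pi * inner ℝ (Matrix.toEuclideanLin A⁻¹ y) y) *
      Real.exp (2 * Real.pi * inner ℝ x y) := by
    rw [← Real.exp_add, ← Real.exp_add]
    congr 1
    ring
  rw [h3]
  ring

lemma measurable_beurlingIntegrand_polyGaussian {d : ℕ} (N : ℝ) (P S : MvPolynomial (Fin d) ℂ)
    (A B : Matrix (Fin d) (Fin d) ℝ) :
    Measurable fun p : EuclideanSpace ℝ (Fin d) × EuclideanSpace ℝ (Fin d) =>
      ENNReal.ofReal (beurlingIntegrand N (polyGaussian P A) (polyGaussian S B) p.1 p.2) := by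
  have h1 := (continuous_polyGaussian P A).measurable
  have h2 := (continuous_polyGaussian S B).measurable
  unfold beurlingIntegrand
  have h3 : Measurable fun p : EuclideanSpace ℝ (Fin d) × EuclideanSpace ℝ (Fin d) =>
      ‖polyGaussian P A p.1‖ := (h1.comp measurable_fst).norm
  have h4 : Measurable fun p : EuclideanSpace ℝ (Fin d) × EuclideanSpace ℝ (Fin d) =>
      ‖polyGaussian S B p.2‖ := (h2.comp measurable_snd).norm
  have h5 : Measurable fun p : EuclideanSpace ℝ (Fin d) × EuclideanSpace ℝ (Fin d) =>
      Real.exp (2 * Real.pi * |inner ℝ p.1 p.2|) := by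
    refine Continuous.measurable ?_
    fun_prop
  have h6 : Measurable fun p : EuclideanSpace ℝ (Fin d) × EuclideanSpace ℝ (Fin d) =>
      (1 + ‖p.1‖ + ‖p.2‖) ^ N := by fun_prop
  exact (((h3.mul h4).div h6).mul h5).ennreal_ofReal

lemma lintegral_prod_shear {d : ℕ}
    {Ψ : EuclideanSpace ℝ (Fin d) × EuclideanSpace ℝ (Fin d) → ℝ≥0∞} (hΨ : Measurable Ψ)
    {L : EuclideanSpace ℝ (Fin d) → EuclideanSpace ℝ (Fin d)} (hL : Continuous L) :
    ∫⁻ p, Ψ (p.1, L p.1 + p.2) ∂((volume : Measure (EuclideanSpace ℝ (Fin d))).prod volume) =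
      ∫⁻ p, Ψ p ∂((volume : Measure (EuclideanSpace ℝ (Fin d))).prod volume) := by
  have h : Measurable fun p : EuclideanSpace ℝ (Fin d) × EuclideanSpace ℝ (Fin d) =>
      Ψ (p.1, L p.1 + p.2) := hΨ.comp (by fun_prop)
  rw [lintegral_prod _ h.aemeasurable, lintegral_prod _ hΨ.aemeasurable]
  exact lintegral_congr fun x => lintegral_add_left_eq_self (fun y => Ψ (x, y)) (L x)

lemma ae_exists_liminf_shear_eq_zero {d : ℕ} (hd : 1 ≤ d)
    {Ψ : EuclideanSpace ℝ (Fin d) × EuclideanSpace ℝ (Fin d) → ℝ≥0∞} (hΨ : Measurable Ψ)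
    (hfin : ∫⁻ p, Ψ p ∂((volume : Measure (EuclideanSpace ℝ (Fin d))).prod volume) < ∞)
    {L : EuclideanSpace ℝ (Fin d) → EuclideanSpace ℝ (Fin d)} (hL : Continuous L) :
    ∀ᵐ ξ : EuclideanSpace ℝ (Fin d), ∃ v : EuclideanSpace ℝ (Fin d),
      Filter.liminf (fun n : ℕ => ENNReal.ofReal ((n : ℝ) ^ d) *
        Ψ ((n : ℝ) • ξ, L ((n : ℝ) • ξ) + v)) Filter.atTop = 0 := by
  have h : Measurable fun p : EuclideanSpace ℝ (Fin d) × EuclideanSpace ℝ (Fin d) =>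
      Ψ (p.1, L p.1 + p.2) := hΨ.comp (by fun_prop)
  rw [← lintegral_prod_shear hΨ hL] at hfin
  exact (Measure.ae_ae_of_ae_prod (ae_liminf_dilate_eq_zero hd h hfin.ne)).mono
    fun ξ hξ => hξ.exists

/-- On the shifted graph the weight is at most `n^N` times a constant. Since `N ≤ d + 2m`, the
factor `n^d` together with one power `n^m` for each polynomial compensates for it. -/
lemma le_pow_mul_beurlingIntegrand {d : ℕ} {N : ℝ} (hN : 0 ≤ N) {P S : MvPolynomial (Fin d) ℂ}
    {A : Matrix (Fin d) (Fin d) ℝ} (hA : A.PosDef) {m : ℕ} (hm : N ≤ d + 2 * m)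
    (ξ v : EuclideanSpace ℝ (Fin d)) {n : ℕ} (hn : 1 ≤ n) :
    ‖MvPolynomial.eval (fun i => (((n : ℝ) • ξ) i : ℂ)) P‖ / (n : ℝ) ^ m *
      (‖MvPolynomial.eval (fun i => ((Matrix.toEuclideanLin A ((n : ℝ) • ξ) + v) i : ℂ)) S‖ /
        (n : ℝ) ^ m) *
      (Real.exp (-Real.pi * inner ℝ (Matrix.toEuclideanLin A⁻¹ v) v) /
        (1 + ‖ξ‖ + ‖Matrix.toEuclideanLin A ξ‖ + ‖v‖) ^ N) ≤
    (n : ℝ) ^ d * beurlingIntegrand N (polyGaussian P A) (polyGaussian S A⁻¹) ((n : ℝ) • ξ)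
      (Matrix.toEuclideanLin A ((n : ℝ) • ξ) + v) := by
  set x := (n : ℝ) • ξ with hx
  set y := Matrix.toEuclideanLin A x + v with hy
  set M := 1 + ‖ξ‖ + ‖Matrix.toEuclideanLin A ξ‖ + ‖v‖ with hM
  have hM0 : 0 < M := by positivity
  have hn1 : (1 : ℝ) ≤ n := by exact_mod_cast hn
  have hn0 : (0 : ℝ) < n := by linarith
  have h1 : 1 + ‖x‖ + ‖y‖ ≤ n * M := by
    have e1 : ‖x‖ = n * ‖ξ‖ := by rw [hx, norm_smul, Real.norm_natCast]
    have e2 : ‖y‖ ≤ n * ‖Matrix.toEuclideanLin A ξ‖ + ‖v‖ := by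
      refine (norm_add_le _ _).trans_eq ?_
      rw [hx, map_smul, norm_smul, Real.norm_natCast]
    have e3 : ‖v‖ ≤ n * ‖v‖ := le_mul_of_one_le_left (norm_nonneg _) hn1
    rw [e1, hM]
    linarith
  have h2 : (1 + ‖x‖ + ‖y‖) ^ N ≤ (n : ℝ) ^ d * ((n : ℝ) ^ m * (n : ℝ) ^ m) * M ^ N := by
    refine (Real.rpow_le_rpow (by positivity) h1 hN).trans ?_
    rw [Real.mul_rpow hn0.le hM0.le]
    gcongr
    refine (Real.rpow_le_rpow_of_exponent_le hn1 hm).trans_eq ?_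
    rw [← pow_add, ← pow_add, ← Real.rpow_natCast]
    congr 1
    push_cast; ring
  have h3 := norm_polyGaussian_mul_exp P S hA x y
  rw [show y - Matrix.toEuclideanLin A x = v by rw [hy]; abel] at h3
  set p := ‖MvPolynomial.eval (fun i => (x i : ℂ)) P‖
  set s := ‖MvPolynomial.eval (fun i => (y i : ℂ)) S‖
  set e := Real.exp (-Real.pi * inner ℝ (Matrix.toEuclideanLin A⁻¹ v) v)
  have h4 : p * s * e / (1 + ‖x‖ + ‖y‖) ^ N ≤
      beurlingIntegrand N (polyGaussian P A) (polyGaussian S A⁻¹) x y := by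
    rw [← h3, beurlingIntegrand, div_mul_eq_mul_div]
    gcongr
    exact le_abs_self _
  refine le_trans ?_ (mul_le_mul_of_nonneg_left h4 (by positivity))
  have hMN : 0 < M ^ N := by positivity
  calc _ = (n : ℝ) ^ d * (p * s * e / ((n : ℝ) ^ d * ((n : ℝ) ^ m * (n : ℝ) ^ m) * M ^ N)) := by
        field_simp
    _ ≤ _ := by gcongr

lemma exists_le_pow_mul_beurlingIntegrand {d : ℕ} {N : ℝ} (hN : 0 ≤ N)
    {P S : MvPolynomial (Fin d) ℂ} {A : Matrix (Fin d) (Fin d) ℝ} (hA : A.PosDef) {m : ℕ}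
    (hPm : P.totalDegree = m) (hSm : S.totalDegree = m) (hm : N ≤ d + 2 * m)
    {ξ : EuclideanSpace ℝ (Fin d)} (v : EuclideanSpace ℝ (Fin d))
    (hne : MvPolynomial.eval (fun i => (ξ i : ℂ)) (MvPolynomial.homogeneousComponent m P) *
      MvPolynomial.eval (fun i => (Matrix.toEuclideanLin A ξ i : ℂ))
        (MvPolynomial.homogeneousComponent m S) ≠ 0) :
    ∃ ε : ℝ, 0 < ε ∧ ∀ᶠ n : ℕ in Filter.atTop, ε ≤ (n : ℝ) ^ d *
      beurlingIntegrand N (polyGaussian P A) (polyGaussian S A⁻¹) ((n : ℝ) • ξ)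
        (Matrix.toEuclideanLin A ((n : ℝ) • ξ) + v) := by
  have ha := (P.tendsto_eval_div_pow (fun i => (ξ i : ℂ)) 0).norm
  have hb := (S.tendsto_eval_div_pow (fun i => (Matrix.toEuclideanLin A ξ i : ℂ))
    (fun i => (v i : ℂ))).norm
  rw [hPm] at ha
  rw [hSm] at hb
  have hab := ha.mul hb
  rw [← norm_mul] at hab
  have hL := norm_pos_iff.2 hne
  have hev := hab.eventually (lt_mem_nhds (half_lt_self hL))
  refine ⟨_, mul_pos (half_pos hL) (div_pos
    (Real.exp_pos (-Real.pi * inner ℝ (Matrix.toEuclideanLin A⁻¹ v) v))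
    (Real.rpow_pos_of_pos (x := 1 + ‖ξ‖ + ‖Matrix.toEuclideanLin A ξ‖ + ‖v‖) (by positivity) N)),
    ?_⟩
  filter_upwards [hev, Filter.eventually_ge_atTop 1] with n hn hn1
  refine le_trans ?_ (le_pow_mul_beurlingIntegrand hN hA hm ξ v hn1)
  refine mul_le_mul_of_nonneg_right ?_ (by positivity)
  refine hn.le.trans_eq ?_
  have e1 : (n : ℂ) • (fun i => (ξ i : ℂ)) + 0 = fun i => (((n : ℝ) • ξ) i : ℂ) := by
    ext i; simp
  have e2 : (n : ℂ) • (fun i => (Matrix.toEuclideanLin A ξ i : ℂ)) + (fun i => (v i : ℂ)) =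
      fun i => ((Matrix.toEuclideanLin A ((n : ℝ) • ξ) + v) i : ℂ) := by
    ext i; rw [map_smul]; simp
  rw [e1, e2, norm_div, norm_div, norm_pow, Complex.norm_natCast]

/-- If the degree were too large, the rescaled integrand would stay above a positive constant
wherever the top components of `P` at `ξ` and of `S` at `Aξ` are nonzero. Integrability makes its
liminf vanish for almost every `ξ` and some `v`, so the product of these top components would be
zero. -/
lemma totalDegree_lt_of_beurling {d : ℕ} (hd : 1 ≤ d) {N : ℝ} (hN : 0 ≤ N)
    {P S : MvPolynomial (Fin d) ℂ} (hP : P ≠ 0) (hS : S ≠ 0)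
    (hdeg : S.totalDegree = P.totalDegree) {A : Matrix (Fin d) (Fin d) ℝ} (hA : A.PosDef)
    (hI : (∫⁻ p : EuclideanSpace ℝ (Fin d) × EuclideanSpace ℝ (Fin d),
      ENNReal.ofReal (beurlingIntegrand N (polyGaussian P A) (polyGaussian S A⁻¹) p.1 p.2)
        ∂((volume : Measure (EuclideanSpace ℝ (Fin d))).prod volume)) < ∞) :
    (P.totalDegree : ℝ) < (N - d) / 2 := by
  by_contra! hle
  have hae := ae_exists_liminf_shear_eq_zero hd
    (measurable_beurlingIntegrand_polyGaussian N P S A A⁻¹) hI (continuous_toEuclideanLin A)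
  obtain ⟨R, hR⟩ := (MvPolynomial.homogeneousComponent P.totalDegree S).exists_eval_comp_toEuclideanLin A
  have hR0 : R ≠ 0 := by
    rintro rfl
    have := MvPolynomial.homogeneousComponent_totalDegree_ne_zero hS
    rw [hdeg] at this
    refine this (MvPolynomial.eq_zero_of_eval_ofReal_eq_zero fun y => ?_)
    have h1 := hR (Matrix.toEuclideanLin A⁻¹ y)
    rw [hA.toEuclideanLin_inv, map_zero] at h1
    exact h1.symm
  refine mul_ne_zero (MvPolynomial.homogeneousComponent_totalDegree_ne_zero hP) hR0
    (MvPolynomial.eq_zero_of_ae_eval_ofReal_eq_zero isOpen_univ (Set.mem_univ _) ?_)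
  rw [Measure.restrict_univ]
  filter_upwards [hae] with ξ hξ
  obtain ⟨v, hv⟩ := hξ
  by_contra hne
  rw [map_mul, hR] at hne
  obtain ⟨ε, hε, hlow⟩ := exists_le_pow_mul_beurlingIntegrand hN hA rfl hdeg (by linarith) v hne
  have hcon := Filter.le_liminf_of_le (f := Filter.atTop)
    (u := fun n : ℕ => ENNReal.ofReal ((n : ℝ) ^ d) *
      ENNReal.ofReal (beurlingIntegrand N (polyGaussian P A) (polyGaussian S A⁻¹) ((n : ℝ) • ξ)
        (Matrix.toEuclideanLin A ((n : ℝ) • ξ) + v))) (a := ENNReal.ofReal ε)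
    (by isBoundedDefault) (hlow.mono fun n hn => by
      rw [← ENNReal.ofReal_mul (by positivity)]
      exact ENNReal.ofReal_le_ofReal hn)
  rw [hv] at hcon
  exact (ENNReal.ofReal_pos.2 hε).not_ge hcon

/-! ### Sufficiency of the degree condition, and conclusion. -/

lemma lintegral_prod_mul_shear_lt_top {d : ℕ} {G H : EuclideanSpace ℝ (Fin d) → ℝ≥0∞}
    (hG : Measurable G) (hH : Measurable H) (hGf : ∫⁻ x, G x < ∞) (hHf : ∫⁻ x, H x < ∞)
    {L : EuclideanSpace ℝ (Fin d) → EuclideanSpace ℝ (Fin d)} (hL : Continuous L) :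
    ∫⁻ p, G p.1 * H (p.2 - L p.1)
      ∂((volume : Measure (EuclideanSpace ℝ (Fin d))).prod volume) < ∞ := by
  have h : Measurable fun p : EuclideanSpace ℝ (Fin d) × EuclideanSpace ℝ (Fin d) =>
      G p.1 * H (p.2 - L p.1) := (hG.comp measurable_fst).mul (hH.comp (by fun_prop))
  rw [← lintegral_prod_shear h hL]
  simp only [add_sub_cancel_left]
  rw [lintegral_prod_mul hG.aemeasurable hH.aemeasurable]
  exact ENNReal.mul_lt_top hGf hHf

/-- The absolute value in the exponent is split into its two signs, the second treated by reflecting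
`x`. The polynomials cost `2m` powers of `1 + ‖x‖ + ‖y‖`, and the remaining nonpositive power is
bounded by the same power of `1 + ‖x‖`. -/
lemma beurlingIntegrand_polyGaussian_le {d : ℕ} (P S : MvPolynomial (Fin d) ℂ)
    (hdeg : S.totalDegree = P.totalDegree) {A : Matrix (Fin d) (Fin d) ℝ} (hA : A.PosDef) {N : ℝ}
    (hN : 2 * (P.totalDegree : ℝ) ≤ N) :
    ∃ C b : ℝ, 0 ≤ C ∧ 0 < b ∧ ∀ x y,
      beurlingIntegrand N (polyGaussian P A) (polyGaussian S A⁻¹) x y ≤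
        C * ((1 + ‖x‖) ^ (-(N - 2 * P.totalDegree)) *
            Real.exp (-b * ‖y - Matrix.toEuclideanLin A x‖ ^ 2) +
          (1 + ‖x‖) ^ (-(N - 2 * P.totalDegree)) *
            Real.exp (-b * ‖y - -Matrix.toEuclideanLin A x‖ ^ 2)) := by
  obtain ⟨c, hc, hcA⟩ := hA.inv.exists_mul_sq_norm_le
  obtain ⟨C₁, hC₁, hP⟩ := P.exists_norm_eval_le
  obtain ⟨C₂, hC₂, hS⟩ := S.exists_norm_eval_le
  rw [hdeg] at hS
  set m := P.totalDegree
  refine ⟨C₁ * C₂, Real.pi * c, by positivity, by positivity, fun x y => ?_⟩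
  have hexp : ∀ v : EuclideanSpace ℝ (Fin d),
      Real.exp (-Real.pi * inner ℝ (Matrix.toEuclideanLin A⁻¹ v) v) ≤
        Real.exp (-(Real.pi * c) * ‖v‖ ^ 2) := fun v => by
    refine Real.exp_le_exp.2 ?_
    nlinarith [mul_le_mul_of_nonneg_left (hcA v) Real.pi_pos.le]
  set T := 1 + ‖x‖ + ‖y‖ with hT
  have hx := norm_nonneg x
  have hy := norm_nonneg y
  have hT0 : 0 < T := by positivity
  set p := ‖MvPolynomial.eval (fun i => (x i : ℂ)) P‖ with hp
  set s := ‖MvPolynomial.eval (fun i => (y i : ℂ)) S‖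
  have hps : p * s / T ^ N ≤ C₁ * C₂ * (1 + ‖x‖) ^ (-(N - 2 * m)) := by
    have h1 : p ≤ C₁ * T ^ m := (hP _).trans (by
      gcongr; rw [hT]; linarith [norm_ofReal_le x])
    have h2 : s ≤ C₂ * T ^ m := (hS _).trans (by
      gcongr; rw [hT]; linarith [norm_ofReal_le y])
    have h3 : T ^ (-(N - 2 * m)) ≤ (1 + ‖x‖) ^ (-(N - 2 * m)) :=
      Real.rpow_le_rpow_of_nonpos (by positivity) (by rw [hT]; linarith) (by linarith)
    have h4 : T ^ (-(N - 2 * m)) = T ^ m * T ^ m / T ^ N := by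
      rw [neg_sub, Real.rpow_sub hT0, ← pow_add, ← Real.rpow_natCast]
      congr 2
      push_cast; ring
    calc p * s / T ^ N ≤ (C₁ * T ^ m) * (C₂ * T ^ m) / T ^ N := by gcongr
      _ = C₁ * C₂ * T ^ (-(N - 2 * m)) := by rw [h4]; ring
      _ ≤ _ := by gcongr
  have e1 := norm_polyGaussian_mul_exp P S hA x y
  have e2 := norm_polyGaussian_mul_exp P.reflect S hA (-x) y
  rw [polyGaussian_reflect, MvPolynomial.eval_reflect, neg_neg, inner_neg_left, map_neg] at e2
  have hle : Real.exp (2 * Real.pi * |inner ℝ x y|) ≤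
      Real.exp (2 * Real.pi * inner ℝ x y) + Real.exp (2 * Real.pi * -inner ℝ x y) := by
    rcases abs_choice (inner ℝ x y) with h | h <;> rw [h]
    · exact le_add_of_nonneg_right (Real.exp_pos _).le
    · exact le_add_of_nonneg_left (Real.exp_pos _).le
  rw [beurlingIntegrand, div_mul_eq_mul_div]
  calc _ ≤ ‖polyGaussian P A x‖ * ‖polyGaussian S A⁻¹ y‖ *
        (Real.exp (2 * Real.pi * inner ℝ x y) + Real.exp (2 * Real.pi * -inner ℝ x y)) / T ^ N := by
        gcongr
    _ ≤ (p * s * Real.exp (-(Real.pi * c) * ‖y - Matrix.toEuclideanLin A x‖ ^ 2) +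
        p * s * Real.exp (-(Real.pi * c) * ‖y - -Matrix.toEuclideanLin A x‖ ^ 2)) / T ^ N := by
        rw [mul_add, e1, e2]
        have hps0 : 0 ≤ p * s := by positivity
        exact div_le_div_of_nonneg_right (add_le_add (mul_le_mul_of_nonneg_left (hexp _) hps0)
          (mul_le_mul_of_nonneg_left (hexp _) hps0)) (by positivity)
    _ = p * s / T ^ N * (Real.exp (-(Real.pi * c) * ‖y - Matrix.toEuclideanLin A x‖ ^ 2) +
        Real.exp (-(Real.pi * c) * ‖y - -Matrix.toEuclideanLin A x‖ ^ 2)) := by ring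
    _ ≤ C₁ * C₂ * (1 + ‖x‖) ^ (-(N - 2 * m)) *
        (Real.exp (-(Real.pi * c) * ‖y - Matrix.toEuclideanLin A x‖ ^ 2) +
        Real.exp (-(Real.pi * c) * ‖y - -Matrix.toEuclideanLin A x‖ ^ 2)) := by gcongr
    _ = _ := by ring

lemma lintegral_beurlingIntegrand_polyGaussian_lt_top {d : ℕ} (P S : MvPolynomial (Fin d) ℂ)
    (hdeg : S.totalDegree = P.totalDegree) {A : Matrix (Fin d) (Fin d) ℝ} (hA : A.PosDef) {N : ℝ}
    (hN : (P.totalDegree : ℝ) < (N - d) / 2) :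
    (∫⁻ p : EuclideanSpace ℝ (Fin d) × EuclideanSpace ℝ (Fin d),
      ENNReal.ofReal (beurlingIntegrand N (polyGaussian P A) (polyGaussian S A⁻¹) p.1 p.2)
        ∂((volume : Measure (EuclideanSpace ℝ (Fin d))).prod volume)) < ∞ := by
  have hd : (0 : ℝ) ≤ d := Nat.cast_nonneg d
  obtain ⟨C, b, hC, hb, h⟩ := beurlingIntegrand_polyGaussian_le P S hdeg hA (N := N) (by linarith)
  set G : EuclideanSpace ℝ (Fin d) → ℝ≥0∞ := fun x =>
    ENNReal.ofReal ((1 + ‖x‖) ^ (-(N - 2 * P.totalDegree)))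
  set H : EuclideanSpace ℝ (Fin d) → ℝ≥0∞ := fun v => ENNReal.ofReal (Real.exp (-b * ‖v‖ ^ 2))
  have hG : Measurable G := by fun_prop
  have hH : Measurable H := by fun_prop
  -- The degree condition says exactly that the exponent `N - 2m` exceeds the dimension.
  have hGf : ∫⁻ x, G x < ∞ := finite_integral_one_add_norm (by
    rw [finrank_euclideanSpace_fin]; linarith)
  have hHf : ∫⁻ x, H x < ∞ := by
    have := (integrable_exp_neg_mul_sq_norm (d := d) hb).lintegral_lt_top
    exact this
  have hL := continuous_toEuclideanLin A
  have h1 := lintegral_prod_mul_shear_lt_top hG hH hGf hHf hL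
  have h2 := lintegral_prod_mul_shear_lt_top hG hH hGf hHf hL.neg
  have hm1 : Measurable fun p : EuclideanSpace ℝ (Fin d) × EuclideanSpace ℝ (Fin d) =>
      G p.1 * H (p.2 - Matrix.toEuclideanLin A p.1) :=
    (hG.comp measurable_fst).mul (hH.comp
      (measurable_snd.sub (hL.measurable.comp measurable_fst)))
  refine lt_of_le_of_lt (b := ∫⁻ p, ENNReal.ofReal C *
    (G p.1 * H (p.2 - Matrix.toEuclideanLin A p.1) + G p.1 * H (p.2 - -Matrix.toEuclideanLin A p.1))
      ∂((volume : Measure (EuclideanSpace ℝ (Fin d))).prod volume))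
    (lintegral_mono fun p => ?_) ?_
  · refine (ENNReal.ofReal_le_ofReal (h p.1 p.2)).trans_eq ?_
    rw [ENNReal.ofReal_mul hC, ENNReal.ofReal_add (by positivity) (by positivity),
      ENNReal.ofReal_mul (by positivity), ENNReal.ofReal_mul (by positivity)]
  · rw [lintegral_const_mul' _ _ ENNReal.ofReal_ne_top, lintegral_add_left hm1]
    exact ENNReal.mul_lt_top ENNReal.ofReal_lt_top (ENNReal.add_lt_top.2 ⟨h1, h2⟩)

lemma lintegral_beurlingIntegrand_congr {d : ℕ} (N : ℝ) {f f' g g' : EuclideanSpace ℝ (Fin d) → ℂ}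
    (hf : f =ᵐ[volume] f') (hg : g =ᵐ[volume] g') :
    (∫⁻ p : EuclideanSpace ℝ (Fin d) × EuclideanSpace ℝ (Fin d),
      ENNReal.ofReal (beurlingIntegrand N f g p.1 p.2)
        ∂((volume : Measure (EuclideanSpace ℝ (Fin d))).prod volume)) =
    ∫⁻ p : EuclideanSpace ℝ (Fin d) × EuclideanSpace ℝ (Fin d),
      ENNReal.ofReal (beurlingIntegrand N f' g' p.1 p.2)
        ∂((volume : Measure (EuclideanSpace ℝ (Fin d))).prod volume) := by
  refine lintegral_congr_ae ?_
  filter_upwards [Measure.quasiMeasurePreserving_fst.ae hf,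
    Measure.quasiMeasurePreserving_snd.ae hg] with p h1 h2
  simp only [beurlingIntegrand, h1, h2]

lemma fourier_ae_eq_polyGaussian {d : ℕ} {P S : MvPolynomial (Fin d) ℂ}
    {A : Matrix (Fin d) (Fin d) ℝ} (hA : A.PosDef) (hS : 𝓕 (polyGaussian P A) = polyGaussian S A⁻¹)
    {f : Lp ℂ 2 (volume : Measure (EuclideanSpace ℝ (Fin d)))}
    (hf : ⇑f =ᵐ[volume] polyGaussian P A) :
    ⇑(𝓕 f : Lp ℂ 2 (volume : Measure (EuclideanSpace ℝ (Fin d)))) =ᵐ[volume]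
      polyGaussian S A⁻¹ := by
  have h : f = (memLp_polyGaussian P hA).toLp _ :=
    Lp.ext (hf.trans (memLp_polyGaussian P hA).coeFn_toLp.symm)
  rw [h, ← hS]
  exact fourier_toLp_ae_eq (integrable_polyGaussian P hA) _

theorem theorem1 (d : ℕ) (hd : 1 ≤ d) (N : ℝ) (hN : 0 ≤ N)
    (f : Lp ℂ 2 (volume : Measure (EuclideanSpace ℝ (Fin d)))) :
    ((∫⁻ p : EuclideanSpace ℝ (Fin d) × EuclideanSpace ℝ (Fin d),
          ENNReal.ofReal (beurlingIntegrand N (⇑f)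
            (⇑(𝓕 f : Lp ℂ 2 (volume : Measure (EuclideanSpace ℝ (Fin d))))) p.1 p.2)
          ∂((volume : Measure (EuclideanSpace ℝ (Fin d))).prod volume)) < ∞ ↔
      ∃ (A : Matrix (Fin d) (Fin d) ℝ) (P : MvPolynomial (Fin d) ℂ),
        A.PosDef ∧ (P = 0 ∨ (P.totalDegree : ℝ) < (N - d) / 2) ∧
          ⇑f =ᵐ[volume] polyGaussian P A) ∧
    (N ≤ d →
      (∫⁻ p : EuclideanSpace ℝ (Fin d) × EuclideanSpace ℝ (Fin d),
          ENNReal.ofReal (beurlingIntegrand N (⇑f)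
            (⇑(𝓕 f : Lp ℂ 2 (volume : Measure (EuclideanSpace ℝ (Fin d))))) p.1 p.2)
          ∂((volume : Measure (EuclideanSpace ℝ (Fin d))).prod volume)) < ∞ →
      f = 0) := by
  set I := ∫⁻ p : EuclideanSpace ℝ (Fin d) × EuclideanSpace ℝ (Fin d),
    ENNReal.ofReal (beurlingIntegrand N (⇑f)
      (⇑(𝓕 f : Lp ℂ 2 (volume : Measure (EuclideanSpace ℝ (Fin d))))) p.1 p.2)
    ∂((volume : Measure (EuclideanSpace ℝ (Fin d))).prod volume) with hIdef
  have hiff : I < ∞ ↔ ∃ (A : Matrix (Fin d) (Fin d) ℝ) (P : MvPolynomial (Fin d) ℂ),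
      A.PosDef ∧ (P = 0 ∨ (P.totalDegree : ℝ) < (N - d) / 2) ∧
        ⇑f =ᵐ[volume] polyGaussian P A := by
    constructor
    · intro hI
      by_cases hf : f = 0
      -- For `f = 0` any positive definite matrix serves, with the zero polynomial.
      · refine ⟨1, 0, Matrix.PosDef.one, Or.inl rfl, ?_⟩
        rw [hf]
        filter_upwards [Lp.coeFn_zero ℂ 2 (volume : Measure (EuclideanSpace ℝ (Fin d)))] with x hx
        rw [hx, polyGaussian, map_zero, zero_mul]; rfl
      obtain ⟨A, P, hA, hP, hfP⟩ := exists_ae_eq_polyGaussian hf hI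
      obtain ⟨S, hdeg, hS, hS'⟩ := exists_fourier_polyGaussian P hA
      refine ⟨A, P, hA, Or.inr (totalDegree_lt_of_beurling hd hN hP ?_ hdeg hA ?_), hfP⟩
      · rintro rfl
        refine hP (eq_of_polyGaussian_eq (A := A) ?_)
        have h0 : ∀ (B : Matrix (Fin d) (Fin d) ℝ) x, polyGaussian 0 B x = 0 := fun B x => by
          rw [polyGaussian, map_zero, zero_mul]
        have hr : (0 : MvPolynomial (Fin d) ℂ).reflect = 0 := map_zero _
        rw [hS', hr]
        funext x
        rw [Real.fourier_eq']
        simp [h0]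
      · rwa [← lintegral_beurlingIntegrand_congr N hfP (fourier_ae_eq_polyGaussian hA hS hfP)]
    · rintro ⟨A, P, hA, hP, hfP⟩
      obtain ⟨S, hdeg, hS, -⟩ := exists_fourier_polyGaussian P hA
      rw [hIdef, lintegral_beurlingIntegrand_congr N hfP (fourier_ae_eq_polyGaussian hA hS hfP)]
      rcases hP with rfl | hP
      · simp [beurlingIntegrand, polyGaussian]
      · exact lintegral_beurlingIntegrand_polyGaussian_lt_top P S hdeg hA hP
  refine ⟨hiff, fun hNd hI => ?_⟩
  obtain ⟨A, P, -, hP, hfP⟩ := hiff.1 hI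
  rcases hP with rfl | hP
  · refine Lp.eq_zero_iff_ae_eq_zero.2 (hfP.trans (Filter.Eventually.of_forall fun x => ?_))
    rw [polyGaussian, map_zero, zero_mul]; rfl
  -- When `N ≤ d` the bound on the degree is nonpositive, so only `P = 0` is possible.
  · have : (0 : ℝ) ≤ P.totalDegree := Nat.cast_nonneg _
    linarith
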